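/- Let $\mathtt{Sp}$ be the category of Hausdorff $C^\infty$-manifolds or of Hausdorff complex manifolds (the dimension is locally constant but may vary, and no countability is required), with the topology of open coverings. An abstract orbifold chart is a pair $(V,H)$ with $V\in\mathtt{Sp}$ and $H$ a finite group acting on $V$; a morphism $(V,H)\to(V',H')$ is a homomorphism $f_H:H\to H'$ with an $f_H$-equivariant morphism $f_V:V\to V'$ such that the induced map of stacks $[H\backslash V]\to[H'\backslash V']$ is an open embedding. An orbifold chart of a Hausdorff space $X$ is a triple $(V,H,\pi)$ with $(V,H)$ an abstract orbifold chart and $\pi:V\to X$ a continuous map identifying $V/H$ with an open subset of $X$; morphisms of charts of $X$ are required to commute with the maps to $X$. A (generalized, possibly non-effective) Satake orbifold atlas on $X$ consists of a small category $A$ in which all endomorphisms are invertible and every $\mathrm{Hom}(a,b)$ is empty or an $\mathrm{Aut}(b)$-torsor, a functor $a\mapsto c(a)=(V(a),H(a),\pi(a))$ from $A$ to the orbifold charts of $X$, and isomorphisms $\iota_a:\mathrm{Aut}(a)\to H(a)$ such that $\varphi\in\mathrm{Aut}(a)$ acts on $V(a)$ as $\iota_a(\varphi)$ and on $H(a)$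 as conjugation by $\iota_a(\varphi)$, and which are natural in $a$: if $f:a\to b$ and $f\circ\varphi=\psi\circ f$ with $\varphi\in\mathrm{Aut}(a)$, $\psi\in\mathrm{Aut}(b)$, then $c(f)_H(\iota_a(\varphi))=\iota_b(\psi)$. Moreover the images of the charts $c(a)$ cover $X$, and for each $x$ in the images of $c(a')$ and $c(a'')$ there are arrows $a\to a'$, $a\to a''$ in $A$ with $x$ in the image of $c(a)$. Theorem. For every such atlas the diagram $a\mapsto V(a)$ of representable stacks over $\mathtt{Sp}$ has a 2-colimit $[X]$ in the 2-category of stacks of groupoids over $\mathtt{Sp}$ (the realization of the atlas), and every such 2-colimit $[X]$ has the following properties. (1) $[X]$ is an orbifold, i.e. it is equivalent to the stack associated with an étale groupoid $G_1\rightrightarrows G_0$ in $\mathtt{Sp}$ that is separated (the map $(s,t):G_1\to G_0\times G_0$ is proper). (2) For every $a\in A$ the stack $[H(a)\backslash V(a)]$ associated with the transformation groupoid exists, and there is an open embedding of stacks $\hat\pi_a:[H(a)\backslash V(a)]\to[X]$ whose restriction to $V(a)$ is isomorphic to the canonical map $V(a)\to[X]$ of the 2-colimit, compatibly with the actions of $H(a)\cong\mathrm{Aut}(a)$.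 (3) The coarse space of $[X]$ is $X$: there is a bijection from the set of isomorphism classes of objects of $[X](\mathrm{point})$ onto $X$ that maps the class of a point $v\in V(a)$ to $\pi(a)(v)$ for all $a\in A$, and it is a homeomorphism when the source carries the quotient topology from $G_0$, for any étale separated groupoid $G_\bullet$ presenting $[X]$. -/

import Mathlib

open CategoryTheory Topology Set
open scoped ContDiff

universe u

namespace SatakeOrbifold

/-! ### Manifolds

`𝕜 = ℝ` gives Hausdorff `C^∞`-manifolds, `𝕜 = ℂ` gives Hausdorff complex manifolds. The dimension
is locally constant, and no countability condition is imposed. -/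

/-- A Hausdorff space with a smooth atlas; its charts take values in the spaces `𝕜ⁿ`, for varying
`n`. -/
structure Mfd (𝕜 : Type) [RCLike 𝕜] : Type (u + 1) where
  carrier : Type u
  [top : TopologicalSpace carrier]
  [t2 : T2Space carrier]
  atlas : (n : ℕ) → Set (OpenPartialHomeomorph carrier (EuclideanSpace 𝕜 (Fin n)))
  cover : ∀ x, ∃ n, ∃ e ∈ atlas n, x ∈ e.source
  compat : ∀ m n, ∀ e ∈ atlas m, ∀ e' ∈ atlas n,
    ContDiffOn 𝕜 ∞ (fun z => e' (e.symm z)) (e.target ∩ e.symm ⁻¹' e'.source)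

namespace Mfd

variable {𝕜 : Type} [RCLike 𝕜]

instance : CoeSort (Mfd.{u} 𝕜) (Type u) := ⟨Mfd.carrier⟩

instance (M : Mfd.{u} 𝕜) : TopologicalSpace M := M.top

instance (M : Mfd.{u} 𝕜) : T2Space M := M.t2

/-- Smoothness (for `𝕜 = ℂ`: holomorphy) of a map on an open subset, read in the charts. -/
structure SmoothOn {M N : Mfd.{u} 𝕜} (f : M → N) (s : Set M) : Prop where
  cont : ContinuousOn f s
  smooth : ∀ m n, ∀ e ∈ M.atlas m, ∀ e' ∈ N.atlas n,
    ContDiffOn 𝕜 ∞ (fun z => e' (f (e.symm z)))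
      (e.target ∩ e.symm ⁻¹' (s ∩ f ⁻¹' e'.source))

theorem SmoothOn.comp_on {M N P : Mfd.{u} 𝕜} {f : M → N} {g : N → P} {s : Set M} {t : Set N}
    (hg : SmoothOn g t) (hf : SmoothOn f s) (hs : IsOpen s) (ht : IsOpen t) :
    SmoothOn (fun x => g (f x)) (s ∩ f ⁻¹' t) := by
  have hst : IsOpen (s ∩ f ⁻¹' t) := hf.cont.isOpen_inter_preimage hs ht
  refine ⟨hg.cont.comp (hf.cont.mono inter_subset_left) (fun _ hx => hx.2), ?_⟩
  intro m n e he e' he' z hz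
  obtain ⟨hz1, ⟨hz2, hz3⟩, hz4⟩ := hz
  obtain ⟨k, d, hd, hx⟩ := N.cover (f (e.symm z))
  have h1 := hf.smooth m k e he d hd z ⟨hz1, hz2, hx⟩
  have hgo : IsOpen (t ∩ g ⁻¹' e'.source) := hg.cont.isOpen_inter_preimage ht e'.open_source
  have hW : IsOpen (s ∩ f ⁻¹' (d.source ∩ (t ∩ g ⁻¹' e'.source))) :=
    hf.cont.isOpen_inter_preimage hs (d.open_source.inter hgo)
  have h2 := hg.smooth k n d hd e' he' (d (f (e.symm z)))
    ⟨d.map_source hx, by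
      change d.symm (d (f (e.symm z))) ∈ t ∩ g ⁻¹' e'.source
      rw [d.left_inv hx]; exact ⟨hz3, hz4⟩⟩
  have h3 := ContDiffWithinAt.comp (g := fun w => e' (g (d.symm w)))
    (f := fun w => d (f (e.symm w))) z (s := e.target ∩ e.symm ⁻¹'
      (s ∩ f ⁻¹' (d.source ∩ (t ∩ g ⁻¹' e'.source)))) h2
    (h1.mono (fun y hy => ⟨hy.1, hy.2.1, hy.2.2.1⟩))
    (fun y hy => ⟨d.map_source hy.2.2.1, by
      change d.symm (d (f (e.symm y))) ∈ t ∩ g ⁻¹' e'.source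
      rw [d.left_inv hy.2.2.1]; exact hy.2.2.2⟩)
  have hop : IsOpen (e.target ∩ e.symm ⁻¹'
      (s ∩ f ⁻¹' (d.source ∩ (t ∩ g ⁻¹' e'.source)))) := e.symm.isOpen_inter_preimage hW
  have hmem : z ∈ e.target ∩ e.symm ⁻¹' (s ∩ f ⁻¹' (d.source ∩ (t ∩ g ⁻¹' e'.source))) :=
    ⟨hz1, hz2, hx, hz3, hz4⟩
  have h4 : ContDiffWithinAt 𝕜 ∞ (fun z => e' (g (f (e.symm z)))) (e.target ∩ e.symm ⁻¹'
      (s ∩ f ⁻¹' (d.source ∩ (t ∩ g ⁻¹' e'.source)))) z := by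
    refine h3.congr (fun y hy => ?_) ?_
    · simp only [Function.comp, d.left_inv hy.2.2.1]
    · simp only [Function.comp, d.left_inv hx]
  exact (h4.contDiffAt (hop.mem_nhds hmem)).contDiffWithinAt

theorem SmoothOn.mono {M N : Mfd.{u} 𝕜} {f : M → N} {s t : Set M} (hf : SmoothOn f t)
    (h : s ⊆ t) : SmoothOn f s :=
  ⟨hf.cont.mono h, fun m n e he e' he' => (hf.smooth m n e he e' he').mono
    (fun _ hz => ⟨hz.1, h hz.2.1, hz.2.2⟩)⟩

theorem SmoothOn.comp {M N P : Mfd.{u} 𝕜} {f : M → N} {g : N → P}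
    (hg : SmoothOn g univ) (hf : SmoothOn f univ) : SmoothOn (fun x => g (f x)) univ :=
  (hg.comp_on hf isOpen_univ isOpen_univ).mono (fun _ _ => ⟨trivial, trivial⟩)

/-- Morphisms of manifolds: smooth (holomorphic) maps. -/
@[ext]
structure Hom (M N : Mfd.{u} 𝕜) : Type u where
  toFun : M → N
  smooth : SmoothOn toFun univ

instance : Category.{u} (Mfd.{u} 𝕜) where
  Hom := Hom
  id M := ⟨fun x => x, ⟨continuousOn_id, fun m n e he e' he' => by
    simpa using M.compat m n e he e' he'⟩⟩
  comp f g := ⟨fun x => g.toFun (f.toFun x), g.smooth.comp f.smooth⟩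

instance (M N : Mfd.{u} 𝕜) : CoeFun (M ⟶ N) (fun _ => M → N) := ⟨Hom.toFun⟩

@[ext]
theorem hom_ext {M N : Mfd.{u} 𝕜} {f g : M ⟶ N} (h : ∀ x, f x = g x) : f = g :=
  Hom.ext (funext h)

@[simp]
theorem comp_apply {M N P : Mfd.{u} 𝕜} (f : M ⟶ N) (g : N ⟶ P) (x : M) : (f ≫ g) x = g (f x) :=
  rfl

@[simp]
theorem id_apply {M : Mfd.{u} 𝕜} (x : M) : (𝟙 M : M ⟶ M) x = x :=
  rfl

theorem continuous {M N : Mfd.{u} 𝕜} (f : M ⟶ N) : Continuous f :=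
  continuousOn_univ.1 f.smooth.cont

/-- Étale morphisms: local isomorphisms. -/
def Etale {M N : Mfd.{u} 𝕜} (f : M ⟶ N) : Prop :=
  ∀ x : M, ∃ e : OpenPartialHomeomorph M N, x ∈ e.source ∧ (∀ y ∈ e.source, f y = e y) ∧
    SmoothOn e.symm e.target

theorem etale_id (M : Mfd.{u} 𝕜) : Etale (𝟙 M) := fun _ =>
  ⟨OpenPartialHomeomorph.refl M, trivial, fun _ _ => rfl, (𝟙 M : M ⟶ M).smooth⟩

theorem Etale.comp {M N P : Mfd.{u} 𝕜} {f : M ⟶ N} {g : N ⟶ P} (hf : Etale f) (hg : Etale g) :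
    Etale (f ≫ g) := by
  intro x
  obtain ⟨e, hx, he, hes⟩ := hf x
  obtain ⟨d, hy, hd, hds⟩ := hg (f x)
  refine ⟨e.trans d, ⟨hx, ?_⟩, ?_, ?_⟩
  · change e x ∈ d.source
    rw [← he x hx]; exact hy
  · intro y hy
    have h1 := he y hy.1
    have h2 : f y ∈ d.source := by rw [h1]; exact hy.2
    change g (f y) = d (e y)
    rw [hd _ h2, h1]
  · exact (hes.comp_on hds d.open_target e.open_target).mono (fun z hz => ⟨hz.1, hz.2⟩)

/-- Covering families: jointly surjective families of open embeddings (injective local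
isomorphisms). -/
def IsCover {U : Mfd.{u} 𝕜} {I : Type u} {V : I → Mfd.{u} 𝕜} (f : ∀ i, V i ⟶ U) : Prop :=
  (∀ i, Etale (f i) ∧ Function.Injective (f i)) ∧ ∀ x : U, ∃ i, ∃ v : V i, f i v = x

variable (𝕜) in
/-- The one-point manifold. -/
def pt : Mfd.{u} 𝕜 where
  carrier := PUnit
  atlas _ := univ
  cover _ := ⟨0, (Homeomorph.homeomorphOfUnique PUnit
    (EuclideanSpace 𝕜 (Fin 0))).toOpenPartialHomeomorph, mem_univ _, mem_univ _⟩
  compat _ _ e _ e' _ := (contDiffOn_const (c := e' PUnit.unit)).congr (fun _ _ => rfl)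

/-- The morphism from the one-point manifold with value `x`. -/
def point {M : Mfd.{u} 𝕜} (x : M) : pt.{u} 𝕜 ⟶ M where
  toFun _ := x
  smooth := ⟨continuousOn_const, fun _ _ _ _ _ _ => contDiffOn_const⟩

open Classical in
/-- The coproduct (disjoint union) of a family of manifolds. -/
noncomputable def sigma {I : Type u} (V : I → Mfd.{u} 𝕜) : Mfd.{u} 𝕜 where
  carrier := Σ i, V i
  atlas n := {E | ∃ i, ∃ e ∈ (V i).atlas n,
    E = e.lift_openEmbedding (f := Sigma.mk (β := fun i => (V i).carrier) i)
      IsOpenEmbedding.sigmaMk}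
  cover := by
    rintro ⟨i, v⟩
    obtain ⟨n, e, he, hv⟩ := (V i).cover v
    exact ⟨n, _, ⟨i, e, he, rfl⟩, ⟨v, hv, rfl⟩⟩
  compat := by
    rintro m n _ ⟨i, e, he, rfl⟩ _ ⟨j, e', he', rfl⟩
    by_cases hij : i = j
    · subst hij
      refine ((V i).compat m n e he e' he').congr_mono ?_ ?_
      · intro z hz
        exact OpenPartialHomeomorph.lift_openEmbedding_apply _ _
      · rintro z ⟨hz, y, hy, hyz⟩
        refine ⟨hz, ?_⟩
        have : y = e.symm z := by
          simpa [OpenPartialHomeomorph.lift_openEmbedding_symm] using hyz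
        subst this
        exact hy
    · intro z hz
      obtain ⟨-, y, -, hyz⟩ := hz
      exact absurd (congrArg Sigma.fst hyz).symm hij

/-- A continuous map into a disjoint union of copies of `V` is smooth if its projection to `V`
is. -/
theorem smooth_sigma {I : Type u} {M V : Mfd.{u} 𝕜} (F : M → sigma (fun _ : I => V))
    (hF : Continuous F) (p : M ⟶ V) (hp : ∀ x, (F x).2 = p x) : SmoothOn F univ := by
  refine ⟨hF.continuousOn, ?_⟩
  rintro m n e he E ⟨j, e', he', hE⟩
  subst hE
  have key : ∀ z ∈ e.target ∩ e.symm ⁻¹' (univ ∩ F ⁻¹'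
      (e'.lift_openEmbedding (f := Sigma.mk (β := fun _ : I => V.carrier) j)
        IsOpenEmbedding.sigmaMk).source), ∃ y ∈ e'.source, F (e.symm z) = ⟨j, y⟩ := by
    rintro z ⟨-, -, y, hy, hyz⟩
    exact ⟨y, hy, hyz.symm⟩
  refine (p.smooth.smooth m n e he e' he').congr_mono ?_ ?_
  · intro z hz
    obtain ⟨y, -, hyz⟩ := key z hz
    have h2 := hp (e.symm z)
    rw [hyz] at h2
    simp only [hyz]
    rw [← h2]
    exact OpenPartialHomeomorph.lift_openEmbedding_apply _ _
  · intro z hz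
    obtain ⟨y, hy, hyz⟩ := key z hz
    have h2 := hp (e.symm z)
    rw [hyz] at h2
    refine ⟨hz.1, trivial, ?_⟩
    change p (e.symm z) ∈ e'.source
    rw [← h2]
    exact hy

/-- The morphism out of a disjoint union with given restrictions. -/
noncomputable def sigmaDesc {I : Type u} {V : I → Mfd.{u} 𝕜} {N : Mfd.{u} 𝕜} (p : ∀ i, V i ⟶ N) :
    sigma V ⟶ N where
  toFun x := p x.1 x.2
  smooth := by
    refine ⟨(continuous_sigma (fun i => continuous (p i))).continuousOn, ?_⟩
    rintro m n E ⟨i, e, he, hE⟩ e' he'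
    subst hE
    exact (p i).smooth.smooth m n e he e' he'

theorem continuous_sigma_copies {I : Type u} {M V : Mfd.{u} 𝕜} (a : M → I) (v : M → V)
    (ha : IsLocallyConstant a) (hv : Continuous v) :
    Continuous (fun x => (⟨a x, v x⟩ : sigma (fun _ : I => V))) := by
  rw [continuous_iff_continuousAt]
  intro x
  have h1 : Continuous (fun y => (⟨a x, v y⟩ : sigma (fun _ : I => V))) :=
    (continuous_sigmaMk (σ := fun _ : I => V.carrier) (i := a x)).comp hv
  refine h1.continuousAt.congr ?_
  filter_upwards [ha.eventually_eq x] with y hy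
  rw [hy]

theorem isLocallyConstant_fst {I : Type u} (V : I → Mfd.{u} 𝕜) :
    IsLocallyConstant (fun x : sigma V => x.1) := by
  intro s
  exact isOpen_sigma_fst_preimage (σ := fun i => (V i).carrier) s

end Mfd

open Mfd

/-! ### Groupoids over the category of manifolds, and stacks -/

section Stacks

variable {𝕜 : Type} [RCLike 𝕜]

/-- A category over the category of manifolds is fibred in groupoids. -/
structure IsGroupoidOver (𝒳 : BasedCategory.{u, u + 1} (Mfd.{u} 𝕜)) : Prop where
  lift : ∀ (x : 𝒳.obj) (U : Mfd.{u} 𝕜) (α : U ⟶ 𝒳.p.obj x),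
    ∃ (y : 𝒳.obj) (a : y ⟶ x), 𝒳.p.IsHomLift α a
  factor : ∀ (x y z : 𝒳.obj) (a : y ⟶ x) (b : z ⟶ x) (γ : 𝒳.p.obj y ⟶ 𝒳.p.obj z),
    𝒳.p.map a = γ ≫ 𝒳.p.map b → ∃! c : y ⟶ z, c ≫ b = a ∧ 𝒳.p.map c = γ

/-- Morphisms glue uniquely: for `x`, `y` and `α : p x ⟶ p y`, the morphisms `x ⟶ y` over `α`
form a sheaf. The restriction of `x` to the member `V i` of a covering is presented by an arrow
`ρ i : xs i ⟶ x` over `V i ⟶ U`. -/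
def HomsGlue (𝒳 : BasedCategory.{u, u + 1} (Mfd.{u} 𝕜)) : Prop :=
  ∀ (x y : 𝒳.obj) (α : 𝒳.p.obj x ⟶ 𝒳.p.obj y) (I : Type u) (V : I → Mfd.{u} 𝕜)
    (f : ∀ i, V i ⟶ 𝒳.p.obj x), IsCover f →
    ∀ (xs : I → 𝒳.obj) (ρ : ∀ i, xs i ⟶ x) (φ : ∀ i, xs i ⟶ y),
      (∀ i, 𝒳.p.IsHomLift (f i) (ρ i)) → (∀ i, 𝒳.p.IsHomLift (f i ≫ α) (φ i)) →
      (∀ i j (z : 𝒳.obj) (a : z ⟶ xs i) (b : z ⟶ xs j), a ≫ ρ i = b ≫ ρ j → a ≫ φ i = b ≫ φ j) →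
      ∃! ψ : x ⟶ y, 𝒳.p.map ψ = α ∧ ∀ i, ρ i ≫ ψ = φ i

/-- Objects glue: local data are objects `x i` over the members `V i` of a covering of `U`, with
isomorphisms between their restrictions to the overlaps `W i j = V i ×_U V j`, satisfying the
cocycle condition. The isomorphism `x i |_{W i j} ≅ x j |_{W i j}` is presented by an object
`w i j` over `W i j` with arrows to `x i` and `x j` over the two projections. -/
def ObjectsGlue (𝒳 : BasedCategory.{u, u + 1} (Mfd.{u} 𝕜)) : Prop :=
  ∀ (U : Mfd.{u} 𝕜) (I : Type u) (V : I → Mfd.{u} 𝕜) (f : ∀ i, V i ⟶ U), IsCover f →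
    ∀ (W : I → I → Mfd.{u} 𝕜) (p₁ : ∀ i j, W i j ⟶ V i) (p₂ : ∀ i j, W i j ⟶ V j),
      (∀ i j, IsPullback (p₁ i j) (p₂ i j) (f i) (f j)) →
      ∀ (x : I → 𝒳.obj) (w : I → I → 𝒳.obj) (l : ∀ i j, w i j ⟶ x i) (r : ∀ i j, w i j ⟶ x j),
        (∀ i, 𝒳.p.obj (x i) = V i) →
        (∀ i j, 𝒳.p.IsHomLift (p₁ i j) (l i j)) → (∀ i j, 𝒳.p.IsHomLift (p₂ i j) (r i j)) →
        (∀ i j k (z : 𝒳.obj) (a : z ⟶ w i j) (b : z ⟶ w j k) (c : z ⟶ w i k),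
          a ≫ r i j = b ≫ l j k → a ≫ l i j = c ≫ l i k → c ≫ r i k = b ≫ r j k) →
        ∃ (y : 𝒳.obj) (ρ : ∀ i, x i ⟶ y), (∀ i, 𝒳.p.IsHomLift (f i) (ρ i)) ∧
          ∀ i j, l i j ≫ ρ i = r i j ≫ ρ j

/-- Stacks (of groupoids) over the category of manifolds with the topology of open coverings. -/
structure IsStack (𝒳 : BasedCategory.{u, u + 1} (Mfd.{u} 𝕜)) : Prop where
  groupoid : IsGroupoidOver 𝒳
  homs : HomsGlue 𝒳
  objects : ObjectsGlue 𝒳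

/-- `ℓ : 𝒜 ⥤ᵇ 𝒳` exhibits `𝒳` as the stack associated with `𝒜`: the target is a stack, its
objects are locally in the image of `ℓ`, and the sheaves of morphisms between objects in the image
are the sheafifications of the presheaves of morphisms of `𝒜`. -/
structure IsAssociatedStack {𝒜 𝒳 : BasedCategory.{u, u + 1} (Mfd.{u} 𝕜)} (ℓ : 𝒜 ⥤ᵇ 𝒳) :
    Prop where
  isStack : IsStack 𝒳
  locally_surj : ∀ x : 𝒳.obj, ∃ (I : Type u) (V : I → Mfd.{u} 𝕜) (f : ∀ i, V i ⟶ 𝒳.p.obj x)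
    (q : I → 𝒜.obj) (φ : ∀ i, ℓ.obj (q i) ⟶ x), IsCover f ∧ ∀ i, 𝒳.p.IsHomLift (f i) (φ i)
  locally_full : ∀ (p q : 𝒜.obj) (χ : ℓ.obj p ⟶ ℓ.obj q),
    ∃ (I : Type u) (V : I → Mfd.{u} 𝕜) (f : ∀ i, V i ⟶ 𝒜.p.obj p) (r : I → 𝒜.obj)
      (ρ : ∀ i, r i ⟶ p) (φ : ∀ i, r i ⟶ q), IsCover f ∧ (∀ i, 𝒜.p.IsHomLift (f i) (ρ i)) ∧
        ∀ i, ℓ.map (φ i) = ℓ.map (ρ i) ≫ χ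
  locally_faithful : ∀ (p q : 𝒜.obj) (φ ψ : p ⟶ q), ℓ.map φ = ℓ.map ψ →
    ∃ (I : Type u) (V : I → Mfd.{u} 𝕜) (f : ∀ i, V i ⟶ 𝒜.p.obj p) (r : I → 𝒜.obj)
      (ρ : ∀ i, r i ⟶ p), IsCover f ∧ (∀ i, 𝒜.p.IsHomLift (f i) (ρ i)) ∧
        ∀ i, ρ i ≫ φ = ρ i ≫ ψ

/-- The functor `Hom(𝒳, 𝒵) ⥤ Hom(𝒜, 𝒵)` of precomposition with `ℓ`, between categories of functors
over the category of manifolds. -/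
def precomp {𝒜 𝒳 : BasedCategory.{u, u + 1} (Mfd.{u} 𝕜)} (ℓ : 𝒜 ⥤ᵇ 𝒳)
    (𝒵 : BasedCategory.{u, u + 1} (Mfd.{u} 𝕜)) : (𝒳 ⥤ᵇ 𝒵) ⥤ (𝒜 ⥤ᵇ 𝒵) where
  obj F := ℓ.comp F
  map η := BasedCategory.whiskerLeft ℓ η
  map_id _ := rfl
  map_comp _ _ := rfl

/-- For an object `y` of `𝒴` over `M`, the functor to `𝒴` that it defines has a 2-fibre product
with `F : 𝒳 ⥤ᵇ 𝒴`: its objects are the objects `x` of `𝒳` with an arrow `F x ⟶ y` (i.e. a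
morphism `u` to `M` with an isomorphism from `F x` to `u^* y`). This is its projection to `M`,
that is, to the category of manifolds over `M`. -/
def fibreProj {𝒳 𝒴 : BasedCategory.{u, u + 1} (Mfd.{u} 𝕜)} (F : 𝒳 ⥤ᵇ 𝒴) (y : 𝒴.obj) :
    CostructuredArrow F.toFunctor y ⥤ Over (𝒴.p.obj y) :=
  CostructuredArrow.toOver F.toFunctor y ⋙ Over.post 𝒴.p

/-- Open embeddings of stacks: every base change to a manifold `M` is an open subset `W` of `M`,
i.e. the projection of the 2-fibre product to `M` is an equivalence onto the category of manifolds
over `M` that map into `W`. -/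
def IsOpenEmb {𝒳 𝒴 : BasedCategory.{u, u + 1} (Mfd.{u} 𝕜)} (F : 𝒳 ⥤ᵇ 𝒴) : Prop :=
  ∀ y : 𝒴.obj, (fibreProj F y).Full ∧ (fibreProj F y).Faithful ∧
    ∃ W : Set (𝒴.p.obj y), IsOpen W ∧
      ∀ v : Over (𝒴.p.obj y), (fibreProj F y).essImage v ↔ range v.hom ⊆ W

end Stacks

/-! ### Groupoids in the category of manifolds, and orbifolds -/

section Groupoids

/-- A groupoid in the category of manifolds. The composition is given on `M`-valued points,
naturally in `M`: `comp f g` is `f` followed by `g`. By the Yoneda lemma this is a morphism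
`G₁ ×_{G₀} G₁ ⟶ G₁` as soon as the fibre product exists, for instance for étale `s`, `t`. -/
structure GroupoidIn (𝕜 : Type) [RCLike 𝕜] : Type (u + 1) where
  G₀ : Mfd.{u} 𝕜
  G₁ : Mfd.{u} 𝕜
  s : G₁ ⟶ G₀
  t : G₁ ⟶ G₀
  one : G₀ ⟶ G₁
  inv : G₁ ⟶ G₁
  comp : ∀ {M : Mfd.{u} 𝕜} (f g : M ⟶ G₁), f ≫ t = g ≫ s → (M ⟶ G₁)
  comp_nat : ∀ {M N : Mfd.{u} 𝕜} (k : N ⟶ M) (f g : M ⟶ G₁) (h : f ≫ t = g ≫ s)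
    (h' : (k ≫ f) ≫ t = (k ≫ g) ≫ s), k ≫ comp f g h = comp (k ≫ f) (k ≫ g) h'
  one_s : one ≫ s = 𝟙 G₀
  one_t : one ≫ t = 𝟙 G₀
  comp_s : ∀ {M : Mfd.{u} 𝕜} (f g : M ⟶ G₁) (h : f ≫ t = g ≫ s), comp f g h ≫ s = f ≫ s
  comp_t : ∀ {M : Mfd.{u} 𝕜} (f g : M ⟶ G₁) (h : f ≫ t = g ≫ s), comp f g h ≫ t = g ≫ t
  one_comp : ∀ {M : Mfd.{u} 𝕜} (f : M ⟶ G₁) (h : ((f ≫ s) ≫ one) ≫ t = f ≫ s),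
    comp ((f ≫ s) ≫ one) f h = f
  comp_one : ∀ {M : Mfd.{u} 𝕜} (f : M ⟶ G₁) (h : f ≫ t = ((f ≫ t) ≫ one) ≫ s),
    comp f ((f ≫ t) ≫ one) h = f
  assoc : ∀ {M : Mfd.{u} 𝕜} (f g k : M ⟶ G₁) (h₁ : f ≫ t = g ≫ s) (h₂ : g ≫ t = k ≫ s)
    (h₃ : comp f g h₁ ≫ t = k ≫ s) (h₄ : f ≫ t = comp g k h₂ ≫ s),
    comp (comp f g h₁) k h₃ = comp f (comp g k h₂) h₄
  inv_s : inv ≫ s = t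
  inv_t : inv ≫ t = s
  comp_inv : ∀ {M : Mfd.{u} 𝕜} (f : M ⟶ G₁) (h : f ≫ t = (f ≫ inv) ≫ s),
    comp f (f ≫ inv) h = (f ≫ s) ≫ one
  inv_comp : ∀ {M : Mfd.{u} 𝕜} (f : M ⟶ G₁) (h : (f ≫ inv) ≫ t = f ≫ s),
    comp (f ≫ inv) f h = (f ≫ t) ≫ one

variable {𝕜 : Type} [RCLike 𝕜]

namespace GroupoidIn

/-- Étale groupoids: source and target are étale. -/
def IsEtale (G : GroupoidIn.{u} 𝕜) : Prop := Etale G.s ∧ Etale G.t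

/-- Separated groupoids: the map `(s, t) : G₁ → G₀ × G₀` is proper. -/
def IsSeparated (G : GroupoidIn.{u} 𝕜) : Prop := IsProperMap (fun γ : G.G₁ => (G.s γ, G.t γ))

/-- Objects of the groupoid over the category of manifolds defined by `G`: the `M`-valued points of
`G₀`, for all manifolds `M`. -/
structure Pts (G : GroupoidIn.{u} 𝕜) : Type (u + 1) where
  base : Mfd.{u} 𝕜
  map : base ⟶ G.G₀

/-- Morphisms over `u : M ⟶ N` from `x` to `y`: `M`-valued points of `G₁` from `x` to `u^* y`. -/
@[ext]
structure PtsHom {G : GroupoidIn.{u} 𝕜} (x y : G.Pts) : Type u where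
  base : x.base ⟶ y.base
  arr : x.base ⟶ G.G₁
  src : arr ≫ G.s = x.map
  tgt : arr ≫ G.t = base ≫ y.map

theorem comp_congr (G : GroupoidIn.{u} 𝕜) {M : Mfd.{u} 𝕜} {f f' g g' : M ⟶ G.G₁}
    (h : f ≫ G.t = g ≫ G.s) (hf : f = f') (hg : g = g') :
    G.comp f g h = G.comp f' g' (by rw [← hf, ← hg, h]) := by
  subst hf hg; rfl

instance (G : GroupoidIn.{u} 𝕜) : Category.{u} G.Pts where
  Hom := PtsHom
  id x := ⟨𝟙 _, x.map ≫ G.one, by rw [Category.assoc, G.one_s, Category.comp_id],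
    by rw [Category.assoc, G.one_t, Category.comp_id, Category.id_comp]⟩
  comp {x y z} a b := ⟨a.base ≫ b.base,
    G.comp a.arr (a.base ≫ b.arr) (by rw [a.tgt, Category.assoc, b.src]),
    by rw [G.comp_s, a.src],
    by rw [G.comp_t, Category.assoc, b.tgt, Category.assoc]⟩
  id_comp {x y} a := by
    refine PtsHom.ext (Category.id_comp _) ?_
    have h : (a.arr ≫ G.s) ≫ G.one = x.map ≫ G.one := by rw [a.src]
    exact (G.comp_congr _ h.symm (Category.id_comp _)).trans
      (G.one_comp a.arr (by rw [Category.assoc, G.one_t, Category.comp_id]))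
  comp_id {x y} a := by
    refine PtsHom.ext (Category.comp_id _) ?_
    have h : a.base ≫ y.map ≫ G.one = (a.arr ≫ G.t) ≫ G.one := by rw [a.tgt, Category.assoc]
    exact (G.comp_congr _ rfl h).trans
      (G.comp_one a.arr (by rw [Category.assoc, G.one_s, Category.comp_id]))
  assoc {x y z w} a b c := by
    refine PtsHom.ext (Category.assoc _ _ _) ?_
    have h1 : b.arr ≫ G.t = (b.base ≫ c.arr) ≫ G.s := by rw [b.tgt, Category.assoc, c.src]
    have h2 : (a.base ≫ b.arr) ≫ G.t = (a.base ≫ b.base ≫ c.arr) ≫ G.s := by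
      rw [Category.assoc, h1]; simp only [Category.assoc]
    have h3 := G.comp_nat a.base b.arr (b.base ≫ c.arr) h1 h2
    have h4 : a.arr ≫ G.t = (a.base ≫ b.arr) ≫ G.s := by rw [a.tgt, Category.assoc, b.src]
    refine (G.comp_congr _ rfl (Category.assoc _ _ _)).trans ?_
    refine (G.assoc a.arr (a.base ≫ b.arr) (a.base ≫ b.base ≫ c.arr) h4 h2
      (by rw [G.comp_t, h2]) (by rw [G.comp_s, h4])).trans ?_
    exact (G.comp_congr _ rfl h3).symm

/-- The groupoid over the category of manifolds defined by a groupoid in it. -/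
def toBased (G : GroupoidIn.{u} 𝕜) : BasedCategory.{u, u + 1} (Mfd.{u} 𝕜) where
  obj := G.Pts
  p := { obj := Pts.base, map := PtsHom.base }

end GroupoidIn

/-- Orbifolds: stacks that are equivalent to the stack associated with an étale separated groupoid,
i.e. that are presented by such a groupoid. -/
def IsOrbifold (𝒳 : BasedCategory.{u, u + 1} (Mfd.{u} 𝕜)) : Prop :=
  IsStack 𝒳 ∧ ∃ G : GroupoidIn.{u} 𝕜, G.IsEtale ∧ G.IsSeparated ∧
    ∃ α : G.toBased ⥤ᵇ 𝒳, IsAssociatedStack α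

/-- The underlying set of the coarse space of a stack: the connected components of its groupoid of
points. -/
def Coarse (𝒳 : BasedCategory.{u, u + 1} (Mfd.{u} 𝕜)) : Type (u + 1) :=
  CategoryTheory.ConnectedComponents (𝒳.p.Fiber (pt.{u} 𝕜))

/-- The class in the coarse space of an object over the one-point manifold. -/
def coarseMk {𝒳 : BasedCategory.{u, u + 1} (Mfd.{u} 𝕜)} (x : 𝒳.obj) (hx : 𝒳.p.obj x = pt.{u} 𝕜) :
    Coarse 𝒳 :=
  Quotient.mk _ (Functor.Fiber.mk hx : 𝒳.p.Fiber (pt.{u} 𝕜))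

/-- The natural map from the space of objects of a groupoid to the coarse space of a stack which it
presents. -/
def coarseMap {G : GroupoidIn.{u} 𝕜} {𝒳 : BasedCategory.{u, u + 1} (Mfd.{u} 𝕜)}
    (α : G.toBased ⥤ᵇ 𝒳) (x : G.G₀) : Coarse 𝒳 :=
  coarseMk (α.obj (⟨pt.{u} 𝕜, point x⟩ : G.Pts)) (α.w_obj _)

/-- The topology of the coarse space, as a quotient of the space of objects of a presentation. -/
@[reducible] def coarseTopology {G : GroupoidIn.{u} 𝕜} {𝒳 : BasedCategory.{u, u + 1} (Mfd.{u} 𝕜)}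
    (α : G.toBased ⥤ᵇ 𝒳) : TopologicalSpace (Coarse 𝒳) :=
  TopologicalSpace.coinduced (coarseMap α) inferInstance

end Groupoids

/-! ### Orbifold charts and atlases -/

section Charts

/-- Abstract orbifold charts: a finite group acting on a manifold. (Products in `Aut V` are
compositions of maps, so that `ρ` is a left action.) -/
structure AbstractChart (𝕜 : Type) [RCLike 𝕜] : Type (u + 1) where
  V : Mfd.{u} 𝕜
  H : Type u
  [group : Group H]
  [finite : Finite H]
  ρ : H →* Aut V

variable {𝕜 : Type} [RCLike 𝕜]

instance (C : AbstractChart.{u} 𝕜) : Group C.H := C.group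

instance (C : AbstractChart.{u} 𝕜) : Finite C.H := C.finite

namespace AbstractChart

/-- The action of `H` on the points of `V`. -/
def act (C : AbstractChart.{u} 𝕜) (h : C.H) (v : C.V) : C.V := (C.ρ h).hom v

theorem act_one (C : AbstractChart.{u} 𝕜) (v : C.V) : C.act 1 v = v := by
  simp only [act, map_one]; rfl

theorem act_mul (C : AbstractChart.{u} 𝕜) (g h : C.H) (v : C.V) :
    C.act (g * h) v = C.act g (C.act h v) := by
  simp only [act, map_mul]; rfl

/-- Morphisms of abstract orbifold charts: equivariant pairs which induce an open embedding of
global quotients `[H\V] → [H'\V']`. After the base change `V' → [H'\V']` the latter becomes the map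
`[H\(H' × V)] → V'`; it is an open embedding if and only if the kernel of `H → H'` acts freely on
`V` and the induced map from the quotient manifold `H' ×^H V` to `V'` is an open embedding, i.e. is
étale and injective. Injectivity of `H' ×^H V → V'` is spelled out on representatives. -/
@[ext]
structure Hom (C D : AbstractChart.{u} 𝕜) : Type u where
  fV : C.V ⟶ D.V
  fH : C.H →* D.H
  equivariant : ∀ h, (C.ρ h).hom ≫ fV = fV ≫ (D.ρ (fH h)).hom
  etale : Etale fV
  free : ∀ (h : C.H) (v : C.V), fH h = 1 → C.act h v = v → h = 1
  inj : ∀ (v w : C.V) (k : D.H), D.act k (fV v) = fV w → ∃ h, fH h = k ∧ C.act h v = w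

/-- The transformation groupoid `(H\V)_•` of a chart: objects `V`, arrows `H × V` (the disjoint
union of copies of `V` indexed by `H`), with source `(h, v) ↦ v` and target `(h, v) ↦ h v`. -/
noncomputable def transGroupoid (C : AbstractChart.{u} 𝕜) : GroupoidIn.{u} 𝕜 where
  G₀ := C.V
  G₁ := sigma (fun _ : C.H => C.V)
  s := sigmaDesc (fun _ => 𝟙 C.V)
  t := sigmaDesc (fun h => (C.ρ h).hom)
  one := ⟨fun v => ⟨1, v⟩, smooth_sigma _
    (continuous_sigma_copies _ _ (IsLocallyConstant.const 1) continuous_id) (𝟙 _) (fun _ => rfl)⟩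
  inv := ⟨fun x => ⟨x.1⁻¹, C.act x.1 x.2⟩, smooth_sigma _
    (continuous_sigma_copies _ _ ((isLocallyConstant_fst _).comp (fun h : C.H => h⁻¹))
      (continuous (sigmaDesc (fun h => (C.ρ h).hom)))) (sigmaDesc (fun h => (C.ρ h).hom))
    (fun _ => rfl)⟩
  comp {M} f g _ := ⟨fun m => ⟨(g m).1 * (f m).1, (f m).2⟩, smooth_sigma _
    (continuous_sigma_copies _ _
      (((isLocallyConstant_fst _).comp_continuous (continuous g)).comp₂
        ((isLocallyConstant_fst _).comp_continuous (continuous f)) (fun a b : C.H => a * b))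
      (continuous (f ≫ sigmaDesc (fun _ => 𝟙 C.V)))) (f ≫ sigmaDesc (fun _ => 𝟙 C.V))
    (fun _ => rfl)⟩
  comp_nat _ _ _ _ _ := rfl
  one_s := rfl
  one_t := Mfd.hom_ext (fun v => C.act_one v)
  comp_s _ _ _ := rfl
  comp_t f g h := Mfd.hom_ext (fun m => by
    have hm : C.act (f m).1 (f m).2 = (g m).2 := congrArg (fun k => Mfd.Hom.toFun k m) h
    change C.act ((g m).1 * (f m).1) (f m).2 = C.act (g m).1 (g m).2
    rw [act_mul, hm])
  one_comp f h := Mfd.hom_ext (fun m => by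
    change (⟨(f m).1 * 1, (f m).2⟩ : Σ _ : C.H, C.V) = f m
    rw [mul_one]; rfl)
  comp_one f h := Mfd.hom_ext (fun m => by
    change (⟨1 * (f m).1, (f m).2⟩ : Σ _ : C.H, C.V) = f m
    rw [one_mul]; rfl)
  assoc f g k _ _ _ _ := Mfd.hom_ext (fun m => by
    change (⟨(k m).1 * ((g m).1 * (f m).1), (f m).2⟩ : Σ _ : C.H, C.V) =
      ⟨(k m).1 * (g m).1 * (f m).1, (f m).2⟩
    rw [mul_assoc])
  inv_s := rfl
  inv_t := Mfd.hom_ext (fun x => by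
    change C.act x.1⁻¹ (C.act x.1 x.2) = x.2
    rw [← act_mul, inv_mul_cancel, act_one])
  comp_inv f h := Mfd.hom_ext (fun m => by
    change (⟨(f m).1⁻¹ * (f m).1, (f m).2⟩ : Σ _ : C.H, C.V) = ⟨1, (f m).2⟩
    rw [inv_mul_cancel])
  inv_comp f h := Mfd.hom_ext (fun m => by
    change (⟨(f m).1 * (f m).1⁻¹, C.act (f m).1 (f m).2⟩ : Σ _ : C.H, C.V) =
      ⟨1, C.act (f m).1 (f m).2⟩
    rw [mul_inv_cancel])

theorem Hom.fV_act {C D : AbstractChart.{u} 𝕜} (f : Hom C D) (h : C.H) (v : C.V) :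
    D.act (f.fH h) (f.fV v) = f.fV (C.act h v) :=
  (congrArg (fun k => Mfd.Hom.toFun k v) (f.equivariant h)).symm

end AbstractChart

/-- Orbifold charts of a space `X`: an abstract chart with a continuous map `π : V → X` that
identifies `V/H` with an open subset of `X`. -/
structure OrbChart (𝕜 : Type) [RCLike 𝕜] (X : Type u) [TopologicalSpace X] : Type (u + 1) extends
    AbstractChart.{u} 𝕜 where
  π : V → X
  π_cont : Continuous π
  π_open : IsOpenMap π
  π_eq_iff : ∀ v w : V, π v = π w ↔ ∃ h, toAbstractChart.act h v = w

namespace OrbChart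

variable {X : Type u} [TopologicalSpace X]

/-- Morphisms of orbifold charts of `X`. -/
@[ext]
structure Hom (C D : OrbChart.{u} 𝕜 X) : Type u extends
    AbstractChart.Hom C.toAbstractChart D.toAbstractChart where
  π_comp : ∀ v, D.π (fV v) = C.π v

instance : Category.{u} (OrbChart.{u} 𝕜 X) where
  Hom := Hom
  id C :=
    { fV := 𝟙 C.V
      fH := MonoidHom.id C.H
      equivariant := fun _ => rfl
      etale := etale_id C.V
      free := fun _ _ h _ => h
      inj := fun v w k h => ⟨k, rfl, h⟩
      π_comp := fun _ => rfl }
  comp {C D E} f g :=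
    { fV := f.fV ≫ g.fV
      fH := g.fH.comp f.fH
      equivariant := fun h => by
        rw [← Category.assoc, f.equivariant, Category.assoc, g.equivariant, Category.assoc]; rfl
      etale := f.etale.comp g.etale
      free := fun h v h1 h2 => by
        refine f.free h v (g.free (f.fH h) (f.fV v) h1 ?_) h2
        rw [f.toHom.fV_act, h2]
      inj := fun v w k hk => by
        obtain ⟨h', h1, h2⟩ := g.inj (f.fV v) (f.fV w) k hk
        obtain ⟨h, h3, h4⟩ := f.inj v w h' h2
        refine ⟨h, ?_, h4⟩
        rw [MonoidHom.comp_apply, h3, h1]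
      π_comp := fun v => (g.π_comp (f.fV v)).trans (f.π_comp v) }

/-- The functor that takes a chart to its manifold. -/
def forgetV : OrbChart.{u} 𝕜 X ⥤ Mfd.{u} 𝕜 where
  obj C := C.V
  map f := f.fV

end OrbChart

/-- Chart categories: endomorphisms are invertible, and `Hom(a, b)` is a, possibly empty,
`Aut(b)`-torsor. -/
structure IsChartCategory (A : Type u) [SmallCategory A] : Prop where
  isIso : ∀ (a : A) (f : a ⟶ a), IsIso f
  torsor : ∀ (a b : A) (f g : a ⟶ b), ∃! φ : Aut b, f ≫ φ.hom = g

/-- Orbifold atlases of a space `X`, indexed by a chart category `A`. -/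
structure OrbifoldAtlas (𝕜 : Type) [RCLike 𝕜] (X : Type u) [TopologicalSpace X] (A : Type u)
    [SmallCategory A] : Type (u + 1) where
  isChartCategory : IsChartCategory A
  /-- the charts -/
  c : A ⥤ OrbChart.{u} 𝕜 X
  /-- the isomorphisms `Aut(a) ≅ H(a)` -/
  ι : ∀ a, Aut a ≃* (c.obj a).H
  /-- `φ : Aut(a)` induces the inner automorphism of `c(a)` given by `ι φ` -/
  ι_V : ∀ (a : A) (φ : Aut a), (c.map φ.hom).fV = ((c.obj a).ρ (ι a φ)).hom
  ι_H : ∀ (a : A) (φ : Aut a) (g : (c.obj a).H), (c.map φ.hom).fH g = ι a φ * g * (ι a φ)⁻¹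
  /-- `ι` is natural: if `f ∘ φ = ψ ∘ f`, i.e. `ψ = Aut(f)(φ)`, then `H(f)` maps `ι φ` to `ι ψ` -/
  ι_nat : ∀ (a b : A) (f : a ⟶ b) (φ : Aut a) (ψ : Aut b), φ.hom ≫ f = f ≫ ψ.hom →
    (c.map f).fH (ι a φ) = ι b ψ
  /-- the images of the charts cover `X` -/
  cover : ∀ x : X, ∃ a, x ∈ range (c.obj a).π
  /-- a point in the images of two charts is in the image of a chart that maps to both -/
  refines : ∀ (a' a'' : A) (x : X), x ∈ range (c.obj a').π → x ∈ range (c.obj a'').π →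
    ∃ a, Nonempty (a ⟶ a') ∧ Nonempty (a ⟶ a'') ∧ x ∈ range (c.obj a).π

end Charts

/-! ### The realization of an atlas -/

section Realization

universe w w'

variable {𝕜 : Type} [RCLike 𝕜]

/-- Objects of the total category of a diagram of manifolds `V`, regarded as a diagram of
representable stacks: morphisms `f : M ⟶ V(a)`, for all `a` and `M`. -/
structure TotalObj {A : Type w} [Category.{u} A] (V : A ⥤ Mfd.{u} 𝕜) : Type (max w (u + 1)) where
  idx : A
  base : Mfd.{u} 𝕜
  map : base ⟶ V.obj idx

/-- Morphisms of the total category: `α : a ⟶ b` and `u : M ⟶ N` with `V(α) ∘ f = g ∘ u`. -/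
@[ext]
structure TotalHom {A : Type w} [Category.{u} A] {V : A ⥤ Mfd.{u} 𝕜} (x y : TotalObj V) :
    Type u where
  idx : x.idx ⟶ y.idx
  base : x.base ⟶ y.base
  w : x.map ≫ V.map idx = base ≫ y.map

instance {A : Type w} [Category.{u} A] (V : A ⥤ Mfd.{u} 𝕜) : Category.{u} (TotalObj V) where
  Hom := TotalHom
  id x := ⟨𝟙 _, 𝟙 _, by simp⟩
  comp f g := ⟨f.idx ≫ g.idx, f.base ≫ g.base, by
    rw [V.map_comp, ← Category.assoc, f.w, Category.assoc, g.w, Category.assoc]⟩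
  id_comp f := TotalHom.ext (Category.id_comp _) (Category.id_comp _)
  comp_id f := TotalHom.ext (Category.comp_id _) (Category.comp_id _)
  assoc f g h := TotalHom.ext (Category.assoc _ _ _) (Category.assoc _ _ _)

/-- The total category of a diagram of manifolds, over the category of manifolds. -/
def total {A : Type w} [Category.{u} A] (V : A ⥤ Mfd.{u} 𝕜) :
    BasedCategory.{u, max w (u + 1)} (Mfd.{u} 𝕜) where
  obj := TotalObj V
  p := { obj := TotalObj.base, map := TotalHom.base }

/-- The functor between total categories given by the restriction of a diagram. -/
def totalMap {A : Type w} {B : Type w'} [Category.{u} A] [Category.{u} B] (F : B ⥤ A)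
    (V : A ⥤ Mfd.{u} 𝕜) : total (F ⋙ V) ⥤ᵇ total V where
  obj x := (⟨F.obj x.idx, x.base, x.map⟩ : TotalObj V)
  map {x y} f := (⟨F.map (TotalHom.idx (V := F ⋙ V) (x := x) (y := y) f),
    TotalHom.base (V := F ⋙ V) (x := x) (y := y) f,
    TotalHom.w (V := F ⋙ V) (x := x) (y := y) f⟩ : TotalHom
    (⟨F.obj x.idx, x.base, x.map⟩ : TotalObj V) ⟨F.obj y.idx, y.base, y.map⟩)
  map_id _ := TotalHom.ext (F.map_id _) rfl
  map_comp _ _ := TotalHom.ext (F.map_comp _ _) rfl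
  w := rfl

/-- `ℓ` exhibits the stack `𝒳` as the 2-colimit of the diagram of representable stacks `V(a)`.
For a stack `𝒵` (or any category fibred in groupoids), a functor `total V ⥤ᵇ 𝒵` over the category
of manifolds is the same as a cocone up to coherent isomorphism: its restrictions to the objects
with a given `a` are the legs `V(a) ⟶ 𝒵`, and the images of the morphisms `(α, id)`, which are
invertible, are the 2-isomorphisms from the leg of `a` to the composition of the leg of `b` with
`V(α)`. In other words, `𝒳` is the stack associated with the localization of the total category at
the morphisms over identities, characterized by its universal property. -/
def IsTwoColimit {A : Type u} [SmallCategory A] (V : A ⥤ Mfd.{u} 𝕜)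
    {𝒳 : BasedCategory.{u, u + 1} (Mfd.{u} 𝕜)} (ℓ : total V ⥤ᵇ 𝒳) : Prop :=
  IsStack 𝒳 ∧ ∀ 𝒵 : BasedCategory.{u, u + 1} (Mfd.{u} 𝕜), IsStack 𝒵 → (precomp ℓ 𝒵).IsEquivalence

/-- The classifying groupoid of `Aut(a)` as a subcategory of `A`. -/
def autIncl {A : Type u} [SmallCategory A] (a : A) : SingleObj (Aut a) ⥤ A where
  obj _ := a
  map φ := Iso.hom (φ : Aut a)
  map_id _ := rfl
  map_comp _ _ := rfl

namespace OrbifoldAtlas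

variable {X : Type u} [TopologicalSpace X] {A : Type u} [SmallCategory A]

/-- The diagram of manifolds `a ↦ V(a)` of an atlas. -/
def diagram (c : OrbifoldAtlas.{u} 𝕜 X A) : A ⥤ Mfd.{u} 𝕜 := c.c ⋙ OrbChart.forgetV

/-- A realization of the atlas: a 2-colimit of the stacks represented by the `V(a)`. -/
def IsRealization (c : OrbifoldAtlas.{u} 𝕜 X A) {𝒳 : BasedCategory.{u, u + 1} (Mfd.{u} 𝕜)}
    (ℓ : total c.diagram ⥤ᵇ 𝒳) : Prop :=
  IsTwoColimit c.diagram ℓ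

/-- The transformation groupoid of the chart `c(a)`, over the category of manifolds. -/
noncomputable def chartGroupoid (c : OrbifoldAtlas.{u} 𝕜 X A) (a : A) :
    BasedCategory.{u, u + 1} (Mfd.{u} 𝕜) :=
  (c.c.obj a).toAbstractChart.transGroupoid.toBased

/-- The part of the total category with index `a` and automorphisms of `a`. -/
def cell (c : OrbifoldAtlas.{u} 𝕜 X A) (a : A) : BasedCategory.{u, u + 1} (Mfd.{u} 𝕜) :=
  total (autIncl a ⋙ c.diagram)

/-- The inclusion of `cell a` into the total category. -/
def cellToTotal (c : OrbifoldAtlas.{u} 𝕜 X A) (a : A) : c.cell a ⥤ᵇ total c.diagram :=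
  totalMap (autIncl a) c.diagram

/-- The functor from `cell a` to the transformation groupoid of `c(a)`: it is the identity on
objects and takes `φ : Aut(a)` to the constant `ι φ ∈ H(a)`. -/
noncomputable def cellToChart (c : OrbifoldAtlas.{u} 𝕜 X A) (a : A) :
    c.cell a ⥤ᵇ c.chartGroupoid a where
  obj x := (⟨TotalObj.base x, TotalObj.map x⟩ :
    (c.c.obj a).toAbstractChart.transGroupoid.Pts)
  map {x y} f :=
    { base := TotalHom.base f
      arr := ⟨fun m => ⟨c.ι a (TotalHom.idx f), (TotalObj.map x).toFun m⟩, smooth_sigma _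
        (continuous_sigma_copies _ _ (IsLocallyConstant.const _)
          (Mfd.continuous (TotalObj.map x))) (TotalObj.map x) (fun _ => rfl)⟩
      src := rfl
      tgt := Mfd.hom_ext (fun m => by
        have h1 := congrArg (fun k => Mfd.Hom.toFun k m) (TotalHom.w f)
        have h2 := congrArg (fun k => Mfd.Hom.toFun k ((TotalObj.map x).toFun m))
          (c.ι_V a (TotalHom.idx f))
        exact h2.symm.trans h1) }
  map_id x := by
    refine GroupoidIn.PtsHom.ext rfl (Mfd.hom_ext (fun m => ?_))
    exact congrArg (fun h => (⟨h, (TotalObj.map x).toFun m⟩ :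
      Σ _ : (c.c.obj a).H, (c.c.obj a).V)) (map_one (c.ι a))
  map_comp {x y z} f g := by
    refine GroupoidIn.PtsHom.ext rfl (Mfd.hom_ext (fun m => ?_))
    exact congrArg (fun h => (⟨h, (TotalObj.map x).toFun m⟩ :
      Σ _ : (c.c.obj a).H, (c.c.obj a).V))
      ((c.ι a).map_mul (TotalHom.idx g) (TotalHom.idx f))
  w := rfl

/-- The class in the coarse space of `𝒳` of the image of a point `v` of `V(a)`. -/
def coarsePoint (c : OrbifoldAtlas.{u} 𝕜 X A) {𝒳 : BasedCategory.{u, u + 1} (Mfd.{u} 𝕜)}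
    (ℓ : total c.diagram ⥤ᵇ 𝒳) (a : A) (v : (c.c.obj a).V) : Coarse 𝒳 :=
  coarseMk (ℓ.obj (⟨a, pt.{u} 𝕜, point v⟩ : TotalObj c.diagram)) (ℓ.w_obj _)

end OrbifoldAtlas

end Realization

end SatakeOrbifold

/-! ### Étale morphisms and open submanifolds -/

namespace SatakeOrbifold

namespace Mfd

variable {𝕜 : Type} [RCLike 𝕜]

/-! The points of the orbifold are read off from the category of elements of `a ↦ V(a)`, whose
objects are pairs of a chart and a point of it. The axioms of an atlas give this category a calculus
of right fractions for the class of all arrows. Chart points with the same image in `X` are joined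
by a span, because a common refinement exists and its arrows can be corrected by automorphisms of
the charts (`exists_span_of_proj_eq`). Injectivity of `H' ×^H V → V'` and the torsor condition turn
such a span into a commutative square (`exists_aut_comp`, `elt_ore`). Freeness of the kernel of `H →
H'` gives cancellation (`eq_of_comp_eq`).

Inverting all arrows yields a groupoid whose arrows are given by spans `d ⟶ a`, `d ⟶ b` and points
of `V(d)`. The maps `V(f)` are étale, so the spans are étale charts on the set of arrows, which
becomes a manifold, étale over the objects by source and by target. Cancellation makes it Hausdorff.
The map `(s, t)` is proper because `X` is Hausdorff and because the arrows near a given pair of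
endpoints lie on finitely many sheets, one for each element of the finite group `Aut(b)`.

On the side of stacks the central notion is `IsLocalEquiv`. Arrows and objects of a stack glue, so
precomposition with a local equivalence into a stack is an equivalence on categories of functors to
stacks (`exists_extension`, `precomp_full`, `precomp_faithful`). The stack associated with a
groupoid `G` is built from descent data: a set `P` over a manifold `M` with local sections, and a
functor from `P ×_M P` to `G`. The set `P` carries only a class of plots, because fibre products of
manifolds need not be manifolds, whereas sets with plots can be restricted and glued freely.

The total category of the diagram maps to the groupoid of the atlas by a local equivalence
(`isLocalEquiv_toGroupoid`). It is not fibred in groupoids in general; local equivalences allow for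
this by using fractions. Hence the stack associated with the groupoid is a 2-colimit, and every
2-colimit is equivalent to it (`exists_comparison`).

For a fixed `a`, two arrows `d ⟶ a` differ by an element of `Aut(a)`, so the arrows of `[X]` between
points of `V(a)` are locally given by `Aut(a) ≅ H(a)`. Both `[H(a)\V(a)]` and the full substack of
objects that are locally in the image of `V(a)` are therefore associated with `cell a`, which gives
the embedding. It is open because the maps `V(f)` are étale (`map_mem_hitSet`). Finally, points of
`[X]` are isomorphic if and only if they are joined by a span, that is, if and only if they have the
same image in `X`. The topologies agree because the projections `π(a)` are continuous and open. -/

theorem SmoothOn.congr {M N : Mfd.{u} 𝕜} {f g : M → N} {s : Set M} (hf : SmoothOn f s)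
    (h : ∀ x ∈ s, g x = f x) : SmoothOn g s := by
  refine ⟨hf.cont.congr h, fun m n e he e' he' => ?_⟩
  refine (hf.smooth m n e he e' he').congr_mono ?_ ?_
  · rintro z ⟨-, hz, -⟩
    simp only [h _ hz]
  · rintro z ⟨h1, h2, h3⟩
    refine ⟨h1, h2, ?_⟩
    change f (e.symm z) ∈ e'.source
    rw [← h _ h2]
    exact h3

theorem smoothOn_univ_of_locally {M N : Mfd.{u} 𝕜} {f : M → N}
    (h : ∀ x, ∃ s : Set M, IsOpen s ∧ x ∈ s ∧ SmoothOn f s) : SmoothOn f univ := by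
  have hc : Continuous f := by
    rw [continuous_iff_continuousAt]
    intro x
    obtain ⟨s, hs, hx, hf⟩ := h x
    exact hf.cont.continuousAt (hs.mem_nhds hx)
  refine ⟨hc.continuousOn, fun m n e he e' he' z hz => ?_⟩
  obtain ⟨s, hs, hx, hf⟩ := h (e.symm z)
  have h1 := hf.smooth m n e he e' he' z ⟨hz.1, hx, hz.2.2⟩
  have ho : IsOpen (e.target ∩ e.symm ⁻¹' (s ∩ f ⁻¹' e'.source)) :=
    e.symm.isOpen_inter_preimage (hs.inter (e'.open_source.preimage hc))
  exact (h1.contDiffAt (ho.mem_nhds ⟨hz.1, hx, hz.2.2⟩)).contDiffWithinAt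

theorem Etale.isLocalHomeomorph {M N : Mfd.{u} 𝕜} {f : M ⟶ N} (hf : Etale f) :
    IsLocalHomeomorph f := by
  refine IsLocalHomeomorph.mk _ (fun x => ?_)
  obtain ⟨e, hx, he, -⟩ := hf x
  exact ⟨e, hx, he⟩

theorem Etale.isOpenMap {M N : Mfd.{u} 𝕜} {f : M ⟶ N} (hf : Etale f) : IsOpenMap f :=
  hf.isLocalHomeomorph.isOpenMap

/-- Smoothness can be checked after composition with étale maps that jointly cover the source. -/
theorem smoothOn_univ_of_etale {M N : Mfd.{u} 𝕜} {f : M → N}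
    (h : ∀ x, ∃ (W : Mfd.{u} 𝕜) (k : W ⟶ M), Etale k ∧ x ∈ range k ∧
      SmoothOn (fun w => f (k w)) univ) : SmoothOn f univ := by
  refine smoothOn_univ_of_locally (fun x => ?_)
  obtain ⟨W, k, hk, ⟨w, rfl⟩, hf⟩ := h x
  obtain ⟨e, hw, he, hes⟩ := hk w
  have hw' : k w ∈ e.target := by rw [he w hw]; exact e.map_source hw
  refine ⟨e.target, e.open_target, hw', ?_⟩
  refine ((hf.comp_on hes e.open_target isOpen_univ).mono (fun z hz => ⟨hz, trivial⟩)).congr ?_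
  intro z hz
  rw [he _ (e.map_target hz), e.right_inv hz]

/-- A continuous map is smooth if its composition with an étale map is. -/
theorem Etale.smooth_of_comp {M N P : Mfd.{u} 𝕜} {g : N ⟶ P} (hg : Etale g) {f : M → N}
    (hf : Continuous f) (h : SmoothOn (fun x => g (f x)) univ) : SmoothOn f univ := by
  refine smoothOn_univ_of_locally (fun x => ?_)
  obtain ⟨e, hx, he, hes⟩ := hg (f x)
  refine ⟨f ⁻¹' e.source, e.open_source.preimage hf, hx, ?_⟩
  refine ((hes.comp_on h isOpen_univ e.open_target).mono (fun z hz => ⟨trivial, ?_⟩)).congr ?_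
  · change g (f z) ∈ e.target
    rw [he _ hz]; exact e.map_source hz
  · intro z hz
    rw [he _ hz, e.left_inv hz]

/-- Near `x` the map `f` is `g ∘ f` followed by a local inverse of `g`, and a local inverse of `f`
is `g` followed by a local inverse of `g ∘ f`, hence smooth. -/
theorem Etale.of_comp {M N P : Mfd.{u} 𝕜} {f : M ⟶ N} {g : N ⟶ P} (hg : Etale g)
    (hfg : Etale (f ≫ g)) : Etale f := by
  intro x
  obtain ⟨e, hx, he, hes⟩ := hfg x
  obtain ⟨d, hd, hd1, hds⟩ := hg (f x)
  have hfc := continuous f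
  let s := f ⁻¹' d.source
  have hs : IsOpen s := d.open_source.preimage hfc
  -- The restriction to `s` ensures that `f` takes values where `d` inverts `g`; without it `d.symm
  -- ∘ e` could land on another sheet of `g`.
  let e1 := (e.restrOpen s hs).trans d.symm
  have key : ∀ y ∈ e.source, y ∈ s → e y = d (f y) := by
    intro y hy hys
    rw [← he y hy, ← hd1 _ hys]; rfl
  refine ⟨e1, ?_, ?_, ?_⟩
  · simp only [e1, OpenPartialHomeomorph.trans_source, OpenPartialHomeomorph.restrOpen_source]
    refine ⟨⟨hx, hd⟩, ?_⟩
    change e x ∈ d.target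
    rw [key x hx hd]; exact d.map_source hd
  · intro y hy
    simp only [e1, OpenPartialHomeomorph.trans_source, OpenPartialHomeomorph.restrOpen_source] at hy
    change f y = d.symm (e y)
    rw [key y hy.1.1 hy.1.2, d.left_inv hy.1.2]
  · have h1 : SmoothOn (fun z => e.symm (g z)) (univ ∩ g ⁻¹' e.target) :=
      hes.comp_on g.smooth isOpen_univ e.open_target
    refine (h1.mono ?_).congr ?_
    · intro z hz
      simp only [e1, OpenPartialHomeomorph.trans_target, OpenPartialHomeomorph.symm_target] at hz
      refine ⟨trivial, ?_⟩
      change g z ∈ e.target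
      rw [hd1 z hz.1]
      -- All that is extracted here is that the target of the restriction of `e` lies in `e.target`.
      exact (e.restrOpen s hs).open_target.subset_interior_iff.2 (Subset.refl _) hz.2 |> fun h => by
        have := interior_subset h
        simp at this
        exact this.1
    · intro z hz
      simp only [e1, OpenPartialHomeomorph.trans_target, OpenPartialHomeomorph.symm_target] at hz
      change e.symm (d z) = e.symm (g z)
      rw [hd1 z hz.1]

/-- A map is étale if it is so after composition with étale maps that jointly cover the source. -/
theorem etale_of_cover {N P : Mfd.{u} 𝕜} {g : N ⟶ P}
    (h : ∀ y, ∃ (M : Mfd.{u} 𝕜) (f : M ⟶ N), Etale f ∧ y ∈ range f ∧ Etale (f ≫ g)) : Etale g := by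
  intro y
  obtain ⟨M, f, hf, ⟨x, rfl⟩, hfg⟩ := h y
  obtain ⟨d, hd, hd1, hds⟩ := hf x
  obtain ⟨e, hx, he, hes⟩ := hfg x
  refine ⟨d.symm.trans e, ?_, ?_, ?_⟩
  · refine ⟨by rw [hd1 x hd]; exact d.map_source hd, ?_⟩
    change d.symm (f x) ∈ e.source
    rw [hd1 x hd, d.left_inv hd]; exact hx
  · intro z hz
    change g z = e (d.symm z)
    refine Eq.trans ?_ (he (d.symm z) hz.2)
    change g z = g (f (d.symm z))
    rw [hd1 _ (d.map_target hz.1), d.right_inv hz.1]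
  · refine ((f.smooth.comp_on hes e.open_target isOpen_univ).mono ?_).congr ?_
    · intro z hz
      exact ⟨hz.1, trivial⟩
    · intro z hz
      change d (e.symm z) = f (e.symm z)
      rw [hd1 _ hz.2]

/-- Open embeddings of manifolds: the members of covering families. -/
def OpenEmb {M N : Mfd.{u} 𝕜} (f : M ⟶ N) : Prop := Etale f ∧ Function.Injective f

theorem openEmb_id (M : Mfd.{u} 𝕜) : OpenEmb (𝟙 M) := ⟨etale_id M, fun _ _ h => h⟩

theorem OpenEmb.comp {M N P : Mfd.{u} 𝕜} {f : M ⟶ N} {g : N ⟶ P} (hf : OpenEmb f)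
    (hg : OpenEmb g) : OpenEmb (f ≫ g) :=
  ⟨hf.1.comp hg.1, fun _ _ h => hf.2 (hg.2 h)⟩

theorem OpenEmb.isOpenEmbedding {M N : Mfd.{u} 𝕜} {f : M ⟶ N} (hf : OpenEmb f) :
    IsOpenEmbedding f :=
  .of_continuous_injective_isOpenMap (continuous f) hf.2 hf.1.isOpenMap

/-! ### Manifold structures pulled back along local homeomorphisms, and open submanifolds. -/

/-- A Hausdorff space with a local homeomorphism to a manifold is a manifold. -/
def ofLocalHomeo {M : Mfd.{u} 𝕜} (Y : Type u) [TopologicalSpace Y] [T2Space Y] (p : Y → M)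
    (hp : IsLocalHomeomorph p) : Mfd.{u} 𝕜 where
  carrier := Y
  atlas n := {E | ∃ d : OpenPartialHomeomorph Y M, (∀ y ∈ d.source, p y = d y) ∧
    ∃ e ∈ M.atlas n, E = d.trans e}
  cover y := by
    obtain ⟨d, hd, rfl⟩ := hp y
    obtain ⟨n, e, he, hx⟩ := M.cover (d y)
    exact ⟨n, _, ⟨d, fun _ _ => rfl, e, he, rfl⟩, hd, hx⟩
  compat := by
    rintro m n _ ⟨d, hd, e, he, rfl⟩ _ ⟨d', hd', e', he', rfl⟩
    -- Both `d` and `d'` are restrictions of `p`, so `d' ∘ d⁻¹` is the identity and the coordinate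
    -- changes are those of `M`.
    have key : ∀ z ∈ (d.trans e).target ∩ (d.trans e).symm ⁻¹' (d'.trans e').source,
        d' (d.symm (e.symm z)) = e.symm z := by
      rintro z ⟨hz, hz'⟩
      rw [OpenPartialHomeomorph.trans_target] at hz
      refine (hd' _ hz'.1).symm.trans ?_
      change p (d.symm (e.symm z)) = _
      rw [hd _ (d.map_target hz.2), d.right_inv hz.2]
    refine (M.compat m n e he e' he').congr_mono ?_ ?_
    · intro z hz
      change e' (d' (d.symm (e.symm z))) = _
      rw [key z hz]
    · intro z hz
      refine ⟨hz.1.1, ?_⟩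
      have : d' (d.symm (e.symm z)) ∈ e'.source := hz.2.2
      rw [key z hz] at this
      exact this

/-- The local homeomorphism that defines the structure of `ofLocalHomeo`, as a morphism. -/
def ofLocalHomeoProj {M : Mfd.{u} 𝕜} (Y : Type u) [TopologicalSpace Y] [T2Space Y] (p : Y → M)
    (hp : IsLocalHomeomorph p) : ofLocalHomeo Y p hp ⟶ M where
  toFun := p
  smooth := by
    refine ⟨hp.continuous.continuousOn, ?_⟩
    rintro m n _ ⟨d, hd, e, he, rfl⟩ e' he'
    have key : ∀ z ∈ (d.trans e).target, p (d.symm (e.symm z)) = e.symm z := by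
      intro z hz
      rw [OpenPartialHomeomorph.trans_target] at hz
      rw [hd _ (d.map_target hz.2), d.right_inv hz.2]
    refine (M.compat m n e he e' he').congr_mono ?_ ?_
    · rintro z ⟨hz, -⟩
      change e' (p (d.symm (e.symm z))) = _
      rw [key z hz]
    · rintro z ⟨hz, hz'⟩
      refine ⟨hz.1, ?_⟩
      have : p (d.symm (e.symm z)) ∈ e'.source := hz'.2
      rw [key z hz] at this
      exact this

theorem etale_ofLocalHomeoProj {M : Mfd.{u} 𝕜} (Y : Type u) [TopologicalSpace Y] [T2Space Y]
    (p : Y → M) (hp : IsLocalHomeomorph p) : Etale (ofLocalHomeoProj Y p hp) := by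
  intro y
  obtain ⟨d, hd, rfl⟩ := hp y
  refine ⟨d, hd, fun _ _ => rfl, d.symm.continuousOn, ?_⟩
  rintro m n e he _ ⟨d', hd', e', he', rfl⟩
  have key : ∀ z ∈ e.target ∩ e.symm ⁻¹' (d.symm.source ∩ d.symm ⁻¹' (d'.trans e').source),
      d' (d.symm (e.symm z)) = e.symm z := by
    rintro z ⟨hz, hz', hz''⟩
    rw [← hd' _ hz''.1]
    exact d.right_inv hz'
  refine (M.compat m n e he e' he').congr_mono ?_ ?_
  · intro z hz
    change e' (d' (d.symm (e.symm z))) = _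
    rw [key z hz]
  · intro z hz
    refine ⟨hz.1, ?_⟩
    have : d' (d.symm (e.symm z)) ∈ e'.source := hz.2.2.2
    rw [key z hz] at this
    exact this

/-- Open subsets of manifolds. -/
def openSub {M : Mfd.{u} 𝕜} (s : Set M) (hs : IsOpen s) : Mfd.{u} 𝕜 :=
  ofLocalHomeo s Subtype.val hs.isOpenEmbedding_subtypeVal.isLocalHomeomorph

/-- The inclusion of an open subset. -/
def openSubι {M : Mfd.{u} 𝕜} (s : Set M) (hs : IsOpen s) : openSub s hs ⟶ M :=
  ofLocalHomeoProj s Subtype.val _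

theorem openEmb_openSubι {M : Mfd.{u} 𝕜} (s : Set M) (hs : IsOpen s) : OpenEmb (openSubι s hs) :=
  ⟨etale_ofLocalHomeoProj _ _ _, Subtype.val_injective⟩

theorem range_openSubι {M : Mfd.{u} 𝕜} (s : Set M) (hs : IsOpen s) : range (openSubι s hs) = s :=
  Subtype.range_val

/-- Morphisms with values in the image of an open embedding factor through it. -/
theorem OpenEmb.exists_lift {V U N : Mfd.{u} 𝕜} {f : V ⟶ U} (hf : OpenEmb f) (h : N ⟶ U)
    (hr : range h ⊆ range f) : ∃ k : N ⟶ V, k ≫ f = h := by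
  choose k hk using fun n => hr (mem_range_self n)
  refine ⟨⟨k, hf.1.smooth_of_comp ?_ ?_⟩, Mfd.hom_ext hk⟩
  · rw [hf.isOpenEmbedding.isInducing.continuous_iff]
    exact (continuous h).congr (fun n => (hk n).symm)
  · exact h.smooth.congr (fun n _ => hk n)

theorem OpenEmb.mono {V U : Mfd.{u} 𝕜} {f : V ⟶ U} (hf : OpenEmb f) : Mono f :=
  ⟨fun _ _ e => Mfd.hom_ext (fun x => hf.2 (congrArg (fun k => Mfd.Hom.toFun k x) e))⟩

/-- Fibre products along arbitrary maps need not exist among manifolds. Along an open embedding the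
open subset `h ⁻¹' range f` serves, and overlaps of coverings require no more. -/
theorem exists_isPullback {V U N : Mfd.{u} 𝕜} {f : V ⟶ U} (hf : OpenEmb f) (h : N ⟶ U) :
    ∃ (W : Mfd.{u} 𝕜) (p₁ : W ⟶ N) (p₂ : W ⟶ V), OpenEmb p₁ ∧ IsPullback p₁ p₂ h f ∧
      range p₁ = h ⁻¹' range f := by
  have hs : IsOpen (h ⁻¹' range f) := hf.1.isOpenMap.isOpen_range.preimage (continuous h)
  obtain ⟨p₂, hp₂⟩ := hf.exists_lift (openSubι _ hs ≫ h) (by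
    rintro _ ⟨w, rfl⟩
    exact w.2)
  refine ⟨_, openSubι _ hs, p₂, openEmb_openSubι _ hs, ⟨⟨hp₂.symm⟩, ⟨?_⟩⟩, range_openSubι _ _⟩
  haveI := hf.mono
  haveI := (openEmb_openSubι _ hs).mono
  have hl : ∀ s : Limits.PullbackCone h f, ∃ k : s.pt ⟶ _, k ≫ openSubι _ hs = s.fst := by
    intro s
    refine (openEmb_openSubι _ hs).exists_lift s.fst ?_
    rw [range_openSubι]
    rintro _ ⟨x, rfl⟩
    exact ⟨s.snd x, (congrArg (fun k => Mfd.Hom.toFun k x) s.condition).symm⟩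
  choose k hk using hl
  refine Limits.PullbackCone.IsLimit.mk _ k hk ?_ ?_
  · intro s
    rw [← cancel_mono f, Category.assoc, hp₂, ← Category.assoc, hk, s.condition]
  · intro s m hm _
    rw [← cancel_mono (openSubι _ hs), hm, hk]

theorem hom_congr_apply {M N : Mfd.{u} 𝕜} {f g : M ⟶ N} (h : f = g) (x : M) : f x = g x := by
  rw [h]

end Mfd

end SatakeOrbifold

/-! ### Local equivalences -/

namespace SatakeOrbifold

open Mfd

variable {𝕜 : Type} [RCLike 𝕜]

/-- `f` is an open embedding whose image contains `m`. -/
def IsNbhd {V U : Mfd.{u} 𝕜} (f : V ⟶ U) (m : U) : Prop := OpenEmb f ∧ m ∈ range f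

theorem isNbhd_id {U : Mfd.{u} 𝕜} (m : U) : IsNbhd (𝟙 U) m := ⟨openEmb_id U, m, rfl⟩

theorem IsNbhd.comp {W V U : Mfd.{u} 𝕜} {f : V ⟶ U} {g : W ⟶ V} {v : V} (hg : IsNbhd g v)
    (hf : OpenEmb f) : IsNbhd (g ≫ f) (f v) := by
  obtain ⟨hg1, w, rfl⟩ := hg
  exact ⟨hg1.comp hf, w, rfl⟩

theorem isCover_of_isNbhd {U : Mfd.{u} 𝕜} {V : U → Mfd.{u} 𝕜} {f : ∀ m, V m ⟶ U}
    (h : ∀ m, IsNbhd (f m) m) : IsCover f :=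
  ⟨fun m => (h m).1, fun m => ⟨m, (h m).2⟩⟩

theorem Mfd.IsCover.exists_isNbhd {U : Mfd.{u} 𝕜} {I : Type u} {V : I → Mfd.{u} 𝕜}
    {f : ∀ i, V i ⟶ U} (h : IsCover f) (m : U) : ∃ i, IsNbhd (f i) m := by
  obtain ⟨i, hi⟩ := h.2 m
  exact ⟨i, h.1 i, hi⟩

/-- Objects of a category over manifolds can be pulled back. -/
def HasLifts (𝒳 : BasedCategory.{u, u + 1} (Mfd.{u} 𝕜)) : Prop :=
  ∀ (x : 𝒳.obj) (U : Mfd.{u} 𝕜) (α : U ⟶ 𝒳.p.obj x),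
    ∃ (y : 𝒳.obj) (a : y ⟶ x), 𝒳.p.IsHomLift α a

section Fibred

variable {𝒜 ℬ 𝒞 𝒳 𝒴 𝒵 : BasedCategory.{u, u + 1} (Mfd.{u} 𝕜)}

theorem HasLifts.exists_lift (h : HasLifts 𝒳) {x : 𝒳.obj} {U V : Mfd.{u} 𝕜}
    (hx : 𝒳.p.obj x = U) (f : V ⟶ U) : ∃ (y : 𝒳.obj) (a : y ⟶ x), 𝒳.p.IsHomLift f a := by
  subst hx
  exact h x V f

/-- Used to deduce equations between maps of manifolds from equations between arrows above them,
with no casts between propositionally equal base objects. -/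
theorem isHomLift_unique {R S : Mfd.{u} 𝕜} {x y : 𝒳.obj} {f g : R ⟶ S} (φ : x ⟶ y)
    (hf : 𝒳.p.IsHomLift f φ) (hg : 𝒳.p.IsHomLift g φ) : f = g := by
  rw [IsHomLift.fac 𝒳.p f φ, IsHomLift.fac 𝒳.p g φ]

theorem map_eq_of_isHomLift {R S : Mfd.{u} 𝕜} {x y : 𝒳.obj} {f : R ⟶ S} {φ ψ : x ⟶ y}
    (hf : 𝒳.p.IsHomLift f φ) (hg : 𝒳.p.IsHomLift f ψ) : 𝒳.p.map φ = 𝒳.p.map ψ := by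
  rw [IsHomLift.fac' 𝒳.p f φ, IsHomLift.fac' 𝒳.p f ψ]

theorem exists_isHomLift {R S : Mfd.{u} 𝕜} {x y : 𝒳.obj} (φ : x ⟶ y) (hx : 𝒳.p.obj x = R)
    (hy : 𝒳.p.obj y = S) : ∃ f : R ⟶ S, 𝒳.p.IsHomLift f φ := by
  subst hx hy
  exact ⟨_, IsHomLift.map _ φ⟩

theorem IsNbhd.of_isHomLift {x y : 𝒳.obj} {φ : x ⟶ y} {V : Mfd.{u} 𝕜} {f : V ⟶ 𝒳.p.obj y}
    {m : 𝒳.p.obj y} (hf : IsNbhd f m) (h : 𝒳.p.IsHomLift f φ) : IsNbhd (𝒳.p.map φ) m := by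
  obtain rfl := IsHomLift.domain_eq 𝒳.p f φ
  rwa [← IsHomLift.eq_of_isHomLift 𝒳.p f φ]

/-- A functor over manifolds preserves base objects only up to a propositional equality; this moves
a neighbourhood across it. -/
theorem IsNbhd.exists_of_eq {x y : 𝒳.obj} {φ : x ⟶ y} {W V U : Mfd.{u} 𝕜} (e : W = V) {f : V ⟶ U}
    {m : U} (hf : IsNbhd f m) (h : 𝒳.p.IsHomLift f φ) :
    ∃ g : W ⟶ U, IsNbhd g m ∧ 𝒳.p.IsHomLift g φ := by
  subst e
  exact ⟨f, hf, h⟩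

namespace IsGroupoidOver

theorem hasLifts (h : IsGroupoidOver 𝒳) : HasLifts 𝒳 := h.lift

theorem exists_factor (h : IsGroupoidOver 𝒳) {R S T : Mfd.{u} 𝕜} {f : R ⟶ S} {g : T ⟶ S}
    (γ : R ⟶ T) (e : γ ≫ g = f) {x y z : 𝒳.obj} (φ : y ⟶ x) (ψ : z ⟶ x)
    (hφ : 𝒳.p.IsHomLift f φ) (hψ : 𝒳.p.IsHomLift g ψ) :
    ∃ c : y ⟶ z, 𝒳.p.IsHomLift γ c ∧ c ≫ ψ = φ := by
  obtain rfl := IsHomLift.domain_eq 𝒳.p f φ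
  obtain rfl := IsHomLift.domain_eq 𝒳.p g ψ
  obtain rfl := IsHomLift.codomain_eq 𝒳.p f φ
  obtain rfl := IsHomLift.eq_of_isHomLift 𝒳.p f φ
  obtain rfl := IsHomLift.eq_of_isHomLift 𝒳.p g ψ
  obtain ⟨c, ⟨h1, h2⟩, -⟩ := h.factor x y z φ ψ γ e.symm
  exact ⟨c, by rw [← h2]; infer_instance, h1⟩

/-- Every arrow of a category fibred in groupoids is cartesian, so composition with `b` is injective
on arrows with a given projection. -/
theorem hom_unique' (h : IsGroupoidOver 𝒳) {x y z : 𝒳.obj} {c c' : y ⟶ z} (b : z ⟶ x)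
    (hp : 𝒳.p.map c = 𝒳.p.map c') (e : c ≫ b = c' ≫ b) : c = c' := by
  obtain ⟨d, -, hd⟩ := h.factor x y z (c' ≫ b) b (𝒳.p.map c') (𝒳.p.map_comp _ _)
  rw [hd c ⟨e, hp⟩, hd c' ⟨rfl, rfl⟩]

theorem hom_unique (h : IsGroupoidOver 𝒳) {R T : Mfd.{u} 𝕜} {γ : R ⟶ T} {x y z : 𝒳.obj}
    {c c' : y ⟶ z} (b : z ⟶ x) (hc : 𝒳.p.IsHomLift γ c) (hc' : 𝒳.p.IsHomLift γ c')
    (e : c ≫ b = c' ≫ b) : c = c' :=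
  h.hom_unique' b (map_eq_of_isHomLift hc hc') e

/-- Factoring the identity of `y` through `φ` gives a right inverse over `f⁻¹`; it is two-sided
because `φ` is cartesian. -/
theorem isIso_of_isHomLift (h : IsGroupoidOver 𝒳) {R S : Mfd.{u} 𝕜} {f : R ⟶ S} [IsIso f]
    {x y : 𝒳.obj} (φ : x ⟶ y) (hφ : 𝒳.p.IsHomLift f φ) : IsIso φ := by
  have hy := IsHomLift.codomain_eq 𝒳.p f φ
  have hx := IsHomLift.domain_eq 𝒳.p f φ
  obtain ⟨c, hc, hc1⟩ := h.exists_factor (inv f) (by simp) (𝟙 y) φ (IsHomLift.id hy) hφ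
  refine ⟨c, ?_, hc1⟩
  have h1 : 𝒳.p.IsHomLift (𝟙 R) (φ ≫ c) := by
    rw [← IsIso.hom_inv_id f]; infer_instance
  exact h.hom_unique φ h1 (IsHomLift.id hx) (by simp [hc1])

end IsGroupoidOver

/-- The separatedness half of the sheaf condition: both arrows glue the restrictions of `ψ`. -/
theorem HomsGlue.hom_ext (h : HomsGlue 𝒳) {x y : 𝒳.obj} {U : Mfd.{u} 𝕜} (hx : 𝒳.p.obj x = U)
    {ψ ψ' : x ⟶ y} (hb : 𝒳.p.map ψ = 𝒳.p.map ψ')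
    (cov : ∀ m : U, ∃ (V : Mfd.{u} 𝕜) (f : V ⟶ U) (w : 𝒳.obj) (ρ : w ⟶ x), IsNbhd f m ∧
      𝒳.p.IsHomLift f ρ ∧ ρ ≫ ψ = ρ ≫ ψ') : ψ = ψ' := by
  subst hx
  choose V f w ρ h1 h2 h3 using cov
  obtain ⟨χ, -, hχ⟩ := h x y (𝒳.p.map ψ) _ V f (isCover_of_isNbhd h1) w ρ (fun i => ρ i ≫ ψ) h2
    (fun i => by have := h2 i; infer_instance)
    (fun i j z a b e => by rw [← Category.assoc, e, Category.assoc])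
  rw [hχ ψ ⟨rfl, fun _ => rfl⟩, hχ ψ' ⟨hb.symm, fun i => (h3 i).symm⟩]

/-- Gluing of morphisms that are given on a family of objects over `x` which contains
neighbourhoods of all points. -/
theorem IsStack.hom_glue (h : IsStack 𝒳) {x y : 𝒳.obj} {U U' : Mfd.{u} 𝕜} (hx : 𝒳.p.obj x = U)
    (hy : 𝒳.p.obj y = U') (α : U ⟶ U') {J : Type*} (w : J → 𝒳.obj) (ρ : ∀ j, w j ⟶ x)
    (φ : ∀ j, w j ⟶ y) (B : J → Mfd.{u} 𝕜) (f : ∀ j, B j ⟶ U)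
    (hρ : ∀ j, 𝒳.p.IsHomLift (f j) (ρ j)) (hφ : ∀ j, 𝒳.p.IsHomLift (f j ≫ α) (φ j))
    (cov : ∀ m : U, ∃ j, IsNbhd (f j) m)
    (compat : ∀ i j (z : 𝒳.obj) (a : z ⟶ w i) (b : z ⟶ w j),
      a ≫ ρ i = b ≫ ρ j → a ≫ φ i = b ≫ φ j) :
    ∃ ψ : x ⟶ y, 𝒳.p.IsHomLift α ψ ∧ ∀ j, ρ j ≫ ψ = φ j := by
  subst hx hy
  -- The family `J` may be too large to index a covering. One member for each point of the base is
  -- enough, and the points form a type in the right universe.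
  choose k hk using cov
  obtain ⟨ψ, ⟨h1, h2⟩, -⟩ := h.homs x y α _ _ _ (isCover_of_isNbhd hk) (fun m => w (k m))
    (fun m => ρ (k m)) (fun m => φ (k m)) (fun m => hρ _) (fun m => hφ _)
    (fun i j z a b => compat _ _ z a b)
  have hψ : 𝒳.p.IsHomLift α ψ := by rw [← h1]; infer_instance
  refine ⟨ψ, hψ, fun j => ?_⟩
  have := hρ j
  have hw := IsHomLift.domain_eq 𝒳.p (f j) (ρ j)
  -- So far `ψ` is controlled only on the chosen members. For an arbitrary `j` the equation is
  -- checked near each point `n`, on the overlap of `w j` with the member chosen for `f j n`.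
  refine h.homs.hom_ext hw (map_eq_of_isHomLift (f := f j ≫ α) inferInstance (hφ j))
    (fun n => ?_)
  obtain ⟨W, p₁, p₂, hp, hpb, hr⟩ := exists_isPullback (hk (f j n)).1 (f j)
  obtain ⟨z, a, ha⟩ := h.groupoid.hasLifts.exists_lift hw p₁
  obtain ⟨b, hb, hb'⟩ := h.groupoid.exists_factor p₂ hpb.w.symm (a ≫ ρ j) (ρ (k (f j n)))
    inferInstance (hρ _)
  refine ⟨W, p₁, z, a, ⟨hp, ?_⟩, ha, ?_⟩
  · rw [hr]; exact (hk (f j n)).2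
  · rw [← compat _ _ _ _ _ hb', ← h2, ← Category.assoc, ← hb', Category.assoc]

/-- `F` is an equivalence locally: locally essentially surjective, and bijective on local
morphisms, where morphisms of `𝒜` may be replaced with fractions. -/
structure IsLocalEquiv (F : 𝒜 ⥤ᵇ ℬ) : Prop where
  surj : ∀ (x : ℬ.obj) (m : ℬ.p.obj x), ∃ (q : 𝒜.obj) (φ : F.obj q ⟶ x)
    (f : 𝒜.p.obj q ⟶ ℬ.p.obj x), IsNbhd f m ∧ ℬ.p.IsHomLift f φ
  full : ∀ (p q : 𝒜.obj) (χ : F.obj p ⟶ F.obj q) (m : 𝒜.p.obj p), ∃ (r : 𝒜.obj) (ρ : r ⟶ p)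
    (φ : r ⟶ q), IsNbhd (𝒜.p.map ρ) m ∧ F.map φ = F.map ρ ≫ χ
  faithful : ∀ (p q : 𝒜.obj) (φ ψ : p ⟶ q), F.map φ = F.map ψ → ∀ m : 𝒜.p.obj p,
    ∃ (r : 𝒜.obj) (ρ : r ⟶ p), IsNbhd (𝒜.p.map ρ) m ∧ ρ ≫ φ = ρ ≫ ψ

namespace IsLocalEquiv

theorem surj_at {F : 𝒜 ⥤ᵇ ℬ} (h : IsLocalEquiv F) {x : ℬ.obj} {U : Mfd.{u} 𝕜}
    (hx : ℬ.p.obj x = U) (m : U) : ∃ (q : 𝒜.obj) (φ : F.obj q ⟶ x)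
    (f : 𝒜.p.obj q ⟶ U), IsNbhd f m ∧ ℬ.p.IsHomLift f φ := by
  subst hx
  exact h.surj x m

theorem full_at {F : 𝒜 ⥤ᵇ ℬ} (h : IsLocalEquiv F) {p q : 𝒜.obj} {U : Mfd.{u} 𝕜}
    (hp : 𝒜.p.obj p = U) (χ : F.obj p ⟶ F.obj q) (m : U) : ∃ (r : 𝒜.obj) (ρ : r ⟶ p)
    (φ : r ⟶ q) (f : 𝒜.p.obj r ⟶ U), IsNbhd f m ∧ 𝒜.p.IsHomLift f ρ ∧
      F.map φ = F.map ρ ≫ χ := by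
  subst hp
  obtain ⟨r, ρ, φ, h1, h2⟩ := h.full p q χ m
  exact ⟨r, ρ, φ, _, h1, inferInstance, h2⟩

theorem faithful_at {F : 𝒜 ⥤ᵇ ℬ} (h : IsLocalEquiv F) {p q : 𝒜.obj} {U : Mfd.{u} 𝕜}
    (hp : 𝒜.p.obj p = U) {φ ψ : p ⟶ q} (e : F.map φ = F.map ψ) (m : U) :
    ∃ (r : 𝒜.obj) (ρ : r ⟶ p) (f : 𝒜.p.obj r ⟶ U), IsNbhd f m ∧ 𝒜.p.IsHomLift f ρ ∧
      ρ ≫ φ = ρ ≫ ψ := by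
  subst hp
  obtain ⟨r, ρ, h1, h2⟩ := h.faithful p q φ ψ e m
  exact ⟨r, ρ, _, h1, inferInstance, h2⟩

/-- Local fullness of `G` produces a span in `ℬ` whose apex need not come from `𝒜`. The apex is
first covered by an object in the image of `F`; then both legs are lifted in turn, each at the price
of a further restriction. -/
theorem comp {F : 𝒜 ⥤ᵇ ℬ} {G : ℬ ⥤ᵇ 𝒞} (hF : IsLocalEquiv F) (hG : IsLocalEquiv G) :
    IsLocalEquiv (F.comp G) where
  surj x m := by
    obtain ⟨q, φ, f, ⟨hf, n, rfl⟩, hφ⟩ := hG.surj x m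
    obtain ⟨r, ρ, g, hg, hρ⟩ := hF.surj q n
    exact ⟨r, G.map ρ ≫ φ, g ≫ f, hg.comp hf, IsHomLift.comp 𝒞.p g f (G.map ρ) φ⟩
  full p q (χ : G.obj (F.obj p) ⟶ G.obj (F.obj q)) m := by
    obtain ⟨r, ρ, φ, f, ⟨hf, n, rfl⟩, hρ, e⟩ := hG.full_at (F.w_obj p) χ m
    obtain ⟨s, σ, g, ⟨hg, k, rfl⟩, hσ⟩ := hF.surj r n
    obtain ⟨t, τ, θ, ⟨hτ, l, rfl⟩, e1⟩ := hF.full s p (σ ≫ ρ) k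
    obtain ⟨v, α, β, hα, e2⟩ := hF.full t q (F.map τ ≫ σ ≫ φ) l
    refine ⟨v, α ≫ θ, β, ?_, ?_⟩
    · have h1 : ℬ.p.IsHomLift (𝒜.p.map τ ≫ g ≫ f) (F.map θ) := by rw [e1]; infer_instance
      rw [𝒜.p.map_comp, isHomLift_unique (F.map θ) (f := 𝒜.p.map θ) inferInstance h1]
      exact hα.comp (hτ.comp (hg.comp hf))
    · change G.map (F.map β) = G.map (F.map (α ≫ θ)) ≫ χ
      rw [e2, F.map_comp, e1]
      simp only [G.map_comp, Category.assoc, e]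
  faithful p q φ ψ e m := by
    obtain ⟨r, ρ, f, ⟨hf, n, rfl⟩, hρ, e⟩ := hG.faithful_at (F.w_obj p) (φ := F.map φ)
      (ψ := F.map ψ) e m
    obtain ⟨s, σ, g, ⟨hg, k, rfl⟩, hσ⟩ := hF.surj r n
    obtain ⟨t, τ, θ, ⟨hτ, l, rfl⟩, e1⟩ := hF.full s p (σ ≫ ρ) k
    obtain ⟨v, α, hα, e2⟩ := hF.faithful t q (θ ≫ φ) (θ ≫ ψ) (by
      rw [F.map_comp, F.map_comp, e1, Category.assoc, Category.assoc, Category.assoc,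
        Category.assoc, e]) l
    refine ⟨v, α ≫ θ, ?_, by simpa using e2⟩
    have h1 : ℬ.p.IsHomLift (𝒜.p.map τ ≫ g ≫ f) (F.map θ) := by rw [e1]; infer_instance
    rw [𝒜.p.map_comp, isHomLift_unique (F.map θ) (f := 𝒜.p.map θ) inferInstance h1]
    exact hα.comp (hτ.comp (hg.comp hf))

/-- Two arrows from an object to objects in the image are locally given by arrows of the source
category. -/
theorem exists_span {F : 𝒜 ⥤ᵇ ℬ} (h : IsLocalEquiv F) {y : ℬ.obj} {U : Mfd.{u} 𝕜}
    (hy : ℬ.p.obj y = U) {q q' : 𝒜.obj} (a : y ⟶ F.obj q) (b : y ⟶ F.obj q') (m : U) :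
    ∃ (r : 𝒜.obj) (σ : F.obj r ⟶ y) (f : 𝒜.p.obj r ⟶ U) (k : r ⟶ q) (l : r ⟶ q'),
      IsNbhd f m ∧ ℬ.p.IsHomLift f σ ∧ σ ≫ a = F.map k ∧ σ ≫ b = F.map l := by
  obtain ⟨s, σ, f, ⟨hf, n, rfl⟩, hσ⟩ := h.surj_at hy m
  obtain ⟨t, τ, k, ⟨hτ, n', rfl⟩, e1⟩ := h.full s q (σ ≫ a) n
  obtain ⟨v, α, l, hα, e2⟩ := h.full t q' (F.map τ ≫ σ ≫ b) n'
  refine ⟨v, F.map α ≫ F.map τ ≫ σ, 𝒜.p.map α ≫ 𝒜.p.map τ ≫ f, α ≫ k, l,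
    hα.comp (hτ.comp hf), inferInstance, ?_, ?_⟩
  · rw [F.map_comp, e1]; simp
  · rw [e2]; simp

theorem congr {F G : 𝒜 ⥤ᵇ ℬ} (h : IsLocalEquiv F) (i : F ≅ G) : IsLocalEquiv G := by
  have hi : ∀ a, i.hom.app a ≫ i.inv.app a = 𝟙 _ := fun a =>
    congrArg (fun k : F ⟶ F => k.app a) i.hom_inv_id
  have hi' : ∀ a, i.inv.app a ≫ i.hom.app a = 𝟙 _ := fun a =>
    congrArg (fun k : G ⟶ G => k.app a) i.inv_hom_id
  have hG : ∀ {a b : 𝒜.obj} (f : a ⟶ b), G.map f = i.inv.app a ≫ F.map f ≫ i.hom.app b := by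
    intro a b f
    rw [i.hom.naturality f, ← Category.assoc, hi' a, Category.id_comp]
  refine ⟨fun x m => ?_, fun p q χ m => ?_, fun p q φ ψ e m => ?_⟩
  · obtain ⟨q, φ, f, hf, hφ⟩ := h.surj x m
    exact ⟨q, i.inv.app q ≫ φ, f, hf, inferInstance⟩
  · obtain ⟨r, ρ, φ, hρ, e⟩ := h.full p q (i.hom.app p ≫ χ ≫ i.inv.app q) m
    refine ⟨r, ρ, φ, hρ, ?_⟩
    rw [hG, hG, e]
    simp only [Category.assoc, hi', Category.comp_id]
  · refine h.faithful p q φ ψ ?_ m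
    have h1 := congrArg (fun k => i.hom.app p ≫ k ≫ i.inv.app q) e
    simp only [hG, Category.assoc, hi, Category.comp_id] at h1
    simp only [← Category.assoc, hi, Category.id_comp] at h1
    exact h1

end IsLocalEquiv

/-- A covering contains a neighbourhood of each point, and conversely a choice of one neighbourhood
for each point is a covering. -/
theorem isAssociatedStack_iff {ℓ : 𝒜 ⥤ᵇ 𝒳} :
    IsAssociatedStack ℓ ↔ IsStack 𝒳 ∧ IsLocalEquiv ℓ := by
  constructor
  · intro h
    refine ⟨h.isStack, ⟨fun x m => ?_, fun p q χ m => ?_, fun p q φ ψ e m => ?_⟩⟩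
    · obtain ⟨I, V, f, q, φ, hc, hφ⟩ := h.locally_surj x
      obtain ⟨i, hi⟩ := hc.exists_isNbhd m
      have := hφ i
      obtain ⟨g, hg, hg'⟩ := hi.exists_of_eq
        ((ℓ.w_obj (q i)).symm.trans (IsHomLift.domain_eq 𝒳.p (f i) (φ i))) (hφ i)
      exact ⟨q i, φ i, g, hg, hg'⟩
    · obtain ⟨I, V, f, r, ρ, φ, hc, hρ, e⟩ := h.locally_full p q χ
      obtain ⟨i, hi⟩ := hc.exists_isNbhd m
      exact ⟨r i, ρ i, φ i, hi.of_isHomLift (hρ i), e i⟩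
    · obtain ⟨I, V, f, r, ρ, hc, hρ, e⟩ := h.locally_faithful p q φ ψ e
      obtain ⟨i, hi⟩ := hc.exists_isNbhd m
      exact ⟨r i, ρ i, hi.of_isHomLift (hρ i), e i⟩
  · rintro ⟨h, h'⟩
    refine ⟨h, fun x => ?_, fun p q χ => ?_, fun p q φ ψ e => ?_⟩
    · choose q φ f hf hφ using h'.surj x
      exact ⟨_, _, f, q, φ, isCover_of_isNbhd hf, hφ⟩
    · choose r ρ φ hρ e using h'.full p q χ
      exact ⟨_, _, _, r, ρ, φ, isCover_of_isNbhd hρ, fun _ => inferInstance, e⟩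
    · choose r ρ hρ e using h'.faithful p q φ ψ e
      exact ⟨_, _, _, r, ρ, isCover_of_isNbhd hρ, fun _ => inferInstance, e⟩

theorem IsAssociatedStack.isLocalEquiv {ℓ : 𝒜 ⥤ᵇ 𝒳} (h : IsAssociatedStack ℓ) : IsLocalEquiv ℓ :=
  (isAssociatedStack_iff.1 h).2

end Fibred

end SatakeOrbifold

/-! ### Cocones from local data -/

namespace SatakeOrbifold

open Mfd

variable {𝕜 : Type} [RCLike 𝕜]

variable {𝒜 ℬ 𝒞 𝒳 𝒴 𝒵 : BasedCategory.{u, u + 1} (Mfd.{u} 𝕜)}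

theorem IsGroupoidOver.exists_factor_of_full (h : IsGroupoidOver 𝒳) (j : 𝒜 ⥤ᵇ 𝒳)
    [j.toFunctor.Full] {R S T : Mfd.{u} 𝕜} {f : R ⟶ S} {g : T ⟶ S} (γ : R ⟶ T) (e : γ ≫ g = f)
    {x : 𝒳.obj} {s q : 𝒜.obj} (φ : j.obj s ⟶ x) (ψ : j.obj q ⟶ x) (hφ : 𝒳.p.IsHomLift f φ)
    (hψ : 𝒳.p.IsHomLift g ψ) : ∃ n : s ⟶ q, 𝒜.p.IsHomLift γ n ∧ j.map n ≫ ψ = φ := by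
  obtain ⟨c, hc, hc'⟩ := h.exists_factor γ e φ ψ hφ hψ
  obtain ⟨n, rfl⟩ := j.toFunctor.map_surjective c
  exact ⟨n, j.isHomLift_map γ n, hc'⟩

theorem IsGroupoidOver.hom_unique_of_faithful (h : IsGroupoidOver 𝒳) (j : 𝒜 ⥤ᵇ 𝒳)
    [j.toFunctor.Faithful] {R T : Mfd.{u} 𝕜} {γ γ' : R ⟶ T} {x : 𝒳.obj} {s q : 𝒜.obj} {n n' : s ⟶ q}
    (ψ : j.obj q ⟶ x) (hn : 𝒜.p.IsHomLift γ n) (hn' : 𝒜.p.IsHomLift γ' n') (hγ : γ = γ')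
    (e : j.map n ≫ ψ = j.map n' ≫ ψ) : n = n' := by
  subst hγ
  exact j.toFunctor.map_injective
    (h.hom_unique (γ := γ) ψ (j.preserves_isHomLift γ n) (j.preserves_isHomLift γ n') e)

/-- In `ObjectsGlue` the base of the glued object is recorded only by the arrows into it, so an
empty covering leaves that base undetermined. For empty `U` an object over `U` is instead the
restriction of any object along the empty map. -/
theorem exists_obj_over_of_isEmpty (h : HasLifts 𝒵) (z : 𝒵.obj) (U : Mfd.{u} 𝕜) (hU : IsEmpty U) :
    ∃ y : 𝒵.obj, 𝒵.p.obj y = U := by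
  let f : U ⟶ 𝒵.p.obj z := ⟨fun x => hU.elim x,
    smoothOn_univ_of_locally (fun x => hU.elim x)⟩
  obtain ⟨y, a, ha⟩ := h z U f
  exact ⟨y, IsHomLift.domain_eq 𝒵.p f a⟩

/-- If `𝒜` is a full subcategory of `𝒳`, then a functor from `𝒜` to a stack extends to the objects
of `𝒳` which are locally in `𝒜`: for such an object `x` there is a cocone on the restriction of the
functor to the objects of `𝒜` over `x`. -/
theorem exists_cocone (j : 𝒜 ⥤ᵇ 𝒳) [j.toFunctor.Full] [j.toFunctor.Faithful]
    (h𝒳 : IsGroupoidOver 𝒳) (hl : HasLifts 𝒜) (G : 𝒜 ⥤ᵇ 𝒵) (h𝒵 : IsStack 𝒵) {x : 𝒳.obj}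
    {U : Mfd.{u} 𝕜} (hx : 𝒳.p.obj x = U)
    (cov : ∀ m : U, ∃ (q : 𝒜.obj) (φ : j.obj q ⟶ x) (f : 𝒜.p.obj q ⟶ U), IsNbhd f m ∧
      𝒳.p.IsHomLift f φ) :
    ∃ z : 𝒵.obj, 𝒵.p.obj z = U ∧ ∃ e : ∀ q : 𝒜.obj, (j.obj q ⟶ x) → (G.obj q ⟶ z),
      (∀ (q : 𝒜.obj) (φ : j.obj q ⟶ x) (f : 𝒜.p.obj q ⟶ U), 𝒳.p.IsHomLift f φ →
        𝒵.p.IsHomLift f (e q φ)) ∧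
      ∀ (q' q : 𝒜.obj) (m : q' ⟶ q) (φ : j.obj q ⟶ x),
        G.map m ≫ e q φ = e q' (j.map m ≫ φ) := by
  choose q φ f hf hφ using cov
  have hp : ∀ i i' : U, ∃ (W : Mfd.{u} 𝕜) (p₁ : W ⟶ 𝒜.p.obj (q i)) (p₂ : W ⟶ 𝒜.p.obj (q i')),
      IsPullback p₁ p₂ (f i) (f i') := fun i i' => by
    obtain ⟨W, p₁, p₂, -, h, -⟩ := exists_isPullback (hf i').1 (f i)
    exact ⟨W, p₁, p₂, h⟩
  choose W p₁ p₂ hW using hp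
  choose r k hk using fun i i' => hl.exists_lift rfl (p₁ i i')
  have hr : ∀ i i', 𝒜.p.obj (r i i') = W i i' := fun i i' =>
    IsHomLift.domain_eq 𝒜.p (p₁ i i') (k i i')
  -- The gluing datum: over the overlap both restrictions map to the same object `x`, so the
  -- comparison arrow exists in `𝒳`, and by fullness in `𝒜`.
  choose l hl₂ hlk using fun i i' => h𝒳.exists_factor_of_full j (p₂ i i') (hW i i').w.symm
    (j.map (k i i') ≫ φ i) (φ i') (by have := hk i i'; have := hφ i; infer_instance) (hφ i')
  obtain ⟨z, ρ, hρ, hρl⟩ : ∃ (z : 𝒵.obj) (ρ : ∀ i, G.obj (q i) ⟶ z),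
      (∀ i, 𝒵.p.IsHomLift (f i) (ρ i)) ∧
      ∀ i i', G.map (k i i') ≫ ρ i = G.map (l i i') ≫ ρ i' := by
    refine h𝒵.objects U U _ f (isCover_of_isNbhd hf) W p₁ p₂ hW (fun i => G.obj (q i))
      (fun i i' => G.obj (r i i')) (fun i i' => G.map (k i i')) (fun i i' => G.map (l i i'))
      (fun i => G.w_obj _) (fun i i' => by have := hk i i'; infer_instance)
      (fun i i' => by have := hl₂ i i'; infer_instance) ?_
    intro i i' i'' z a b c e₁ e₂
    obtain ⟨α, hα⟩ := exists_isHomLift a rfl ((G.w_obj _).trans (hr i i'))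
    obtain ⟨β, hβ⟩ := exists_isHomLift b rfl ((G.w_obj _).trans (hr i' i''))
    obtain ⟨γ, hγ⟩ := exists_isHomLift c rfl ((G.w_obj _).trans (hr i i''))
    have := hk i i'
    have := hk i' i''
    have := hk i i''
    have := hl₂ i i'
    have := hl₂ i' i''
    have := hl₂ i i''
    have := hφ i
    have := hφ i'
    have := hφ i''
    -- The test object `z` lies in `𝒵`, while the cocycle identity is available in `𝒳`. A lift `σ`
    -- in `𝒜` of the projection of `a` replaces `a` by `G σ`, up to the comparison `a'`. The arrows
    -- `b` and `c` then become the images of `τ` and `υ`, and the identity is verified in `𝒜`.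
    obtain ⟨s, σ, hσ⟩ := hl.exists_lift (hr i i') α
    obtain ⟨a', ha', ha⟩ := h𝒵.groupoid.exists_factor (𝟙 _) (Category.id_comp α) a (G.map σ) hα
      inferInstance
    have b₁ : α ≫ p₂ i i' = β ≫ p₁ i' i'' :=
      isHomLift_unique (a ≫ G.map (l i i')) inferInstance (by rw [e₁]; infer_instance)
    have b₂ : α ≫ p₁ i i' = γ ≫ p₁ i i'' :=
      isHomLift_unique (a ≫ G.map (k i i')) inferInstance (by rw [e₂]; infer_instance)
    have b₃ : β ≫ p₁ i' i'' ≫ f i' = α ≫ p₁ i i' ≫ f i := by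
      rw [(hW i i').w, ← Category.assoc, ← b₁, Category.assoc]
    have b₄ : γ ≫ p₁ i i'' ≫ f i = α ≫ p₁ i i' ≫ f i := by
      rw [← Category.assoc, ← b₂, Category.assoc]
    obtain ⟨τ, hτ, eτ⟩ := h𝒳.exists_factor_of_full j (s := s) (q := r i' i'') β b₃
      (j.map σ ≫ j.map (k i i') ≫ φ i) (j.map (k i' i'') ≫ φ i') inferInstance inferInstance
    obtain ⟨υ, hυ, eυ⟩ := h𝒳.exists_factor_of_full j (s := s) (q := r i i'') γ b₄
      (j.map σ ≫ j.map (k i i') ≫ φ i) (j.map (k i i'') ≫ φ i) inferInstance inferInstance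
    have h₁ : τ ≫ k i' i'' = σ ≫ l i i' :=
      h𝒳.hom_unique_of_faithful j (γ := β ≫ p₁ i' i'') (γ' := α ≫ p₂ i i') (φ i') inferInstance
        inferInstance b₁.symm (by
          rw [j.map_comp, j.map_comp, Category.assoc, Category.assoc, eτ, hlk])
    have h₂ : υ ≫ k i i'' = σ ≫ k i i' :=
      h𝒳.hom_unique_of_faithful j (γ := γ ≫ p₁ i i'') (γ' := α ≫ p₁ i i') (φ i) inferInstance
        inferInstance b₂.symm (by rw [j.map_comp, j.map_comp, Category.assoc, Category.assoc, eυ])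
    have h₃ : a' ≫ G.map τ = b :=
      h𝒵.groupoid.hom_unique (γ := β) (G.map (k i' i''))
        (by rw [← Category.id_comp β]; infer_instance) hβ (by
          rw [Category.assoc, ← G.map_comp, h₁, G.map_comp, ← Category.assoc, ha, e₁])
    have h₄ : a' ≫ G.map υ = c :=
      h𝒵.groupoid.hom_unique (γ := γ) (G.map (k i i''))
        (by rw [← Category.id_comp γ]; infer_instance) hγ (by
          rw [Category.assoc, ← G.map_comp, h₂, G.map_comp, ← Category.assoc, ha, e₂])
    have := (hf i'').1.mono
    have h₅ : υ ≫ l i i'' = τ ≫ l i' i'' :=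
      h𝒳.hom_unique_of_faithful j (γ := γ ≫ p₂ i i'') (γ' := β ≫ p₂ i' i'') (φ i'') inferInstance
        inferInstance (by
          rw [← cancel_mono (f i''), Category.assoc, Category.assoc, ← (hW i i'').w,
            ← (hW i' i'').w, b₃, b₄])
        (by rw [j.map_comp, j.map_comp, Category.assoc, Category.assoc, hlk, hlk, eυ, eτ])
    rw [← h₃, ← h₄, Category.assoc, Category.assoc, ← G.map_comp, ← G.map_comp, h₅]
  -- Arrows to `q i` and `q i'` that agree over `x` factor through the object over the overlap, so
  -- the glued legs are compatible on all of `𝒜`.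
  have key : ∀ (i i' : U) (t : 𝒜.obj) (b : t ⟶ q i) (b' : t ⟶ q i'),
      j.map b ≫ φ i = j.map b' ≫ φ i' → G.map b ≫ ρ i = G.map b' ≫ ρ i' := by
    intro i i' t b b' e
    have := hk i i'
    have := hl₂ i i'
    have := hφ i
    have := hφ i'
    have hb : 𝒜.p.map b ≫ f i = 𝒜.p.map b' ≫ f i' :=
      isHomLift_unique (j.map b ≫ φ i) inferInstance (by rw [e]; infer_instance)
    obtain ⟨ε, hε, eε⟩ := h𝒳.exists_factor_of_full j (s := t) (q := r i i')
      (f := 𝒜.p.map b ≫ f i) (g := p₁ i i' ≫ f i) ((hW i i').lift _ _ hb)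
      (by rw [← Category.assoc, IsPullback.lift_fst])
      (j.map b ≫ φ i) (j.map (k i i') ≫ φ i) inferInstance inferInstance
    have h₁ : ε ≫ k i i' = b :=
      h𝒳.hom_unique_of_faithful j (γ := (hW i i').lift _ _ hb ≫ p₁ i i') (γ' := 𝒜.p.map b) (φ i)
        inferInstance inferInstance ((hW i i').lift_fst _ _ hb)
        (by rw [j.map_comp, Category.assoc, eε])
    have h₂ : ε ≫ l i i' = b' :=
      h𝒳.hom_unique_of_faithful j (γ := (hW i i').lift _ _ hb ≫ p₂ i i') (γ' := 𝒜.p.map b') (φ i')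
        inferInstance inferInstance ((hW i i').lift_snd _ _ hb)
        (by rw [j.map_comp, Category.assoc, hlk, eε, e])
    rw [← h₁, ← h₂, G.map_comp, G.map_comp, Category.assoc, Category.assoc, hρl]
  -- When `U` is empty the object `z` obtained by gluing may lie over any manifold and has to be
  -- replaced.
  have hz : ∃ (z : 𝒵.obj) (_ : 𝒵.p.obj z = U) (ρ : ∀ i, G.obj (q i) ⟶ z),
      (∀ i, 𝒵.p.IsHomLift (f i) (ρ i)) ∧ ∀ (i i' : U) (t : 𝒜.obj) (b : t ⟶ q i) (b' : t ⟶ q i'),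
      j.map b ≫ φ i = j.map b' ≫ φ i' → G.map b ≫ ρ i = G.map b' ≫ ρ i' := by
    rcases isEmpty_or_nonempty U with hU | ⟨⟨i⟩⟩
    · obtain ⟨y, hy⟩ := exists_obj_over_of_isEmpty h𝒵.groupoid.hasLifts z U hU
      exact ⟨y, hy, fun i => hU.elim i, fun i => hU.elim i, fun i => hU.elim i⟩
    · have := hρ i
      exact ⟨z, IsHomLift.codomain_eq 𝒵.p (f i) (ρ i), ρ, hρ, key⟩
  clear key hρl hρ ρ z
  obtain ⟨z, hz, ρ, hρ, key⟩ := hz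
  -- An arbitrary object of `𝒜` over `x` is locally an object over a member of the chosen covering.
  have cov : ∀ (s : 𝒜.obj) (χ : j.obj s ⟶ x) (g : 𝒜.p.obj s ⟶ U), 𝒳.p.IsHomLift g χ →
      ∀ m : 𝒜.p.obj s, ∃ (t : 𝒜.obj) (a : t ⟶ s) (b : t ⟶ q (g m)), IsNbhd (𝒜.p.map a) m ∧
        j.map a ≫ χ = j.map b ≫ φ (g m) := by
    intro s χ g hχ m
    obtain ⟨V, v₁, v₂, hv, hV, hVr⟩ := exists_isPullback (hf (g m)).1 g
    obtain ⟨t, a, ha⟩ := hl.exists_lift rfl v₁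
    obtain ⟨b, hb, eb⟩ := h𝒳.exists_factor_of_full j (s := t) v₂ hV.w.symm
      (j.map a ≫ χ) (φ (g m)) inferInstance (hφ _)
    refine ⟨t, a, b, ?_, eb.symm⟩
    have : IsNbhd v₁ m := ⟨hv, by rw [hVr]; exact (hf _).2⟩
    exact this.of_isHomLift ha
  have he : ∀ (s : 𝒜.obj) (χ : j.obj s ⟶ x), ∃ ε : G.obj s ⟶ z,
      (∀ g : 𝒜.p.obj s ⟶ U, 𝒳.p.IsHomLift g χ → 𝒵.p.IsHomLift g ε) ∧
      ∀ (i : U) (t : 𝒜.obj) (a : t ⟶ s) (b : t ⟶ q i), j.map a ≫ χ = j.map b ≫ φ i →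
        G.map a ≫ ε = G.map b ≫ ρ i := by
    intro s χ
    obtain ⟨g, hg⟩ := exists_isHomLift χ (j.w_obj s) hx
    -- The leg at `s` is glued from all local factorizations through the covering at once, so that
    -- no choice enters and naturality in `s` can be checked locally.
    obtain ⟨ε, hε, hε'⟩ := h𝒵.hom_glue (x := G.obj s) (y := z) (G.w_obj s) hz g
      (J := {T : Σ (i : U) (t : 𝒜.obj), (t ⟶ s) × (t ⟶ q i) //
        j.map T.2.2.1 ≫ χ = j.map T.2.2.2 ≫ φ T.1})
      (fun T => G.obj T.1.2.1) (fun T => G.map T.1.2.2.1) (fun T => G.map T.1.2.2.2 ≫ ρ T.1.1)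
      (fun T => 𝒜.p.obj T.1.2.1) (fun T => 𝒜.p.map T.1.2.2.1) (fun T => inferInstance)
      (by
        rintro ⟨⟨i, t, a, b⟩, e⟩
        have := hρ i
        have := hφ i
        have hb : 𝒜.p.map a ≫ g = 𝒜.p.map b ≫ f i :=
          isHomLift_unique (j.map a ≫ χ) inferInstance (by
            dsimp only at e
            rw [e]; infer_instance)
        change 𝒵.p.IsHomLift (𝒜.p.map a ≫ g) (G.map b ≫ ρ i)
        rw [hb]; infer_instance)
      (by
        intro m
        obtain ⟨t, a, b, hab, e⟩ := cov s χ g hg m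
        exact ⟨⟨⟨_, t, a, b⟩, e⟩, hab⟩)
      (by
        rintro ⟨⟨i, t, a, b⟩, e⟩ ⟨⟨i', t', a', b'⟩, e'⟩ y α β h
        dsimp only at e e' α β h ⊢
        obtain ⟨γ, hγ⟩ := exists_isHomLift α rfl (G.w_obj t)
        obtain ⟨δ, hδ⟩ := exists_isHomLift β rfl (G.w_obj t')
        obtain ⟨v, θ, hθ⟩ := hl.exists_lift rfl γ
        obtain ⟨α', hα', eα'⟩ := h𝒵.groupoid.exists_factor (𝟙 _) (Category.id_comp γ) α (G.map θ)
          hγ inferInstance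
        have hb : δ ≫ 𝒜.p.map a' = γ ≫ 𝒜.p.map a :=
          isHomLift_unique (β ≫ G.map a') inferInstance (by rw [← h]; infer_instance)
        obtain ⟨κ, hκ, eκ⟩ := h𝒳.exists_factor_of_full j (s := v) (q := t') δ hb
          (j.map θ ≫ j.map a) (j.map a') inferInstance inferInstance
        have eκ' : κ ≫ a' = θ ≫ a := j.toFunctor.map_injective (by
          rw [j.map_comp, j.map_comp]; exact eκ)
        have h₁ : α' ≫ G.map κ = β :=
          h𝒵.groupoid.hom_unique (γ := δ) (G.map a')
            (by rw [← Category.id_comp δ]; infer_instance) hδ (by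
            rw [Category.assoc, ← G.map_comp, eκ', G.map_comp, ← Category.assoc, eα', h])
        rw [← h₁, ← eα', Category.assoc, Category.assoc, ← Category.assoc (G.map θ),
          ← Category.assoc (G.map κ), ← G.map_comp, ← G.map_comp]
        congr 1
        refine key _ _ _ _ _ ?_
        rw [j.map_comp, j.map_comp, Category.assoc, Category.assoc, ← e, ← e', ← Category.assoc,
          ← Category.assoc, eκ])
    refine ⟨ε, fun g' hg' => ?_, fun i t a b e => hε' ⟨⟨i, t, a, b⟩, e⟩⟩
    rwa [isHomLift_unique χ hg' hg]
  choose e he₁ he₂ using he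
  refine ⟨z, hz, e, he₁, fun s' s m χ => ?_⟩
  obtain ⟨g, hg⟩ := exists_isHomLift χ (j.w_obj s) hx
  have := he₁ s χ g hg
  refine h𝒵.homs.hom_ext (G.w_obj s') (map_eq_of_isHomLift (f := 𝒜.p.map m ≫ g) inferInstance
    (he₁ _ _ _ inferInstance)) (fun n => ?_)
  obtain ⟨t, a, b, hab, h⟩ := cov s' (j.map m ≫ χ) (𝒜.p.map m ≫ g) inferInstance n
  refine ⟨_, _, G.obj t, G.map a, hab, inferInstance, ?_⟩
  rw [he₂ _ _ _ _ _ _ h, ← Category.assoc, ← G.map_comp]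
  refine he₂ _ _ _ _ _ _ ?_
  rw [← h, j.map_comp, Category.assoc]

end SatakeOrbifold

/-! ### Extension along local equivalences -/

namespace SatakeOrbifold

open Mfd

variable {𝕜 : Type} [RCLike 𝕜]

variable {𝒜 ℬ 𝒞 𝒳 𝒴 𝒵 : BasedCategory.{u, u + 1} (Mfd.{u} 𝕜)}

/-- A functor is based if it takes morphisms to lifts of their projections. -/
def basedFunctorOfIsHomLift (F : 𝒳.obj ⥤ 𝒵.obj)
    (h : ∀ {x y : 𝒳.obj} (f : x ⟶ y), 𝒵.p.IsHomLift (𝒳.p.map f) (F.map f)) : 𝒳 ⥤ᵇ 𝒵 where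
  toFunctor := F
  w := by
    have ho : ∀ x, 𝒵.p.obj (F.obj x) = 𝒳.p.obj x := fun x => by
      have := h (𝟙 x)
      exact IsHomLift.domain_eq 𝒵.p (𝒳.p.map (𝟙 x)) (F.map (𝟙 x))
    refine CategoryTheory.Functor.ext ho (fun x y f => ?_)
    have := h f
    exact IsHomLift.fac' 𝒵.p (𝒳.p.map f) (F.map f)

/-- A functor from a full subcategory of `𝒳` to a stack extends to `𝒳` if all objects of `𝒳` are
locally in the subcategory. -/
theorem exists_extension_of_full (j : 𝒜 ⥤ᵇ 𝒳) [j.toFunctor.Full] [j.toFunctor.Faithful]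
    (h𝒳 : IsGroupoidOver 𝒳) (hl : HasLifts 𝒜) (G : 𝒜 ⥤ᵇ 𝒵) (h𝒵 : IsStack 𝒵)
    (cov : ∀ (x : 𝒳.obj) (m : 𝒳.p.obj x), ∃ (q : 𝒜.obj) (φ : j.obj q ⟶ x)
      (f : 𝒜.p.obj q ⟶ 𝒳.p.obj x), IsNbhd f m ∧ 𝒳.p.IsHomLift f φ) :
    ∃ F : 𝒳 ⥤ᵇ 𝒵, Nonempty (j.comp F ≅ G) := by
  choose z hz e he hn using fun x => exists_cocone j h𝒳 hl G h𝒵 (x := x) rfl (cov x)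
  -- The legs of the cocone at `x` are jointly epimorphic among arrows with the same projection. All
  -- the functor identities below are tested on them.
  have ext : ∀ {x : 𝒳.obj} {y : 𝒵.obj} {ψ ψ' : z x ⟶ y}, 𝒵.p.map ψ = 𝒵.p.map ψ' →
      (∀ (q : 𝒜.obj) (φ : j.obj q ⟶ x), e x q φ ≫ ψ = e x q φ ≫ ψ') → ψ = ψ' := by
    intro x y ψ ψ' hb h
    refine h𝒵.homs.hom_ext (hz x) hb (fun m => ?_)
    obtain ⟨q, φ, f, hf, hφ⟩ := cov x m
    exact ⟨_, f, _, e x q φ, hf, he x q φ f hφ, h q φ⟩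
  -- An arrow `χ : x ⟶ y` takes objects over `x` to objects over `y`, hence the legs at `y` form a
  -- cocone under the objects over `x`, and they glue to an arrow between the vertices.
  have hF : ∀ {x y : 𝒳.obj} (χ : x ⟶ y), ∃ ψ : z x ⟶ z y, 𝒵.p.IsHomLift (𝒳.p.map χ) ψ ∧
      ∀ (q : 𝒜.obj) (φ : j.obj q ⟶ x), e x q φ ≫ ψ = e y q (φ ≫ χ) := by
    intro x y χ
    choose g hg using fun (q : 𝒜.obj) (φ : j.obj q ⟶ x) => exists_isHomLift φ (j.w_obj q) rfl
    obtain ⟨ψ, h₁, h₂⟩ := h𝒵.hom_glue (hz x) (hz y) (𝒳.p.map χ) (J := Σ q : 𝒜.obj, (j.obj q ⟶ x))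
      (fun T => G.obj T.1) (fun T => e x T.1 T.2) (fun T => e y T.1 (T.2 ≫ χ))
      (fun T => 𝒜.p.obj T.1) (fun T => g T.1 T.2) (fun T => he _ _ _ _ (hg _ _))
      (fun T => he _ _ _ _ (by have := hg T.1 T.2; infer_instance))
      (fun m => by
        obtain ⟨q, φ, f, hf, hφ⟩ := cov x m
        refine ⟨⟨q, φ⟩, ?_⟩
        rwa [isHomLift_unique φ (hg q φ) hφ])
      (by
        rintro ⟨q, φ⟩ ⟨q', φ'⟩ y' α β h
        dsimp only at α β h ⊢
        obtain ⟨γ, hγ⟩ := exists_isHomLift α rfl (G.w_obj q)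
        obtain ⟨δ, hδ⟩ := exists_isHomLift β rfl (G.w_obj q')
        obtain ⟨t, θ, hθ⟩ := hl.exists_lift rfl γ
        obtain ⟨α', hα', eα'⟩ := h𝒵.groupoid.exists_factor (𝟙 _) (Category.id_comp γ) α (G.map θ)
          hγ inferInstance
        have := hg q φ
        have := hg q' φ'
        have := he _ _ _ _ (hg q φ)
        have := he _ _ _ _ (hg q' φ')
        have hb : δ ≫ g q' φ' = γ ≫ g q φ :=
          isHomLift_unique (β ≫ e x q' φ') inferInstance (by rw [← h]; infer_instance)
        obtain ⟨κ, hκ, eκ⟩ := h𝒳.exists_factor_of_full j (s := t) (q := q') δ hb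
          (j.map θ ≫ φ) φ' inferInstance inferInstance
        have h₁ : α' ≫ G.map κ = β :=
          h𝒵.groupoid.hom_unique (γ := δ) (e x q' φ')
            (by rw [← Category.id_comp δ]; infer_instance) hδ (by
            rw [Category.assoc, hn, eκ, ← hn, ← Category.assoc, eα', h])
        rw [← h₁, ← eα', Category.assoc, Category.assoc, hn, hn, ← Category.assoc,
          ← Category.assoc (j.map κ), eκ])
    exact ⟨ψ, h₁, fun q φ => h₂ ⟨q, φ⟩⟩
  choose ψ hψ hψe using @hF
  have hmap : ∀ {x y : 𝒳.obj} {χ χ' : z x ⟶ z y} (f : 𝒳.p.obj x ⟶ 𝒳.p.obj y),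
      𝒵.p.IsHomLift f χ → 𝒵.p.IsHomLift f χ' → 𝒵.p.map χ = 𝒵.p.map χ' :=
    fun f h h' => map_eq_of_isHomLift h h'
  let F₀ : 𝒳.obj ⥤ 𝒵.obj :=
    { obj := z
      map := ψ
      map_id := fun x => ext (hmap (𝟙 _) (by rw [← 𝒳.p.map_id]; exact hψ _)
        (IsHomLift.id (hz x))) (fun q φ => by rw [hψe, Category.comp_id, Category.comp_id])
      map_comp := fun f g => ext (hmap (𝒳.p.map (f ≫ g)) (hψ _) (by
        have := hψ f
        have := hψ g
        rw [𝒳.p.map_comp]; infer_instance)) (fun q φ => by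
          rw [hψe, ← Category.assoc (e _ q φ), hψe, hψe, Category.assoc]) }
  let F : 𝒳 ⥤ᵇ 𝒵 := basedFunctorOfIsHomLift F₀ hψ
  -- For `x = j q` the leg at the identity lies over an identity; it is the component at `q` of the
  -- isomorphism between `G` and the restriction of `F`.
  have hc : ∀ q : 𝒜.obj, 𝒵.p.IsHomLift (𝟙 (𝒜.p.obj q)) (e (j.obj q) q (𝟙 _)) := by
    intro q
    have h₁ : ∃ f : 𝒜.p.obj q ⟶ 𝒳.p.obj (j.obj q), 𝒳.p.IsHomLift f (𝟙 (j.obj q)) :=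
      exists_isHomLift _ (j.w_obj q) rfl
    obtain ⟨f, hf⟩ := h₁
    have := he _ _ _ _ hf
    -- Generalizing over both base objects makes it possible to substitute their equality.
    have h₂ : ∀ (R S : Mfd.{u} 𝕜) (hR : R = S) (f : R ⟶ S) (_ : 𝒳.p.IsHomLift f (𝟙 (j.obj q)))
        (_ : 𝒵.p.IsHomLift f (e (j.obj q) q (𝟙 _))),
        𝒵.p.IsHomLift (𝟙 R) (e (j.obj q) q (𝟙 _)) := by
      intro R S hR f h h'
      subst hR
      rwa [isHomLift_unique (𝟙 (j.obj q)) (f := 𝟙 R) (g := f)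
        (IsHomLift.id (IsHomLift.domain_eq 𝒳.p f (𝟙 (j.obj q)))) h]
    exact h₂ _ _ (j.w_obj q).symm f hf this
  have hiso : ∀ q, IsIso (e (j.obj q) q (𝟙 _)) := fun q =>
    h𝒵.groupoid.isIso_of_isHomLift _ (hc q)
  refine ⟨F, ⟨(BasedNatIso.mkNatIso (NatIso.ofComponents
    (fun q => @asIso _ _ _ _ (e (j.obj q) q (𝟙 _)) (hiso q)) ?_) hc).symm⟩⟩
  intro q q' m
  change G.map m ≫ e (j.obj q') q' (𝟙 _) = e (j.obj q) q (𝟙 _) ≫ ψ (j.map m)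
  rw [hn, hψe, Category.comp_id, Category.id_comp]

/-! ### Extension first to the full image of a local equivalence, then to the whole stack. -/

/-- The objects of the full image of a functor. -/
def FullImage (_ : 𝒜 ⥤ᵇ 𝒳) : Type (u + 1) := 𝒜.obj

instance (ℓ : 𝒜 ⥤ᵇ 𝒳) : Category.{u} (FullImage ℓ) where
  Hom a b := ℓ.obj a ⟶ ℓ.obj b
  id a := 𝟙 (ℓ.obj a)
  comp {a b c} (f : ℓ.obj a ⟶ ℓ.obj b) (g : ℓ.obj b ⟶ ℓ.obj c) := f ≫ g
  id_comp {a b} (f : ℓ.obj a ⟶ ℓ.obj b) := Category.id_comp f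
  comp_id {a b} (f : ℓ.obj a ⟶ ℓ.obj b) := Category.comp_id f
  assoc {a b c d} (f : ℓ.obj a ⟶ ℓ.obj b) (g : ℓ.obj b ⟶ ℓ.obj c) (h : ℓ.obj c ⟶ ℓ.obj d) :=
    Category.assoc f g h

/-- The full subcategory of `𝒳` given by a functor to `𝒳`. -/
def fullImage (ℓ : 𝒜 ⥤ᵇ 𝒳) : BasedCategory.{u, u + 1} (Mfd.{u} 𝕜) where
  obj := FullImage ℓ
  p :=
    { obj := fun a => 𝒳.p.obj (ℓ.obj a)
      map := fun {a b} (f : ℓ.obj a ⟶ ℓ.obj b) => 𝒳.p.map f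
      map_id := fun a => 𝒳.p.map_id (ℓ.obj a)
      map_comp := fun {a b c} (f : ℓ.obj a ⟶ ℓ.obj b) (g : ℓ.obj b ⟶ ℓ.obj c) =>
        𝒳.p.map_comp f g }

/-- The inclusion of the full image of a functor. -/
def fullImageIncl (ℓ : 𝒜 ⥤ᵇ 𝒳) : fullImage ℓ ⥤ᵇ 𝒳 where
  obj := fun a : FullImage ℓ => ℓ.obj a
  map := fun {a b : FullImage ℓ} (f : ℓ.obj a ⟶ ℓ.obj b) => f
  map_id _ := rfl
  map_comp _ _ := rfl
  w := rfl

/-- The functor to the full image. -/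
def toFullImage (ℓ : 𝒜 ⥤ᵇ 𝒳) : 𝒜 ⥤ᵇ fullImage ℓ where
  obj := fun a : 𝒜.obj => (a : FullImage ℓ)
  map f := ℓ.map f
  map_id _ := ℓ.map_id _
  map_comp _ _ := ℓ.map_comp _ _
  w := ℓ.w

instance (ℓ : 𝒜 ⥤ᵇ 𝒳) : (fullImageIncl ℓ).toFunctor.Full :=
  ⟨fun {a b : FullImage ℓ} (f : ℓ.obj a ⟶ ℓ.obj b) => ⟨f, rfl⟩⟩

instance (ℓ : 𝒜 ⥤ᵇ 𝒳) : (fullImageIncl ℓ).toFunctor.Faithful :=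
  ⟨fun {a b : FullImage ℓ} {f g : ℓ.obj a ⟶ ℓ.obj b} (h : f = g) => h⟩

theorem hasLifts_fullImage (ℓ : 𝒜 ⥤ᵇ 𝒳) (h : HasLifts 𝒜) : HasLifts (fullImage ℓ) := by
  intro (x : 𝒜.obj) U α
  obtain ⟨y, a, ha⟩ := h.exists_lift (x := x) (ℓ.w_obj x).symm α
  exact ⟨y, (toFullImage ℓ).map a,
    @BasedFunctor.preserves_isHomLift _ _ _ _ (toFullImage ℓ) _ _ _ _ α a ha⟩

/-- A functor to a stack extends to the morphisms of the full image of a local equivalence. -/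
theorem exists_extension_fullImage {ℓ : 𝒜 ⥤ᵇ 𝒳} (hℓ : IsLocalEquiv ℓ) (h𝒳 : IsGroupoidOver 𝒳)
    (hl : HasLifts 𝒜) (G : 𝒜 ⥤ᵇ 𝒵) (h𝒵 : IsStack 𝒵) :
    ∃ G' : fullImage ℓ ⥤ᵇ 𝒵, Nonempty ((toFullImage ℓ).comp G' ≅ G) := by
  have hG : ∀ {s q : 𝒜.obj} (χ : ℓ.obj s ⟶ ℓ.obj q), ∃ ε : G.obj s ⟶ G.obj q,
      (∀ f : 𝒜.p.obj s ⟶ 𝒜.p.obj q, 𝒳.p.IsHomLift f χ → 𝒵.p.IsHomLift f ε) ∧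
      ∀ (r : 𝒜.obj) (m : r ⟶ s) (n : r ⟶ q), ℓ.map m ≫ χ = ℓ.map n → G.map m ≫ ε = G.map n := by
    intro s q χ
    obtain ⟨g, hg⟩ := exists_isHomLift χ (ℓ.w_obj s) (ℓ.w_obj q)
    -- The value at `χ` has to be `(G m)⁻¹ (G n)` wherever `χ` is the fraction `m⁻¹ n` of arrows of
    -- `𝒜`; local fullness says that such fractions exist near every point.
    obtain ⟨ε, h₁, h₂⟩ := h𝒵.hom_glue (G.w_obj s) (G.w_obj q) g
      (J := {T : Σ r : 𝒜.obj, (r ⟶ s) × (r ⟶ q) // ℓ.map T.2.1 ≫ χ = ℓ.map T.2.2})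
      (fun T => G.obj T.1.1) (fun T => G.map T.1.2.1) (fun T => G.map T.1.2.2)
      (fun T => 𝒜.p.obj T.1.1) (fun T => 𝒜.p.map T.1.2.1) (fun T => inferInstance)
      (by
        rintro ⟨⟨r, m, n⟩, e⟩
        dsimp only at e ⊢
        have hb : 𝒜.p.map m ≫ g = 𝒜.p.map n :=
          isHomLift_unique (ℓ.map m ≫ χ) inferInstance (by rw [e]; infer_instance)
        rw [hb]; infer_instance)
      (by
        intro m
        obtain ⟨r, ρ, φ, hρ, e⟩ := hℓ.full s q χ m
        exact ⟨⟨⟨r, ρ, φ⟩, e.symm⟩, hρ⟩)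
      (by
        rintro ⟨⟨r, m, n⟩, e⟩ ⟨⟨r', m', n'⟩, e'⟩ y α β h
        dsimp only at e e' α β h ⊢
        obtain ⟨γ, hγ⟩ := exists_isHomLift α rfl (G.w_obj r)
        obtain ⟨δ, hδ⟩ := exists_isHomLift β rfl (G.w_obj r')
        obtain ⟨v, θ, hθ⟩ := hl.exists_lift rfl γ
        obtain ⟨α', hα', eα'⟩ := h𝒵.groupoid.exists_factor (𝟙 _) (Category.id_comp γ) α (G.map θ)
          hγ inferInstance
        have hb : δ ≫ 𝒜.p.map m' = γ ≫ 𝒜.p.map m :=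
          isHomLift_unique (β ≫ G.map m') inferInstance (by rw [← h]; infer_instance)
        obtain ⟨κ, hκ, eκ⟩ := h𝒳.exists_factor δ hb (ℓ.map θ ≫ ℓ.map m) (ℓ.map m') inferInstance
          inferInstance
        have hv : 𝒜.p.obj v = 𝒵.p.obj y := IsHomLift.domain_eq 𝒜.p γ θ
        -- The arrow `κ`, which compares two fractions, exists only in `𝒳`. Near each point it is
        -- replaced by an arrow `σ` of `𝒜`; the two equations that hold after `ℓ` then hold in `𝒜`
        -- after two further restrictions, by local faithfulness.
        have loc : ∀ k : 𝒵.p.obj y, ∃ (t : 𝒜.obj) (τ : t ⟶ v) (σ : t ⟶ r')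
            (f : 𝒜.p.obj t ⟶ 𝒵.p.obj y), IsNbhd f k ∧ 𝒜.p.IsHomLift f τ ∧
            ℓ.map σ = ℓ.map τ ≫ κ ∧ σ ≫ m' = τ ≫ θ ≫ m ∧ σ ≫ n' = τ ≫ θ ≫ n := by
          intro k
          obtain ⟨t, τ, σ, f, ⟨hf, k₁, rfl⟩, hτ, h₁⟩ := hℓ.full_at hv κ k
          obtain ⟨t₁, ι₁, ⟨hι₁, k₂, rfl⟩, h₂⟩ := hℓ.faithful t r' |> fun _ =>
            hℓ.faithful t s (σ ≫ m') (τ ≫ θ ≫ m) (by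
              rw [ℓ.map_comp, h₁, Category.assoc, eκ, ℓ.map_comp, ℓ.map_comp]) k₁
          obtain ⟨t₂, ι₂, hι₂, h₃⟩ := hℓ.faithful t₁ q (ι₁ ≫ σ ≫ n') (ι₁ ≫ τ ≫ θ ≫ n) (by
              simp only [ℓ.map_comp, h₁, Category.assoc, ← e, ← e', reassoc_of% eκ]) k₂
          refine ⟨t₂, ι₂ ≫ ι₁ ≫ τ, ι₂ ≫ ι₁ ≫ σ, 𝒜.p.map ι₂ ≫ 𝒜.p.map ι₁ ≫ f,
            hι₂.comp (hι₁.comp hf), inferInstance, ?_, ?_, ?_⟩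
          · simp [h₁]
          · simp only [Category.assoc, h₂]
          · simp only [Category.assoc, h₃]
        have := h𝒵.groupoid.isIso_of_isHomLift α' hα'
        have hβ : 𝒵.p.IsHomLift δ (inv α' ≫ β) := by
          rw [← Category.id_comp δ]; infer_instance
        rw [← eα', Category.assoc, ← IsIso.eq_inv_comp, ← G.map_comp, ← Category.assoc]
        refine h𝒵.homs.hom_ext (x := G.obj v) ((G.w_obj v).trans hv) (map_eq_of_isHomLift
          (f := γ ≫ 𝒜.p.map n) inferInstance ?_) (fun k => ?_)
        · have : δ ≫ 𝒜.p.map n' = γ ≫ 𝒜.p.map n := by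
            refine isHomLift_unique (κ ≫ ℓ.map n') inferInstance ?_
            rw [← e', reassoc_of% eκ, e]
            infer_instance
          rw [← this]
          infer_instance
        · obtain ⟨t, τ, σ, f, hf, hτ, h₁, h₂, h₃⟩ := loc k
          refine ⟨_, f, _, G.map τ, hf, inferInstance, ?_⟩
          have hσ : 𝒜.p.IsHomLift (f ≫ δ) σ := by
            rw [← ℓ.isHomLift_iff, h₁]; infer_instance
          have h₄ : G.map τ ≫ inv α' ≫ β = G.map σ := by
            refine h𝒵.groupoid.hom_unique (γ := f ≫ δ) (G.map m') inferInstance inferInstance ?_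
            rw [Category.assoc, Category.assoc, ← h, ← G.map_comp, h₂, ← eα', Category.assoc,
              IsIso.inv_hom_id_assoc, G.map_comp, G.map_comp]
          rw [← Category.assoc, h₄, ← G.map_comp, ← G.map_comp, h₃])
    refine ⟨ε, fun f hf => ?_, fun r m n e => h₂ ⟨⟨r, m, n⟩, e⟩⟩
    rwa [isHomLift_unique χ hf hg]
  choose ε hε hε' using @hG
  have ext : ∀ {s q : 𝒜.obj} {ψ ψ' : G.obj s ⟶ G.obj q} (f : 𝒜.p.obj s ⟶ 𝒜.p.obj q),
      𝒵.p.IsHomLift f ψ → 𝒵.p.IsHomLift f ψ' →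
      (∀ k : 𝒜.p.obj s, ∃ (t : 𝒜.obj) (τ : t ⟶ s), IsNbhd (𝒜.p.map τ) k ∧
        G.map τ ≫ ψ = G.map τ ≫ ψ') → ψ = ψ' := by
    intro s q ψ ψ' f h h' hloc
    refine h𝒵.homs.hom_ext (G.w_obj s) (map_eq_of_isHomLift h h') (fun k => ?_)
    obtain ⟨t, τ, hτ, e⟩ := hloc k
    exact ⟨_, _, _, G.map τ, hτ, inferInstance, e⟩
  have hmap : ∀ {s q : 𝒜.obj} (m : s ⟶ q), ε (ℓ.map m) = G.map m := by
    intro s q m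
    have := hε' (ℓ.map m) s (𝟙 s) m (by simp)
    simpa using this
  have hcomp : ∀ {a b c : 𝒜.obj} (χ : ℓ.obj a ⟶ ℓ.obj b) (χ' : ℓ.obj b ⟶ ℓ.obj c),
      ε (χ ≫ χ') = ε χ ≫ ε χ' := by
    intro a b c χ χ'
    obtain ⟨f, hf⟩ := exists_isHomLift χ (ℓ.w_obj a) (ℓ.w_obj b)
    obtain ⟨f', hf'⟩ := exists_isHomLift χ' (ℓ.w_obj b) (ℓ.w_obj c)
    have := hε _ _ hf
    have := hε _ _ hf'
    refine ext (f ≫ f') (hε _ _ inferInstance) inferInstance (fun k => ?_)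
    obtain ⟨t, τ, φ, ⟨hτ, k₁, rfl⟩, e⟩ := hℓ.full _ _ χ k
    obtain ⟨t', τ', φ', hτ', e'⟩ := hℓ.full _ _ (ℓ.map φ ≫ χ') k₁
    refine ⟨t', τ' ≫ τ, by rw [𝒜.p.map_comp]; exact hτ'.comp hτ, ?_⟩
    rw [hε' (χ ≫ χ') t' (τ' ≫ τ) φ' (by
      rw [e', e, ℓ.map_comp]; simp only [Category.assoc])]
    rw [G.map_comp, Category.assoc, ← Category.assoc (G.map τ),
      hε' χ t τ φ e.symm, ← Category.assoc, ← G.map_comp]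
    refine (hε' χ' t' (τ' ≫ φ) φ' ?_).symm
    rw [e', ℓ.map_comp, Category.assoc]
  have hlift : ∀ {a b : 𝒜.obj} (χ : ℓ.obj a ⟶ ℓ.obj b), 𝒵.p.IsHomLift (𝒳.p.map χ) (ε χ) := by
    intro a b χ
    obtain ⟨f, hf⟩ := exists_isHomLift χ (ℓ.w_obj a) (ℓ.w_obj b)
    have h₁ := hε _ _ hf
    -- Passage from the projection written with the bases in `𝒜` to the one written with the equal
    -- bases in `𝒳`.
    have h₂ : ∀ (R S R' S' : Mfd.{u} 𝕜) (f : R ⟶ S) (g : R' ⟶ S'), 𝒳.p.IsHomLift f χ →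
        𝒳.p.IsHomLift g χ → 𝒵.p.IsHomLift f (ε χ) → 𝒵.p.IsHomLift g (ε χ) := by
      intro R S R' S' f g hf hg h
      obtain rfl : R = R' := (IsHomLift.domain_eq 𝒳.p f χ).symm.trans (IsHomLift.domain_eq 𝒳.p g χ)
      obtain rfl : S = S' :=
        (IsHomLift.codomain_eq 𝒳.p f χ).symm.trans (IsHomLift.codomain_eq 𝒳.p g χ)
      rwa [isHomLift_unique χ hg hf]
    exact h₂ _ _ _ _ f _ hf inferInstance h₁
  let G₀ : (fullImage ℓ).obj ⥤ 𝒵.obj :=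
    { obj := fun a : 𝒜.obj => G.obj a
      map := fun {a b : 𝒜.obj} (f : ℓ.obj a ⟶ ℓ.obj b) => ε f
      map_id := fun a : 𝒜.obj => by
        refine Eq.trans ?_ (G.map_id a)
        rw [← hmap, ℓ.map_id]
        rfl
      map_comp := fun {a b c : 𝒜.obj} (χ : ℓ.obj a ⟶ ℓ.obj b) (χ' : ℓ.obj b ⟶ ℓ.obj c) =>
        hcomp χ χ' }
  let G' : fullImage ℓ ⥤ᵇ 𝒵 := basedFunctorOfIsHomLift G₀
    (fun {a b : 𝒜.obj} (χ : ℓ.obj a ⟶ ℓ.obj b) => hlift χ)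
  refine ⟨G', ⟨BasedNatIso.mkNatIso (NatIso.ofComponents
    (fun a : 𝒜.obj => (Iso.refl (G.obj a) : G'.obj a ≅ G.obj a)) ?_) ?_⟩⟩
  · intro a b m
    change ε (ℓ.map m) ≫ 𝟙 _ = 𝟙 _ ≫ G.map m
    rw [hmap, Category.comp_id, Category.id_comp]
  · intro a
    exact IsHomLift.id (G.w_obj a)

/-- The universal property of the associated stack. -/
theorem exists_extension {ℓ : 𝒜 ⥤ᵇ 𝒳} (hℓ : IsLocalEquiv ℓ) (h𝒳 : IsGroupoidOver 𝒳)
    (hl : HasLifts 𝒜) (G : 𝒜 ⥤ᵇ 𝒵) (h𝒵 : IsStack 𝒵) :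
    ∃ F : 𝒳 ⥤ᵇ 𝒵, Nonempty (ℓ.comp F ≅ G) := by
  obtain ⟨G', ⟨i⟩⟩ := exists_extension_fullImage hℓ h𝒳 hl G h𝒵
  obtain ⟨F, ⟨i'⟩⟩ := exists_extension_of_full (fullImageIncl ℓ) h𝒳 (hasLifts_fullImage ℓ hl) G' h𝒵
    (fun x m => by
      obtain ⟨q, φ, f, hf, hφ⟩ := hℓ.surj x m
      obtain ⟨g, hg, hg'⟩ := hf.exists_of_eq (ℓ.w_obj q) hφ
      exact ⟨q, φ, g, hg, hg'⟩)
  exact ⟨F, ⟨(precomp (toFullImage ℓ) 𝒵).mapIso i' ≪≫ i⟩⟩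

/-- Every object of `𝒳` is locally of the form `ℓ q`, and by naturality the components of a
transformation are determined locally. -/
theorem precomp_faithful {ℓ : 𝒜 ⥤ᵇ 𝒳} (hℓ : IsLocalEquiv ℓ) (h𝒵 : IsStack 𝒵) :
    (precomp ℓ 𝒵).Faithful := by
  refine ⟨fun {F F'} η θ h => ?_⟩
  refine BasedNatTrans.homCategory.ext _ _ (NatTrans.ext (funext fun x => ?_))
  refine h𝒵.homs.hom_ext (F.w_obj x) (map_eq_of_isHomLift (BasedNatTrans.app_isHomLift η x)
    (BasedNatTrans.app_isHomLift θ x)) (fun m => ?_)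
  obtain ⟨q, φ, f, hf, hφ⟩ := hℓ.surj x m
  refine ⟨_, f, _, F.map φ, hf, inferInstance, ?_⟩
  have hq : η.app (ℓ.obj q) = θ.app (ℓ.obj q) := congrArg
    (fun k : (precomp ℓ 𝒵).obj F ⟶ (precomp ℓ 𝒵).obj F' => k.app q) h
  rw [η.naturality, θ.naturality, hq]

/-- The component at `x` is glued from the arrows `a q ≫ F' φ`, for all `φ : ℓ q ⟶ x`. -/
theorem precomp_full {ℓ : 𝒜 ⥤ᵇ 𝒳} (hℓ : IsLocalEquiv ℓ) (h𝒳 : IsGroupoidOver 𝒳)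
    (h𝒵 : IsStack 𝒵) : (precomp ℓ 𝒵).Full := by
  refine ⟨fun {F F'} (η : ℓ.comp F ⟶ ℓ.comp F') => ?_⟩
  -- The components are renamed so that their types mention `F` and `ℓ` separately instead of the
  -- composite functor.
  have hη : ∀ q : 𝒜.obj, ∃ k : F.obj (ℓ.obj q) ⟶ F'.obj (ℓ.obj q), k = η.app q :=
    fun q => ⟨_, rfl⟩
  choose a ha using hη
  have ha₁ : ∀ q, 𝒵.p.IsHomLift (𝟙 (𝒜.p.obj q)) (a q) := fun q => by
    rw [ha]; exact η.isHomLift' q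
  have ha₂ : ∀ {q q' : 𝒜.obj} (m : q ⟶ q'),
      F.map (ℓ.map m) ≫ a q' = a q ≫ F'.map (ℓ.map m) := fun m => by
    rw [ha, ha]; exact η.naturality m
  have hF : ∀ x : 𝒳.obj, ∃ ψ : F.obj x ⟶ F'.obj x, 𝒵.p.IsHomLift (𝟙 (𝒳.p.obj x)) ψ ∧
      ∀ (q : 𝒜.obj) (φ : ℓ.obj q ⟶ x), F.map φ ≫ ψ = a q ≫ F'.map φ := by
    intro x
    choose g hg using fun (q : 𝒜.obj) (φ : ℓ.obj q ⟶ x) => exists_isHomLift φ (ℓ.w_obj q) rfl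
    obtain ⟨ψ, h₁, h₂⟩ := h𝒵.hom_glue (F.w_obj x) (F'.w_obj x) (𝟙 _)
      (J := Σ q : 𝒜.obj, (ℓ.obj q ⟶ x)) (fun T => F.obj (ℓ.obj T.1)) (fun T => F.map T.2)
      (fun T => a T.1 ≫ F'.map T.2) (fun T => 𝒜.p.obj T.1) (fun T => g T.1 T.2)
      (fun T => by have := hg T.1 T.2; infer_instance)
      (fun T => by
        have := hg T.1 T.2
        have := ha₁ T.1
        infer_instance)
      (fun m => by
        obtain ⟨q, φ, f, hf, hφ⟩ := hℓ.surj x m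
        refine ⟨⟨q, φ⟩, ?_⟩
        rwa [isHomLift_unique φ (hg q φ) hφ])
      (by
        rintro ⟨q, φ⟩ ⟨q', φ'⟩ v α β h
        dsimp only at α β h ⊢
        have := hg q φ
        have := hg q' φ'
        have := ha₁ q
        have := ha₁ q'
        obtain ⟨γ, hγ⟩ := exists_isHomLift α rfl ((F.w_obj _).trans (ℓ.w_obj q))
        obtain ⟨δ, hδ⟩ := exists_isHomLift β rfl ((F.w_obj _).trans (ℓ.w_obj q'))
        obtain ⟨y, θ, hθ⟩ := h𝒳.hasLifts.exists_lift (ℓ.w_obj q) γ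
        obtain ⟨α', hα', eα'⟩ := h𝒵.groupoid.exists_factor (𝟙 _) (Category.id_comp γ) α (F.map θ)
          hγ inferInstance
        have hb : δ ≫ g q' φ' = γ ≫ g q φ :=
          isHomLift_unique (β ≫ F.map φ') inferInstance (by rw [← h]; infer_instance)
        obtain ⟨κ, hκ, eκ⟩ := h𝒳.exists_factor δ hb (θ ≫ φ) φ' inferInstance inferInstance
        have h₁ : α' ≫ F.map κ = β :=
          h𝒵.groupoid.hom_unique (γ := δ) (F.map φ')
            (by rw [← Category.id_comp δ]; infer_instance) hδ (by
            rw [Category.assoc, ← F.map_comp, eκ, F.map_comp, ← Category.assoc, eα', h])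
        rw [← h₁, ← eα', Category.assoc, Category.assoc]
        congr 1
        have hy : 𝒳.p.obj y = 𝒵.p.obj v := IsHomLift.domain_eq 𝒳.p γ θ
        refine h𝒵.homs.hom_ext ((F.w_obj y).trans hy) (map_eq_of_isHomLift (f := γ ≫ g q φ)
          inferInstance (by rw [← hb]; infer_instance)) (fun k => ?_)
        -- Naturality of `a` is known only for arrows of `𝒜`, so `θ` and `κ` are replaced locally by
        -- images of such arrows with a common source.
        obtain ⟨r, σ, f, m, n, hf, hσ, e₁, e₂⟩ := hℓ.exists_span hy θ κ k
        refine ⟨_, f, _, F.map σ, hf, inferInstance, ?_⟩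
        rw [← Category.assoc, ← F.map_comp, e₁, ← Category.assoc, ha₂, Category.assoc,
          ← F'.map_comp, ← e₁, ← Category.assoc (F.map σ), ← F.map_comp, e₂, ← Category.assoc,
          ha₂, Category.assoc, Category.assoc, ← F'.map_comp, ← e₂, Category.assoc, eκ])
    exact ⟨ψ, h₁, fun q φ => h₂ ⟨q, φ⟩⟩
  choose ψ hψ hψe using hF
  refine ⟨⟨⟨ψ, fun x y χ => ?_⟩, hψ⟩, ?_⟩
  · have := hψ x
    have := hψ y
    refine h𝒵.homs.hom_ext (F.w_obj x) (map_eq_of_isHomLift (f := 𝒳.p.map χ) inferInstance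
      inferInstance) (fun m => ?_)
    obtain ⟨q, φ, f, hf, hφ⟩ := hℓ.surj x m
    refine ⟨_, f, _, F.map φ, hf, inferInstance, ?_⟩
    rw [← Category.assoc, ← F.map_comp, hψe, ← Category.assoc, hψe, Category.assoc, F'.map_comp]
  · refine BasedNatTrans.homCategory.ext _ _ (NatTrans.ext (funext fun q => ?_))
    change ψ (ℓ.obj q) = η.app q
    rw [← ha]
    simpa using hψe (ℓ.obj q) q (𝟙 _)

/-- Applied to the total category of the diagram, this shows that the associated stack is a
2-colimit. Only liftability is required of `𝒜`; it need not be fibred in groupoids. -/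
theorem IsAssociatedStack.precomp_isEquivalence {ℓ : 𝒜 ⥤ᵇ 𝒳} (hℓ : IsAssociatedStack ℓ)
    (hl : HasLifts 𝒜) (h𝒵 : IsStack 𝒵) : (precomp ℓ 𝒵).IsEquivalence where
  faithful := precomp_faithful hℓ.isLocalEquiv h𝒵
  full := precomp_full hℓ.isLocalEquiv hℓ.isStack.groupoid h𝒵
  essSurj := ⟨fun G => exists_extension hℓ.isLocalEquiv hℓ.isStack.groupoid hl G h𝒵⟩

end SatakeOrbifold

/-! ### Gluing of smooth maps and descent data -/

namespace SatakeOrbifold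

open Mfd

variable {𝕜 : Type} [RCLike 𝕜]

/-- Smooth maps between manifolds. -/
def IsSmooth (M N : Mfd.{u} 𝕜) (f : M → N) : Prop := SmoothOn f univ

theorem IsSmooth.comp {M N P : Mfd.{u} 𝕜} {f : M → N} {g : N → P} (hg : IsSmooth N P g)
    (hf : IsSmooth M N f) : IsSmooth M P (fun x => g (f x)) :=
  SmoothOn.comp hg hf

theorem isSmooth_hom {M N : Mfd.{u} 𝕜} (f : M ⟶ N) : IsSmooth M N f := f.smooth

theorem isSmooth_const {M N : Mfd.{u} 𝕜} (y : N) : IsSmooth M N (fun _ => y) :=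
  ⟨continuousOn_const, fun _ _ _ _ _ _ => contDiffOn_const⟩

theorem isSmooth_of_locally {M N : Mfd.{u} 𝕜} {f : M → N}
    (h : ∀ x, ∃ (W : Mfd.{u} 𝕜) (k : W ⟶ M), IsNbhd k x ∧ IsSmooth W N (fun w => f (k w))) :
    IsSmooth M N f :=
  smoothOn_univ_of_etale (fun x => by
    obtain ⟨W, k, hk, hf⟩ := h x
    exact ⟨W, k, hk.1.1, hk.2, hf⟩)

/-- Neighbourhoods can be pulled back along smooth maps. -/
theorem exists_nbhd_lift {M N V : Mfd.{u} 𝕜} {g : M → N} (hg : IsSmooth M N g) {f : V ⟶ N} (m : M)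
    (hf : IsNbhd f (g m)) : ∃ (W : Mfd.{u} 𝕜) (k : W ⟶ M) (l : W ⟶ V), IsNbhd k m ∧
      ∀ w, f (l w) = g (k w) := by
  obtain ⟨W, k, l, hk, hp, hr⟩ := exists_isPullback hf.1 (⟨g, hg⟩ : M ⟶ N)
  refine ⟨W, k, l, ⟨hk, ?_⟩, fun w => ?_⟩
  · rw [hr]; exact hf.2
  · exact (hom_congr_apply hp.w w).symm

namespace GroupoidIn

variable (G : GroupoidIn.{u} 𝕜)

/-- The points of a groupoid, as objects of its groupoid of points. -/
def Pt : Type u := G.G₀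

variable {G}

/-- Naturality along the points of `M` shows that the composition of `M`-valued points is computed
pointwise. Thus the ordinary groupoid `G.Pt` of points, together with smoothness of families of
arrows, suffices for calculations in `G`. -/
theorem comp_apply {M : Mfd.{u} 𝕜} (f g : M ⟶ G.G₁) (h : f ≫ G.t = g ≫ G.s) (m : M)
    (h' : (point (f m) : pt 𝕜 ⟶ G.G₁) ≫ G.t = (point (g m) : pt 𝕜 ⟶ G.G₁) ≫ G.s) :
    (G.comp f g h) m = (G.comp (point (f m)) (point (g m)) h') PUnit.unit :=
  hom_congr_apply (G.comp_nat (point m) f g h h') PUnit.unit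

instance : Category.{u} G.Pt where
  Hom x y := {γ : G.G₁ // G.s γ = x ∧ G.t γ = y}
  id x := ⟨G.one x, hom_congr_apply G.one_s x, hom_congr_apply G.one_t x⟩
  comp {x y z} a b :=
    have h : (point a.1 : pt 𝕜 ⟶ G.G₁) ≫ G.t = (point b.1 : pt 𝕜 ⟶ G.G₁) ≫ G.s :=
      Mfd.hom_ext fun _ => a.2.2.trans b.2.1.symm
    ⟨(G.comp (point a.1) (point b.1) h) PUnit.unit,
      (hom_congr_apply (G.comp_s (point a.1) (point b.1) h) PUnit.unit).trans a.2.1,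
      (hom_congr_apply (G.comp_t (point a.1) (point b.1) h) PUnit.unit).trans b.2.2⟩
  id_comp {x y} a := Subtype.ext (by
    obtain ⟨γ, rfl, h⟩ := a
    exact hom_congr_apply (G.one_comp (point γ)
      (Mfd.hom_ext fun _ => hom_congr_apply G.one_t (G.s γ))) PUnit.unit)
  comp_id {x y} a := Subtype.ext (by
    obtain ⟨γ, h, rfl⟩ := a
    exact hom_congr_apply (G.comp_one (point γ)
      (Mfd.hom_ext fun _ => (hom_congr_apply G.one_s (G.t γ)).symm)) PUnit.unit)
  assoc {x y z w} a b c := Subtype.ext (by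
    have h₁ : (point a.1 : pt 𝕜 ⟶ G.G₁) ≫ G.t = (point b.1 : pt 𝕜 ⟶ G.G₁) ≫ G.s :=
      Mfd.hom_ext fun _ => a.2.2.trans b.2.1.symm
    have h₂ : (point b.1 : pt 𝕜 ⟶ G.G₁) ≫ G.t = (point c.1 : pt 𝕜 ⟶ G.G₁) ≫ G.s :=
      Mfd.hom_ext fun _ => b.2.2.trans c.2.1.symm
    exact hom_congr_apply (G.assoc (point a.1) (point b.1) (point c.1) h₁ h₂
      (by rw [G.comp_t, h₂]) (by rw [G.comp_s, h₁])) PUnit.unit)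

instance : Groupoid.{u} G.Pt where
  inv {x y} a := ⟨G.inv a.1, (hom_congr_apply G.inv_s a.1).trans a.2.2,
    (hom_congr_apply G.inv_t a.1).trans a.2.1⟩
  inv_comp {x y} a := Subtype.ext (by
    obtain ⟨γ, h, rfl⟩ := a
    exact hom_congr_apply (G.inv_comp (point γ)
      (Mfd.hom_ext fun _ => hom_congr_apply G.inv_t γ)) PUnit.unit)
  comp_inv {x y} a := Subtype.ext (by
    obtain ⟨γ, rfl, h⟩ := a
    exact hom_congr_apply (G.comp_inv (point γ)
      (Mfd.hom_ext fun _ => (hom_congr_apply G.inv_s γ).symm)) PUnit.unit)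

/-- The pointwise composite is the composite in `G` of two `M`-valued points, which is a morphism by
definition. -/
theorem isSmooth_comp {M : Mfd.{u} 𝕜} {x y z : M → G.Pt} {a : ∀ m, x m ⟶ y m} {b : ∀ m, y m ⟶ z m}
    (ha : IsSmooth M G.G₁ (fun m => (a m).1)) (hb : IsSmooth M G.G₁ (fun m => (b m).1)) :
    IsSmooth M G.G₁ (fun m => (a m ≫ b m).1) := by
  let f : M ⟶ G.G₁ := ⟨_, ha⟩
  let g : M ⟶ G.G₁ := ⟨_, hb⟩
  have h : f ≫ G.t = g ≫ G.s := Mfd.hom_ext fun m => (a m).2.2.trans (b m).2.1.symm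
  refine (G.comp f g h).smooth.congr (fun m _ => ?_)
  exact (comp_apply f g h m (Mfd.hom_ext fun _ => (a m).2.2.trans (b m).2.1.symm)).symm

theorem isSmooth_inv {M : Mfd.{u} 𝕜} {x y : M → G.Pt} {a : ∀ m, x m ⟶ y m}
    (ha : IsSmooth M G.G₁ (fun m => (a m).1)) :
    IsSmooth M G.G₁ (fun m => (Groupoid.inv (a m)).1) :=
  (isSmooth_hom G.inv).comp ha

theorem eqToHom_val {x y : G.Pt} (h : x = y) : (eqToHom h).1 = G.one x := by
  subst h; rfl

theorem inv_eq_groupoid_inv {x y : G.Pt} (a : x ⟶ y) : CategoryTheory.inv a = Groupoid.inv a :=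
  (Groupoid.inv_eq_inv a).symm

theorem isSmooth_inv' {M : Mfd.{u} 𝕜} {x y : M → G.Pt} {a : ∀ m, x m ⟶ y m}
    (ha : IsSmooth M G.G₁ (fun m => (a m).1)) :
    IsSmooth M G.G₁ (fun m => (CategoryTheory.inv (a m)).1) := by
  simp only [inv_eq_groupoid_inv]
  exact isSmooth_inv ha

end GroupoidIn

open GroupoidIn

/-- Descent data on a manifold for a groupoid `G`: a set `P` over `base` with a class of plots, such
that `p` has local sections, and a functor from the equivalence relation `P ×_base P` to `G`. -/
structure DescentDatum (G : GroupoidIn.{u} 𝕜) : Type (u + 1) where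
  base : Mfd.{u} 𝕜
  P : Type u
  plot : ∀ {N : Mfd.{u} 𝕜}, (N → P) → Prop
  plot_comp : ∀ {N N' : Mfd.{u} 𝕜} (h : N' ⟶ N) {k : N → P}, plot k → plot (fun n => k (h n))
  plot_const : ∀ {N : Mfd.{u} 𝕜} (a : P), plot (fun _ : N => a)
  p : P → base
  p_smooth : ∀ {N : Mfd.{u} 𝕜} {k : N → P}, plot k → IsSmooth N base (fun n => p (k n))
  sec : ∀ m : base, ∃ (W : Mfd.{u} 𝕜) (f : W ⟶ base) (σ : W → P), IsNbhd f m ∧ plot σ ∧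
    ∀ w, p (σ w) = f w
  μ : P → G.Pt
  μ_smooth : ∀ {N : Mfd.{u} 𝕜} {k : N → P}, plot k → IsSmooth N G.G₀ (fun n => μ (k n))
  δ : ∀ a b, p a = p b → (μ a ⟶ μ b)
  δ_comp : ∀ a b c (h : p a = p b) (h' : p b = p c), δ a b h ≫ δ b c h' = δ a c (h.trans h')
  δ_smooth : ∀ {N : Mfd.{u} 𝕜} {k l : N → P} (h : ∀ n, p (k n) = p (l n)), plot k → plot l →
    IsSmooth N G.G₁ (fun n => (δ (k n) (l n) (h n)).1)

namespace DescentDatum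

variable {G : GroupoidIn.{u} 𝕜}

/-- It is idempotent and invertible. -/
theorem δ_self (x : DescentDatum G) (a : x.P) (h : x.p a = x.p a) : x.δ a a h = 𝟙 _ := by
  have := x.δ_comp a a a h h
  rwa [← cancel_epi (x.δ a a h), Category.comp_id]

theorem exists_pt (x : DescentDatum G) (m : x.base) : ∃ a : x.P, x.p a = m := by
  obtain ⟨W, f, σ, ⟨-, w, rfl⟩, -, h⟩ := x.sec m
  exact ⟨σ w, h w⟩

/-- Local sections along a smooth map. -/
theorem exists_sec (x : DescentDatum G) {N : Mfd.{u} 𝕜} {g : N → x.base}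
    (hg : IsSmooth N x.base g) (n : N) : ∃ (W : Mfd.{u} 𝕜) (k : W ⟶ N) (σ : W → x.P),
      IsNbhd k n ∧ x.plot σ ∧ ∀ w, x.p (σ w) = g (k w) := by
  obtain ⟨V, f, σ, hf, hσ, h⟩ := x.sec (g n)
  obtain ⟨W, k, l, hk, hl⟩ := exists_nbhd_lift hg n hf
  exact ⟨W, k, fun w => σ (l w), hk, x.plot_comp l hσ, fun w => (h _).trans (hl w)⟩

/-- Morphisms of descent data. -/
structure Hom (x y : DescentDatum G) : Type u where
  base : x.base ⟶ y.base
  η : ∀ a b, base (x.p a) = y.p b → (x.μ a ⟶ y.μ b)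
  left : ∀ a a' b (h : x.p a = x.p a') (h' : base (x.p a') = y.p b),
    x.δ a a' h ≫ η a' b h' = η a b (by rw [h, h'])
  right : ∀ a b b' (h : base (x.p a) = y.p b) (h' : y.p b = y.p b'),
    η a b h ≫ y.δ b b' h' = η a b' (h.trans h')
  smooth : ∀ {N : Mfd.{u} 𝕜} {k : N → x.P} {l : N → y.P} (h : ∀ n, base (x.p (k n)) = y.p (l n)),
    x.plot k → y.plot l → IsSmooth N G.G₁ (fun n => (η (k n) (l n) (h n)).1)

theorem Hom.ext' {x y : DescentDatum G} {f g : Hom x y} (h : f.base = g.base)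
    (h' : ∀ a b (e : f.base (x.p a) = y.p b), f.η a b e = g.η a b (by rw [← h, e])) : f = g := by
  obtain ⟨b, η, _, _, _⟩ := f
  obtain ⟨b', η', _, _, _⟩ := g
  obtain rfl : b = b' := h
  obtain rfl : η = η' := by
    funext a b e
    exact h' a b e
  rfl

/-- Passing from `b` to `b'` inserts `y.δ b b'` after `f` and its inverse before `g`. This is what
makes composition well defined although a point of `y.P` has to be chosen. -/
theorem comp_indep {x y z : DescentDatum G} (f : Hom x y) (g : Hom y z) (a : x.P) (b b' : y.P)
    (c : z.P) (h : f.base (x.p a) = y.p b) (h' : f.base (x.p a) = y.p b')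
    (e : g.base (y.p b) = z.p c) (e' : g.base (y.p b') = z.p c) :
    f.η a b h ≫ g.η b c e = f.η a b' h' ≫ g.η b' c e' := by
  rw [← f.right a b b' h (h.symm.trans h'), Category.assoc, g.left]

/-- The composition of morphisms of descent data. -/
noncomputable def Hom.comp {x y z : DescentDatum G} (f : Hom x y) (g : Hom y z) : Hom x z where
  base := f.base ≫ g.base
  η a c h := f.η a (y.exists_pt (f.base (x.p a))).choose (y.exists_pt _).choose_spec.symm ≫
    g.η _ c (by rw [(y.exists_pt (f.base (x.p a))).choose_spec]; exact h)
  left a a' c h h' := by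
    rw [← Category.assoc, f.left]
    refine comp_indep _ _ _ _ _ _ _ _ _ _
  right a c c' h h' := by rw [Category.assoc, g.right]
  smooth {N k l} h hk hl := by
    -- The points chosen in the definition of `η` do not vary smoothly. By independence of the
    -- choice they may be replaced near `n` by a local section that is a plot.
    refine isSmooth_of_locally (fun n => ?_)
    obtain ⟨W, q, σ, hq, hσ, hσ'⟩ := y.exists_sec
      ((isSmooth_hom f.base).comp (x.p_smooth hk)) n
    refine ⟨W, q, hq, ?_⟩
    have h₁ := f.smooth (fun w => (hσ' w).symm) (x.plot_comp q hk) hσ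
    have h₂ := g.smooth (fun w => by rw [hσ' w]; exact h (q w)) hσ (z.plot_comp q hl)
    refine (isSmooth_comp h₁ h₂).congr (fun w _ => ?_)
    exact congrArg Subtype.val (comp_indep _ _ _ _ _ _ _ _ _ _)

theorem Hom.comp_η {x y z : DescentDatum G} (f : Hom x y) (g : Hom y z) (a : x.P) (b : y.P)
    (c : z.P) (h : f.base (x.p a) = y.p b) (e : g.base (y.p b) = z.p c) :
    (f.comp g).η a c (by rw [← e, ← h]; rfl) = f.η a b h ≫ g.η b c e :=
  comp_indep _ _ _ _ _ _ _ _ _ _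

noncomputable instance : Category.{u} (DescentDatum G) where
  Hom := Hom
  id x := ⟨𝟙 _, fun a b h => x.δ a b h, fun a a' b h h' => x.δ_comp _ _ _ h h',
    fun a b b' h h' => x.δ_comp _ _ _ h h', fun h hk hl => x.δ_smooth h hk hl⟩
  comp f g := f.comp g
  id_comp {x y} f := Hom.ext' (Category.id_comp _) (fun a b e =>
    (Hom.comp_η _ f a a b rfl e).trans (f.left _ _ _ _ _))
  comp_id {x y} f := Hom.ext' (Category.comp_id _) (fun a b e =>
    (Hom.comp_η f _ a b b e rfl).trans (f.right _ _ _ _ _))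
  assoc {x y z w} f g k := Hom.ext' (Category.assoc _ _ _) (fun a d e => by
    obtain ⟨b, hb⟩ := y.exists_pt (f.base (x.p a))
    obtain ⟨c, hc⟩ := z.exists_pt (g.base (y.p b))
    have h₁ : (f.comp g).base (x.p a) = z.p c := by rw [hc, hb]; rfl
    have h₂ : k.base (z.p c) = w.p d := by rw [← e, hc, hb]; rfl
    have h₃ : (g.comp k).base (y.p b) = w.p d := by rw [← h₂, hc]; rfl
    change ((f.comp g).comp k).η a d e = (f.comp (g.comp k)).η a d _
    rw [Hom.comp_η (f.comp g) k a c d h₁ h₂, Hom.comp_η f g a b c hb.symm hc.symm,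
      Hom.comp_η f (g.comp k) a b d hb.symm h₃, Hom.comp_η g k b c d hc.symm h₂, Category.assoc])

theorem comp_η {x y z : DescentDatum G} (f : x ⟶ y) (g : y ⟶ z) (a : x.P) (b : y.P)
    (c : z.P) (h : f.base (x.p a) = y.p b) (e : g.base (y.p b) = z.p c)
    (h' : (f ≫ g : x ⟶ z).base (x.p a) = z.p c) :
    (f ≫ g : x ⟶ z).η a c h' = f.η a b h ≫ g.η b c e :=
  Hom.comp_η f g a b c h e

theorem hom_ext {x y : DescentDatum G} {f g : x ⟶ y} (h : f.base = g.base)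
    (h' : ∀ a b (e : f.base (x.p a) = y.p b), f.η a b e = g.η a b (by rw [← h, e])) : f = g :=
  Hom.ext' h h'

theorem η_congr {x y : DescentDatum G} {f g : x ⟶ y} (h : f = g) (a : x.P) (b : y.P)
    (e : f.base (x.p a) = y.p b) : f.η a b e = g.η a b (by rw [← h, e]) := by
  subst h; rfl

variable (G) in
/-- The category of descent data for `G`, over the category of manifolds. -/
noncomputable def based : BasedCategory.{u, u + 1} (Mfd.{u} 𝕜) where
  obj := DescentDatum G
  p := { obj := DescentDatum.base, map := Hom.base }

/-- Restriction of descent data along a morphism of manifolds. -/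
def pull (x : DescentDatum G) {U : Mfd.{u} 𝕜} (α : U ⟶ x.base) : DescentDatum G where
  base := U
  P := {c : U × x.P // α c.1 = x.p c.2}
  plot {N} k := IsSmooth N U (fun n => (k n).1.1) ∧ x.plot (fun n => (k n).1.2)
  plot_comp h _ hk := ⟨hk.1.comp (isSmooth_hom h), x.plot_comp h hk.2⟩
  plot_const a := ⟨isSmooth_const _, x.plot_const _⟩
  p c := c.1.1
  p_smooth hk := hk.1
  sec m := by
    obtain ⟨W, k, σ, hk, hσ, h⟩ := x.exists_sec (isSmooth_hom α) m
    exact ⟨W, k, fun w => ⟨(k w, σ w), (h w).symm⟩, hk, ⟨isSmooth_hom k, hσ⟩, fun _ => rfl⟩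
  μ c := x.μ c.1.2
  μ_smooth hk := x.μ_smooth hk.2
  δ a b h := x.δ _ _ (by rw [← a.2, ← b.2, h])
  δ_comp _ _ _ _ _ := x.δ_comp _ _ _ _ _
  δ_smooth {N k l} h hk hl := x.δ_smooth (k := fun n => (k n).1.2) (l := fun n => (l n).1.2)
    (fun n => by rw [← (k n).2, ← (l n).2, h]) hk.2 hl.2

/-- The morphism from a restriction. -/
noncomputable def pullι (x : DescentDatum G) {U : Mfd.{u} 𝕜} (α : U ⟶ x.base) : x.pull α ⟶ x :=
  show Hom (x.pull α) x from
  { base := α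
    η := fun a b h => x.δ a.1.2 b (by rw [← h, ← a.2]; rfl)
    left := fun _ _ _ _ _ => x.δ_comp _ _ _ _ _
    right := fun _ _ _ _ _ => x.δ_comp _ _ _ _ _
    smooth := fun _ hk hl => x.δ_smooth _ hk.2 hl }

/-- The factorization `c` is forced to be `a.η s w` followed by the inverse of `b.η t w`, for any
point `w` of `x` over the common image; the result does not depend on `w`. -/
theorem isGroupoidOver : IsGroupoidOver (based G) where
  lift (x : DescentDatum G) U (α : U ⟶ x.base) :=
    ⟨x.pull α, x.pullι α, IsHomLift.map (based G).p (x.pullι α)⟩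
  factor (x y z : DescentDatum G) (a : y ⟶ x) (b : z ⟶ x) (γ : y.base ⟶ z.base) (hγ) := by
    have hγ' : ∀ m, a.base m = b.base (γ m) := fun m => hom_congr_apply hγ m
    have hex : ∀ s : y.P, ∃ w : x.P, a.base (y.p s) = x.p w := fun s => by
      obtain ⟨w, hw⟩ := x.exists_pt (a.base (y.p s))
      exact ⟨w, hw.symm⟩
    choose w hw using hex
    have hb : ∀ (s : y.P) (t : z.P) (w : x.P), γ (y.p s) = z.p t → a.base (y.p s) = x.p w →
        b.base (z.p t) = x.p w := fun s t w h e => by rw [← e, hγ', h]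
    have indep : ∀ (s : y.P) (t : z.P) (w w' : x.P) (h : γ (y.p s) = z.p t)
        (e : a.base (y.p s) = x.p w) (e' : a.base (y.p s) = x.p w'),
        a.η s w e ≫ inv (b.η t w (hb s t w h e)) =
          a.η s w' e' ≫ inv (b.η t w' (hb s t w' h e')) := by
      intro s t w w' h e e'
      rw [← a.right s w w' e (e.symm.trans e'), ← b.right t w w' (hb s t w h e) (e.symm.trans e')]
      simp
    let c : Hom y z :=
      { base := γ
        η := fun s t h => a.η s (w s) (hw s) ≫ inv (b.η t (w s) (hb s t (w s) h (hw s)))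
        left := fun s s' t h h' => by
          rw [← Category.assoc, a.left]
          exact indep _ _ _ _ (by rw [h, h']) _ _
        right := fun s t t' h h' => by
          rw [Category.assoc]
          congr 1
          rw [IsIso.inv_comp_eq, IsIso.eq_comp_inv, b.left]
        smooth := by
          intro N k l h hk hl
          refine isSmooth_of_locally (fun n => ?_)
          obtain ⟨W, q, σ, hq, hσ, hσ'⟩ := x.exists_sec
            ((isSmooth_hom a.base).comp (y.p_smooth hk)) n
          refine ⟨W, q, hq, ?_⟩
          have h₁ := a.smooth (fun w => (hσ' w).symm) (y.plot_comp q hk) hσ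
          have h₂ := b.smooth (fun v => hb (k (q v)) (l (q v)) _ (h (q v)) (hσ' v).symm)
            (z.plot_comp q hl) hσ
          refine (isSmooth_comp h₁ (isSmooth_inv' h₂)).congr (fun v _ => ?_)
          exact congrArg Subtype.val (indep _ _ _ _ (h _) _ _) }
    refine ⟨c, ⟨?_, rfl⟩, ?_⟩
    · refine hom_ext (x := y) (y := x) hγ.symm (fun s r e => ?_)
      obtain ⟨t, ht⟩ := z.exists_pt (γ (y.p s))
      have e' : a.base (y.p s) = x.p r := by rw [← e, hγ']; rfl
      refine (comp_η (x := y) (y := z) c b s t r ht.symm (hb s t r ht.symm e') e).trans ?_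
      change (a.η s (w s) (hw s) ≫ _) ≫ _ = _
      rw [indep s t (w s) r ht.symm (hw s) e', Category.assoc, IsIso.inv_hom_id, Category.comp_id]
    · rintro (c' : Hom y z) ⟨h₁, h₂⟩
      refine hom_ext (x := y) (y := z) h₂ (fun s t e => ?_)
      change _ = a.η s (w s) (hw s) ≫ _
      rw [IsIso.eq_comp_inv]
      have e' : γ (y.p s) = z.p t := by rw [← e]; exact (hom_congr_apply h₂ _).symm
      refine (comp_η (x := y) (y := z) c' b s t (w s) e (hb s t (w s) e' (hw s))
        (by
          refine Eq.trans ?_ (hw s)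
          exact hom_congr_apply (congrArg Hom.base h₁) _)).symm.trans ?_
      exact η_congr (x := y) (y := x) h₁ s (w s) _

/-- The trivial descent datum on the one-point manifold. -/
def ofPoint (g : G.Pt) : DescentDatum G where
  base := pt 𝕜
  P := PUnit
  plot _ := True
  plot_comp _ _ _ := trivial
  plot_const _ := trivial
  p _ := PUnit.unit
  p_smooth _ := isSmooth_const _
  sec m := ⟨_, 𝟙 _, fun _ => PUnit.unit, isNbhd_id m, trivial, fun _ => rfl⟩
  μ _ := g
  μ_smooth _ := isSmooth_const _
  δ _ _ _ := 𝟙 g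
  δ_comp _ _ _ _ _ := Category.comp_id _
  δ_smooth _ _ _ := isSmooth_const _

/-- The morphism from the trivial descent datum at a point to a descent datum. -/
noncomputable def ofPointHom {g : G.Pt} (x : DescentDatum G) (a : x.P) (γ : g ⟶ x.μ a) :
    ofPoint g ⟶ x :=
  show Hom (ofPoint g) x from
  { base := point (x.p a)
    η := fun _ b h => γ ≫ x.δ a b h
    left := fun _ _ _ _ _ => Category.id_comp _
    right := fun _ b b' h h' => (Category.assoc γ _ _).trans
      (congrArg (γ ≫ ·) (x.δ_comp a b b' h h'))
    smooth := fun h _ hl => isSmooth_comp (isSmooth_const _) (x.δ_smooth h (x.plot_const a) hl) }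

theorem ofPointHom_comp_η {g : G.Pt} {x y : DescentDatum G} (a : x.P) (γ : g ⟶ x.μ a) (f : x ⟶ y)
    (b : y.P) (h : f.base (x.p a) = y.p b) (c : (ofPoint g).P)
    (h' : (ofPointHom x a γ ≫ f : ofPoint g ⟶ y).base ((ofPoint g).p c) = y.p b) :
    (ofPointHom x a γ ≫ f : ofPoint g ⟶ y).η c b h' = γ ≫ f.η a b h := by
  rw [comp_η (ofPointHom x a γ) f c a b rfl h]
  change (γ ≫ x.δ a a rfl) ≫ _ = _
  rw [x.δ_self, Category.comp_id]

/-- The hypotheses on gluing data quantify over test objects `z`. Taking `z` to be the datum of a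
point turns them into equations between single arrows of `G`. -/
theorem ofPointHom_comp_eq_iff {g : G.Pt} {x x' y : DescentDatum G} (a : x.P) (γ : g ⟶ x.μ a)
    (a' : x'.P) (γ' : g ⟶ x'.μ a') (f : x ⟶ y) (f' : x' ⟶ y) (b : y.P)
    (h : f.base (x.p a) = y.p b) (h' : f'.base (x'.p a') = y.p b) :
    ofPointHom x a γ ≫ f = ofPointHom x' a' γ' ≫ f' ↔ γ ≫ f.η a b h = γ' ≫ f'.η a' b h' := by
  constructor
  · intro e
    rw [← ofPointHom_comp_η a γ f b h PUnit.unit h, ← ofPointHom_comp_η a' γ' f' b h' PUnit.unit h']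
    exact η_congr e _ _ _
  · intro e
    refine hom_ext (Mfd.hom_ext fun _ => h.trans h'.symm) (fun c b' e' => ?_)
    have h₁ : f.base (x.p a) = y.p b' := e'
    have h₂ : f'.base (x'.p a') = y.p b' := h'.trans (h.symm.trans h₁)
    rw [ofPointHom_comp_η a γ f b' h₁, ofPointHom_comp_η a' γ' f' b' h₂,
      ← f.right a b b' h (h.symm.trans h₁), ← f'.right a' b b' h' (h.symm.trans h₁),
      ← Category.assoc, e, Category.assoc]

end DescentDatum

end SatakeOrbifold

/-! ### The stack associated with a groupoid -/

namespace SatakeOrbifold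

open Mfd

variable {𝕜 : Type} [RCLike 𝕜]

open GroupoidIn

theorem map_eq_comp_of_isHomLift {𝒳 : BasedCategory.{u, u + 1} (Mfd.{u} 𝕜)} {w x y : 𝒳.obj}
    {V : Mfd.{u} 𝕜} {f : V ⟶ 𝒳.p.obj x} {α : 𝒳.p.obj x ⟶ 𝒳.p.obj y} {ρ : w ⟶ x} {φ : w ⟶ y}
    (hρ : 𝒳.p.IsHomLift f ρ) (hφ : 𝒳.p.IsHomLift (f ≫ α) φ) : 𝒳.p.map φ = 𝒳.p.map ρ ≫ α := by
  obtain rfl := IsHomLift.domain_eq 𝒳.p f ρ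
  obtain rfl := IsHomLift.eq_of_isHomLift 𝒳.p f ρ
  exact (IsHomLift.eq_of_isHomLift 𝒳.p (𝒳.p.map ρ ≫ α) φ).symm

namespace DescentDatum

variable {G : GroupoidIn.{u} 𝕜}

/-- At `a` and `b` the glued arrow has to be the inverse of `ρ i` followed by `φ i`, computed at any
point of any `xs i` above `a`. -/
theorem exists_glue {x y : DescentDatum G} (α : x.base ⟶ y.base) {I : Type u}
    (xs : I → DescentDatum G) (ρ : ∀ i, xs i ⟶ x) (φ : ∀ i, xs i ⟶ y)
    (hc : ∀ m, ∃ i, IsNbhd (ρ i).base m) (hφ : ∀ i, (φ i).base = (ρ i).base ≫ α)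
    (compat : ∀ i j (z : DescentDatum G) (a : z ⟶ xs i) (b : z ⟶ xs j),
      a ≫ ρ i = b ≫ ρ j → a ≫ φ i = b ≫ φ j) :
    ∃! ψ : x ⟶ y, ψ.base = α ∧ ∀ i, ρ i ≫ ψ = φ i := by
  have hb : ∀ i (w : (xs i).P) (a : x.P) (b : y.P), (ρ i).base ((xs i).p w) = x.p a →
      α (x.p a) = y.p b → (φ i).base ((xs i).p w) = y.p b := fun i w a b h h' => by
    rw [← h', ← h, hφ]; rfl
  have indep : ∀ (i j : I) (w : (xs i).P) (w' : (xs j).P) (a : x.P) (b : y.P)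
      (h : (ρ i).base ((xs i).p w) = x.p a) (h' : (ρ j).base ((xs j).p w') = x.p a)
      (e : α (x.p a) = y.p b),
      inv ((ρ i).η w a h) ≫ (φ i).η w b (hb i w a b h e) =
        inv ((ρ j).η w' a h') ≫ (φ j).η w' b (hb j w' a b h' e) := by
    intro i j w w' a b h h' e
    -- Independence of `i` and `w` is the compatibility hypothesis, tested on the datum of the point
    -- `x.μ a`.
    rw [← ofPointHom_comp_eq_iff w _ w' _ (φ i) (φ j)]
    refine compat _ _ _ _ _ ?_
    rw [ofPointHom_comp_eq_iff w _ w' _ (ρ i) (ρ j) a h h', IsIso.inv_hom_id, IsIso.inv_hom_id]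
  have hex : ∀ a : x.P, ∃ (i : I) (w : (xs i).P), (ρ i).base ((xs i).p w) = x.p a := by
    intro a
    obtain ⟨i, -, v, hv⟩ := hc (x.p a)
    obtain ⟨w, rfl⟩ := (xs i).exists_pt v
    exact ⟨i, w, hv⟩
  choose i w hw using hex
  let ψ : Hom x y :=
    { base := α
      η := fun a b e => inv ((ρ (i a)).η (w a) a (hw a)) ≫
        (φ (i a)).η (w a) b (hb (i a) (w a) a b (hw a) e)
      left := by
        intro a a' b h e
        rw [indep (i a) (i a') (w a) (w a') a b (hw a) (by rw [h, hw]) (by rw [h, e]),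
          ← Category.assoc]
        congr 1
        rw [IsIso.comp_inv_eq, IsIso.eq_inv_comp, (ρ _).right]
      right := by
        intro a b b' e h
        rw [Category.assoc, (φ _).right]
      smooth := by
        intro N k l h hk hl
        refine isSmooth_of_locally (fun n => ?_)
        obtain ⟨j, hj⟩ := hc (x.p (k n))
        obtain ⟨W, q, r, hq, hr⟩ := exists_nbhd_lift (x.p_smooth hk) n hj
        obtain ⟨hq, n', rfl⟩ := hq
        obtain ⟨W', q', σ, hq', hσ, hσ'⟩ := (xs j).exists_sec (isSmooth_hom r) n'
        refine ⟨W', q' ≫ q, hq'.comp hq, ?_⟩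
        have e₁ : ∀ v, (ρ j).base ((xs j).p (σ v)) = x.p (k (q (q' v))) := fun v => by
          rw [hσ', hr]
        have h₁ := (ρ j).smooth e₁ hσ (x.plot_comp (q' ≫ q) hk)
        have h₂ := (φ j).smooth (fun v => hb j (σ v) (k (q (q' v))) (l (q (q' v))) (e₁ v) (h _)) hσ
          (y.plot_comp (q' ≫ q) hl)
        refine (isSmooth_comp (isSmooth_inv' h₁) h₂).congr (fun v _ => ?_)
        exact congrArg Subtype.val (indep _ j _ (σ v) (k (q (q' v))) (l (q (q' v)))
          (hw (k (q (q' v)))) (e₁ v) (h _)) }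
  refine ⟨ψ, ⟨rfl, fun j => ?_⟩, ?_⟩
  · refine hom_ext (hφ j).symm (fun v b e => ?_)
    obtain ⟨a, ha⟩ := x.exists_pt ((ρ j).base ((xs j).p v))
    have e' : α (x.p a) = y.p b := by rw [ha]; exact e
    refine (comp_η (ρ j) ψ v a b ha.symm e' e).trans ?_
    change _ ≫ inv ((ρ (i a)).η (w a) a (hw a)) ≫ _ = _
    rw [indep (i a) j (w a) v a b (hw a) ha.symm e', IsIso.hom_inv_id_assoc]
  · rintro χ ⟨h₁, h₂⟩
    refine hom_ext h₁ (fun a b e => ?_)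
    have e' : α (x.p a) = y.p b := by rw [← h₁, e]
    change _ = inv ((ρ (i a)).η (w a) a (hw a)) ≫ _
    rw [IsIso.eq_inv_comp, ← comp_η (ρ (i a)) χ (w a) a b (hw a) e
      (by rw [← e, ← hw a]; rfl)]
    exact η_congr (h₂ _) _ _ _

theorem homsGlue : HomsGlue (based G) := by
  intro x y α I V f hc xs ρ φ hρ hφ compat
  refine exists_glue (x := x) (y := y) α xs ρ φ (fun m => ?_) (fun i => ?_) compat
  · obtain ⟨i, hi⟩ := hc.exists_isNbhd m
    exact ⟨i, hi.of_isHomLift (hρ i)⟩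
  · exact map_eq_comp_of_isHomLift (hρ i) (hφ i)

/-- The glued datum is the disjoint union of the sets `(x i).P`, with the transition from `a` to `b`
computed as the inverse of `l` followed by `r` at a point above the overlap. The cocycle condition
is the composition law of the transitions. No quotient is taken, which is the advantage of descent
data over honest manifolds `P`. -/
theorem exists_glue_obj {U : Mfd.{u} 𝕜} {I : Type u} (x : I → DescentDatum G)
    (w : I → I → DescentDatum G) (l : ∀ i j, w i j ⟶ x i) (r : ∀ i j, w i j ⟶ x j)
    (f : ∀ i, (x i).base ⟶ U) (hf : ∀ m, ∃ i, IsNbhd (f i) m)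
    (hp : ∀ i j, IsPullback (l i j).base (r i j).base (f i) (f j))
    (compat : ∀ i j k (z : DescentDatum G) (a : z ⟶ w i j) (b : z ⟶ w j k) (c : z ⟶ w i k),
      a ≫ r i j = b ≫ l j k → a ≫ l i j = c ≫ l i k → c ≫ r i k = b ≫ r j k) :
    ∃ (y : DescentDatum G) (h : y.base = U) (ρ : ∀ i, x i ⟶ y),
      (∀ i, (ρ i).base = f i ≫ eqToHom h.symm) ∧ ∀ i j, l i j ≫ ρ i = r i j ≫ ρ j := by
  -- The universal property of the overlap is applied to the one-point manifold: its points are all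
  -- pairs of points with the same image in `U`, and `hmono` says that they are determined by that
  -- pair.
  have hpt : ∀ (i j : I) (a : (x i).P) (b : (x j).P), f i ((x i).p a) = f j ((x j).p b) →
      ∃ t : (w i j).P, (l i j).base ((w i j).p t) = (x i).p a ∧
        (r i j).base ((w i j).p t) = (x j).p b := by
    intro i j a b e
    have e' : (point ((x i).p a) : pt 𝕜 ⟶ _) ≫ f i = point ((x j).p b) ≫ f j :=
      Mfd.hom_ext fun _ => e
    obtain ⟨t, ht⟩ := (w i j).exists_pt ((hp i j).lift _ _ e' PUnit.unit)
    refine ⟨t, ?_, ?_⟩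
    · rw [ht]; exact hom_congr_apply ((hp i j).lift_fst _ _ e') PUnit.unit
    · rw [ht]; exact hom_congr_apply ((hp i j).lift_snd _ _ e') PUnit.unit
  have hmono : ∀ (i j : I) (m m' : (w i j).base), (l i j).base m = (l i j).base m' →
      (r i j).base m = (r i j).base m' → m = m' := by
    intro i j m m' h h'
    have e : (point m : pt 𝕜 ⟶ _) = point m' :=
      (hp i j).hom_ext (Mfd.hom_ext fun _ => h) (Mfd.hom_ext fun _ => h')
    exact hom_congr_apply e PUnit.unit
  have indep : ∀ (i j : I) (a : (x i).P) (b : (x j).P) (t t' : (w i j).P)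
      (h₁ : (l i j).base ((w i j).p t) = (x i).p a) (h₂ : (r i j).base ((w i j).p t) = (x j).p b)
      (h₃ : (l i j).base ((w i j).p t') = (x i).p a) (h₄ : (r i j).base ((w i j).p t') = (x j).p b),
      inv ((l i j).η t a h₁) ≫ (r i j).η t b h₂ = inv ((l i j).η t' a h₃) ≫ (r i j).η t' b h₄ := by
    intro i j a b t t' h₁ h₂ h₃ h₄
    have e := hmono i j _ _ (h₁.trans h₃.symm) (h₂.trans h₄.symm)
    rw [← (l i j).left t t' a e h₃, ← (r i j).left t t' b e h₄]
    simp
  choose t ht₁ ht₂ using hpt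
  have indep' : ∀ (i j : I) (a : (x i).P) (b : (x j).P) (e : f i ((x i).p a) = f j ((x j).p b))
      (t' : (w i j).P) (h₃ : (l i j).base ((w i j).p t') = (x i).p a)
      (h₄ : (r i j).base ((w i j).p t') = (x j).p b),
      inv ((l i j).η (t i j a b e) a (ht₁ i j a b e)) ≫
        (r i j).η (t i j a b e) b (ht₂ i j a b e) =
      inv ((l i j).η t' a h₃) ≫ (r i j).η t' b h₄ :=
    fun i j a b e t' h₃ h₄ => indep i j a b _ t' _ _ h₃ h₄
  have cocycle : ∀ (i j k : I) (a : (x i).P) (b : (x j).P) (c : (x k).P)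
      (e : f i ((x i).p a) = f j ((x j).p b)) (e' : f j ((x j).p b) = f k ((x k).p c)),
      (inv ((l i j).η (t i j a b e) a (ht₁ i j a b e)) ≫
        (r i j).η (t i j a b e) b (ht₂ i j a b e)) ≫
      (inv ((l j k).η (t j k b c e') b (ht₁ j k b c e')) ≫
        (r j k).η (t j k b c e') c (ht₂ j k b c e')) =
      inv ((l i k).η (t i k a c (e.trans e')) a (ht₁ i k a c (e.trans e'))) ≫
        (r i k).η (t i k a c (e.trans e')) c (ht₂ i k a c (e.trans e')) := by
    intro i j k a b c e e'
    -- The cocycle condition on the datum of the point `(x i).μ a`. The arrow from that point to the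
    -- overlap of `i` and `j` undoes `l i j`, and those to the other two overlaps are then forced by
    -- the hypotheses of `compat`.
    have key := compat i j k (ofPoint ((x i).μ a))
      (ofPointHom _ (t i j a b e) (inv ((l i j).η (t i j a b e) a (ht₁ i j a b e))))
      (ofPointHom _ (t j k b c e') (inv ((l i j).η (t i j a b e) a (ht₁ i j a b e)) ≫
        (r i j).η (t i j a b e) b (ht₂ i j a b e) ≫
        inv ((l j k).η (t j k b c e') b (ht₁ j k b c e'))))
      (ofPointHom _ (t i k a c (e.trans e'))
        (inv ((l i k).η (t i k a c (e.trans e')) a (ht₁ i k a c (e.trans e')))))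
      (by
        rw [ofPointHom_comp_eq_iff _ _ _ _ _ _ b (ht₂ i j a b e) (ht₁ j k b c e')]
        simp)
      (by
        rw [ofPointHom_comp_eq_iff _ _ _ _ _ _ a (ht₁ i j a b e) (ht₁ i k a c (e.trans e'))]
        simp)
    rw [ofPointHom_comp_eq_iff _ _ _ _ _ _ c (ht₂ i k a c (e.trans e')) (ht₂ j k b c e')] at key
    rw [key]
    simp only [Category.assoc]
  let y : DescentDatum G :=
    { base := U
      P := Σ i, (x i).P
      -- A plot stays in a single member. This loses nothing, since plots are only needed as local
      -- sections.
      plot := fun {N} k => ∃ (i : I) (k' : N → (x i).P), (x i).plot k' ∧ k = fun n => ⟨i, k' n⟩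
      plot_comp := by
        rintro N N' h _ ⟨i, k, hk, rfl⟩
        exact ⟨i, fun n => k (h n), (x i).plot_comp h hk, rfl⟩
      plot_const := fun a => ⟨a.1, fun _ => a.2, (x a.1).plot_const a.2, rfl⟩
      p := fun a => f a.1 ((x a.1).p a.2)
      p_smooth := by
        rintro N _ ⟨i, k, hk, rfl⟩
        exact (isSmooth_hom (f i)).comp ((x i).p_smooth hk)
      sec := by
        intro m
        obtain ⟨i, hi, v, rfl⟩ := hf m
        obtain ⟨W, g, σ, hg, hσ, hσ'⟩ := (x i).sec v
        exact ⟨W, g ≫ f i, fun n => ⟨i, σ n⟩, hg.comp hi, ⟨i, σ, hσ, rfl⟩,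
          fun n => congrArg (f i) (hσ' n)⟩
      μ := fun a => (x a.1).μ a.2
      μ_smooth := by
        rintro N _ ⟨i, k, hk, rfl⟩
        exact (x i).μ_smooth hk
      δ := fun a b e => inv ((l a.1 b.1).η (t _ _ a.2 b.2 e) a.2 (ht₁ _ _ a.2 b.2 e)) ≫
        (r a.1 b.1).η (t _ _ a.2 b.2 e) b.2 (ht₂ _ _ a.2 b.2 e)
      δ_comp := fun a b c e e' => cocycle _ _ _ _ _ _ e e'
      δ_smooth := by
        rintro N _ _ h ⟨i, k, hk, rfl⟩ ⟨j, k', hk', rfl⟩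
        refine isSmooth_of_locally (fun n => ?_)
        let K : N ⟶ (x i).base := ⟨_, (x i).p_smooth hk⟩
        let K' : N ⟶ (x j).base := ⟨_, (x j).p_smooth hk'⟩
        have hK : K ≫ f i = K' ≫ f j := Mfd.hom_ext h
        obtain ⟨W, q, σ, hq, hσ, hσ'⟩ := (w i j).exists_sec
          (isSmooth_hom ((hp i j).lift K K' hK)) n
        refine ⟨W, q, hq, ?_⟩
        have e₁ : ∀ v, (l i j).base ((w i j).p (σ v)) = (x i).p (k (q v)) := fun v => by
          rw [hσ']; exact hom_congr_apply ((hp i j).lift_fst K K' hK) (q v)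
        have e₂ : ∀ v, (r i j).base ((w i j).p (σ v)) = (x j).p (k' (q v)) := fun v => by
          rw [hσ']; exact hom_congr_apply ((hp i j).lift_snd K K' hK) (q v)
        have h₁ := (l i j).smooth e₁ hσ ((x i).plot_comp q hk)
        have h₂ := (r i j).smooth e₂ hσ ((x j).plot_comp q hk')
        refine (isSmooth_comp (isSmooth_inv' h₁) h₂).congr (fun v _ => ?_)
        exact congrArg Subtype.val (indep' _ _ _ _ _ _ _ _) }
  -- Inside one member the new transitions are the old ones: the arrow from `a` to itself given by
  -- the overlap of `i` with itself is an identity by `δ_self`, which makes `l i i` and `r i i`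
  -- agree there.
  have hδ : ∀ (i : I) (a b : (x i).P) (e : (x i).p a = (x i).p b),
      y.δ ⟨i, a⟩ ⟨i, b⟩ (congrArg (f i) e) = (x i).δ a b e := by
    intro i a b e
    obtain ⟨s, hs⟩ : ∃ s, s = t i i a b (congrArg (f i) e) := ⟨_, rfl⟩
    have h₁ : (l i i).base ((w i i).p s) = (x i).p a := by rw [hs]; exact ht₁ _ _ _ _ _
    have h₂ : (r i i).base ((w i i).p s) = (x i).p b := by rw [hs]; exact ht₂ _ _ _ _ _
    have h₃ : (r i i).base ((w i i).p s) = (x i).p a := by rw [h₂, e]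
    have key : y.δ ⟨i, a⟩ ⟨i, a⟩ rfl = inv ((l i i).η s a h₁) ≫ (r i i).η s a h₃ :=
      indep' i i a a rfl s h₁ h₃
    have key' : y.δ ⟨i, a⟩ ⟨i, b⟩ (congrArg (f i) e) =
      inv ((l i i).η s a h₁) ≫ (r i i).η s b h₂ := indep' i i a b _ s h₁ h₂
    rw [δ_self] at key
    rw [key', ← (r i i).right s a b h₃ e, ← Category.assoc, ← key]
    exact Category.id_comp _
  let ρ : ∀ i, x i ⟶ y := fun i => show Hom (x i) y from
    { base := f i
      η := fun a b e => y.δ ⟨i, a⟩ b e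
      left := fun a a' b h e => by
        rw [← hδ]; exact y.δ_comp _ _ _ _ _
      right := fun a b b' e h => y.δ_comp _ _ _ _ _
      smooth := fun {N k k'} h hk hk' => y.δ_smooth (k := fun n => ⟨i, k n⟩) h ⟨i, k, hk, rfl⟩ hk' }
  refine ⟨y, rfl, ρ, fun i => (Category.comp_id _).symm, fun i j => ?_⟩
  refine hom_ext (hp i j).w (fun s c e => ?_)
  obtain ⟨a, ha⟩ := (x i).exists_pt ((l i j).base ((w i j).p s))
  obtain ⟨b, hb⟩ := (x j).exists_pt ((r i j).base ((w i j).p s))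
  have hw : f i ((l i j).base ((w i j).p s)) = f j ((r i j).base ((w i j).p s)) :=
    hom_congr_apply (hp i j).w _
  have e₁ : f i ((x i).p a) = y.p c := by rw [ha]; exact e
  have e₂ : f j ((x j).p b) = y.p c := by rw [hb, ← hw]; exact e
  refine (comp_η (l i j) (ρ i) s a c ha.symm e₁ e).trans ?_
  refine Eq.trans ?_ (comp_η (r i j) (ρ j) s b c hb.symm e₂ (by rw [← e₂, hb]; rfl)).symm
  change (l i j).η s a _ ≫ y.δ ⟨i, a⟩ c e₁ = (r i j).η s b _ ≫ y.δ ⟨j, b⟩ c e₂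
  have key : y.δ ⟨i, a⟩ ⟨j, b⟩ (e₁.trans e₂.symm) =
      inv ((l i j).η s a ha.symm) ≫ (r i j).η s b hb.symm :=
    indep' i j a b _ s ha.symm hb.symm
  rw [← y.δ_comp ⟨i, a⟩ ⟨j, b⟩ c (e₁.trans e₂.symm) e₂, key]
  simp

theorem objectsGlue : ObjectsGlue (based G) := by
  intro U I V f hc W p₁ p₂ hp x w l r hx hl hr compat
  -- The base objects and projections are replaced by those of the data, so that all lifting
  -- conditions become equalities of maps.
  obtain rfl : V = fun i => (based G).p.obj (x i) := funext fun i => (hx i).symm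
  obtain rfl : W = fun i j => (based G).p.obj (w i j) :=
    funext fun i => funext fun j => (IsHomLift.domain_eq (based G).p (p₁ i j) (l i j)).symm
  obtain rfl : p₁ = fun i j => (based G).p.map (l i j) := funext fun i => funext fun j =>
    have := hl i j
    IsHomLift.eq_of_isHomLift (based G).p (p₁ i j) (l i j)
  obtain rfl : p₂ = fun i j => (based G).p.map (r i j) := funext fun i => funext fun j =>
    have := hr i j
    IsHomLift.eq_of_isHomLift (based G).p (p₂ i j) (r i j)
  obtain ⟨y, rfl, ρ, hρ, e⟩ := exists_glue_obj x w l r f hc.exists_isNbhd hp compat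
  refine ⟨y, ρ, fun i => ?_, e⟩
  have h : Hom.base (ρ i) = f i := (hρ i).trans (Category.comp_id (f i))
  rw [← h]
  exact IsHomLift.map (based G).p (ρ i)

theorem isStack_based : IsStack (based G) := ⟨isGroupoidOver, homsGlue, objectsGlue⟩

/-! ### The comparison of a groupoid with its descent data. -/

/-- The descent datum on `M` that is given by an `M`-valued point of `G₀`. -/
def ofPts (x : G.Pts) : DescentDatum G where
  base := x.base
  P := x.base
  plot {N} k := IsSmooth N x.base k
  plot_comp h _ hk := hk.comp (isSmooth_hom h)
  plot_const a := isSmooth_const a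
  p a := a
  p_smooth hk := hk
  sec m := ⟨_, 𝟙 _, fun a => a, isNbhd_id m, isSmooth_hom (𝟙 _), fun _ => rfl⟩
  μ a := x.map a
  μ_smooth hk := (isSmooth_hom x.map).comp hk
  δ a b h := eqToHom (congrArg x.map.toFun h)
  δ_comp a b c h h' := eqToHom_trans _ _
  δ_smooth {N k l} h hk hl := by
    refine ((isSmooth_hom (x.map ≫ G.one)).comp hk).congr (fun n _ => ?_)
    exact eqToHom_val _

/-- The arrow of `G` at a point. -/
def arrAt {x y : G.Pts} (f : x ⟶ y) (m : x.base) (n : y.base) (h : f.base m = n) :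
    (show G.Pt from x.map m) ⟶ (show G.Pt from y.map n) :=
  ⟨f.arr m, hom_congr_apply f.src m, (hom_congr_apply f.tgt m).trans (congrArg y.map.toFun h)⟩

theorem arrAt_id (x : G.Pts) (m n : x.base) (h : m = n) :
    arrAt (𝟙 x) m n h = eqToHom (C := G.Pt) (congrArg x.map.toFun h) := by
  subst h; rfl

theorem arrAt_comp {x y z : G.Pts} (f : x ⟶ y) (g : y ⟶ z) (m : x.base) (n : y.base) (k : z.base)
    (h : f.base m = n) (h' : g.base n = k) (h'' : (f ≫ g).base m = k) :
    arrAt (f ≫ g) m k h'' = arrAt f m n h ≫ arrAt g n k h' := by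
  subst h h'
  exact Subtype.ext (comp_apply _ _ _ m _)

/-- The morphism of descent data given by a morphism between points of `G`. -/
def ofPtsMap {x y : G.Pts} (f : x ⟶ y) : ofPts x ⟶ ofPts y :=
  show Hom (ofPts x) (ofPts y) from
  { base := f.base
    η := fun a b h => arrAt f a b h
    left := fun a a' b h h' => by
      obtain rfl : a = a' := h
      exact Category.id_comp _
    right := fun a b b' h h' => by
      obtain rfl : b = b' := h'
      exact Category.comp_id _
    smooth := fun h hk hl => (isSmooth_hom f.arr).comp hk }

variable (G) in
/-- The functor from a groupoid to its category of descent data. -/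
noncomputable def ofPtsFunctor : G.toBased ⥤ᵇ based G where
  obj := ofPts
  map := ofPtsMap
  map_id x := hom_ext rfl (fun a b h => arrAt_id x a b h)
  map_comp {x y z} f g := hom_ext rfl (fun a c h => by
    refine Eq.trans ?_ (comp_η (ofPtsMap f) (ofPtsMap g) a (PtsHom.base f a) c rfl h h).symm
    exact arrAt_comp f g a (PtsHom.base f a) c rfl h h)
  w := rfl

/-- A local section `σ` of `P` trivializes a descent datum: it becomes the one given by the point `μ
∘ σ` of `G₀`. Between such data a morphism is the same as an arrow of `G`, so the functor is even
globally full and faithful. -/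
theorem isLocalEquiv_ofPtsFunctor : IsLocalEquiv (ofPtsFunctor G) where
  surj (x : DescentDatum G) m := by
    obtain ⟨W, f, σ, hf, hσ, h⟩ := x.sec m
    let q : G.Pts := ⟨W, ⟨_, x.μ_smooth hσ⟩⟩
    let φ : Hom (ofPts q) x :=
      { base := f
        η := fun a b e => x.δ (σ a) b ((h a).trans e)
        left := fun a a' b e e' => by
          obtain rfl : a = a' := e
          exact Category.id_comp _
        right := fun a b b' e e' => x.δ_comp _ _ _ _ _
        smooth := fun {N k l} e hk hl => x.δ_smooth _ (x.plot_comp ⟨k, hk⟩ hσ) hl }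
    exact ⟨q, φ, f, hf, IsHomLift.map (based G).p (a := ofPts q) (b := x) φ⟩
  full (p q : G.Pts) (χ : Hom (ofPts p) (ofPts q)) m := by
    refine ⟨p, 𝟙 p, ⟨χ.base, ⟨fun m => (χ.η m (χ.base m) rfl).1,
      χ.smooth (k := fun n => n) (l := fun n => χ.base n) (fun _ => rfl) (isSmooth_hom (𝟙 p.base))
        (isSmooth_hom χ.base)⟩, ?_, ?_⟩, ?_, ?_⟩
    · exact Mfd.hom_ext fun m => (χ.η m (χ.base m) rfl).2.1
    · exact Mfd.hom_ext fun m => (χ.η m (χ.base m) rfl).2.2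
    · exact isNbhd_id m
    · refine Eq.trans ?_ (congrArg (· ≫ χ) ((ofPtsFunctor G).map_id p)).symm
      refine Eq.trans ?_ (Category.id_comp (X := ofPts p) (Y := ofPts q) χ).symm
      refine hom_ext (x := ofPts p) (y := ofPts q) rfl (fun a b h => ?_)
      obtain rfl : χ.base a = b := h
      rfl
  faithful (p q : G.Pts) φ ψ e m := by
    refine ⟨p, 𝟙 p, isNbhd_id m, ?_⟩
    congr 1
    have hb : φ.base = ψ.base := congrArg Hom.base e
    refine PtsHom.ext hb (Mfd.hom_ext fun a => ?_)
    exact congrArg Subtype.val (η_congr (x := ofPts p) (y := ofPts q) (f := ofPtsMap φ)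
      (g := ofPtsMap ψ) e a (φ.base a) rfl)

end DescentDatum

/-- Every groupoid in the category of manifolds has an associated stack. -/
theorem GroupoidIn.exists_isAssociatedStack (G : GroupoidIn.{u} 𝕜) :
    ∃ (𝒳 : BasedCategory.{u, u + 1} (Mfd.{u} 𝕜)) (α : G.toBased ⥤ᵇ 𝒳), IsAssociatedStack α :=
  ⟨_, DescentDatum.ofPtsFunctor G, isAssociatedStack_iff.2
    ⟨DescentDatum.isStack_based, DescentDatum.isLocalEquiv_ofPtsFunctor⟩⟩

theorem hasLifts_total {A : Type u} [SmallCategory A] (V : A ⥤ Mfd.{u} 𝕜) : HasLifts (total V) := by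
  intro (x : TotalObj V) U (α : U ⟶ x.base)
  let y : TotalObj V := ⟨x.idx, U, α ≫ x.map⟩
  let a : y ⟶ x := ⟨𝟙 _, α, by simp [y]⟩
  exact ⟨y, a, IsHomLift.map (total V).p a⟩

end SatakeOrbifold

/-! ### The groupoid of points of an atlas -/

namespace SatakeOrbifold

open Mfd

variable {𝕜 : Type} [RCLike 𝕜]

namespace OrbifoldAtlas

variable {X : Type u} [TopologicalSpace X] {A : Type u} [SmallCategory A]
  (c : OrbifoldAtlas.{u} 𝕜 X A)

theorem map_id_apply (a : A) (x : c.diagram.obj a) : c.diagram.map (𝟙 a) x = x :=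
  hom_congr_apply (c.diagram.map_id a) x

theorem map_comp_apply {a b d : A} (f : a ⟶ b) (g : b ⟶ d) (x : c.diagram.obj a) :
    c.diagram.map (f ≫ g) x = c.diagram.map g (c.diagram.map f x) :=
  hom_congr_apply (c.diagram.map_comp f g) x

/-- The projection of a chart to `X`. -/
def proj (a : A) (x : c.diagram.obj a) : X := (c.c.obj a).π x

theorem proj_map {a b : A} (f : a ⟶ b) (x : c.diagram.obj a) :
    c.proj b (c.diagram.map f x) = c.proj a x :=
  (c.c.map f).π_comp x

theorem etale_map {a b : A} (f : a ⟶ b) : Etale (c.diagram.map f) := (c.c.map f).etale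

theorem map_aut {a : A} (φ : Aut a) (x : c.diagram.obj a) :
    c.diagram.map φ.hom x = (c.c.obj a).toAbstractChart.act (c.ι a φ) x :=
  hom_congr_apply (c.ι_V a φ) x

include c in
-- Arrows of a chart category are epimorphisms: `g` is `f` followed by an automorphism of `d`, which
-- has to be trivial because `Aut d` acts freely on `Hom(a, d)`.
theorem arrow_cancel {a b d : A} (h : a ⟶ b) {f g : b ⟶ d} (e : h ≫ f = h ≫ g) : f = g := by
  obtain ⟨ψ, rfl, -⟩ := c.isChartCategory.torsor b d f g
  have := (c.isChartCategory.torsor a d (h ≫ f) (h ≫ f)).unique (y₁ := ψ) (y₂ := 1)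
    ((Category.assoc _ _ _).trans e.symm) (Category.comp_id _)
  rw [this]
  exact (Category.comp_id _).symm

/-- Arrows between the same charts that agree at some points differ by an automorphism of the
source. -/
theorem exists_aut_comp {a b : A} (f g : a ⟶ b) {x x' : c.diagram.obj a}
    (h : c.diagram.map g x' = c.diagram.map f x) :
    ∃ α : Aut a, α.hom ≫ f = g ∧ c.diagram.map α.hom x' = x := by
  -- Write `g` as `f ≫ φ`. Injectivity of the map of quotients provides `k` in `H(a)` that lies over
  -- `ι φ` and moves `x'` to `x`. By naturality of `ι`, the automorphism `α` of `a` with `ι α = k`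
  -- satisfies `α ≫ f = f ≫ φ`.
  obtain ⟨φ, rfl, -⟩ := c.isChartCategory.torsor a b f g
  rw [map_comp_apply, map_aut] at h
  obtain ⟨k, h₁, h₂⟩ := (c.c.map f).inj x' x (c.ι b φ) h
  obtain ⟨α, rfl⟩ := (c.ι a).surjective k
  obtain ⟨ψ, hψ, -⟩ := c.isChartCategory.torsor a b f (α.hom ≫ f)
  rw [c.ι_nat a b f α ψ hψ.symm] at h₁
  obtain rfl := (c.ι b).injective h₁
  exact ⟨α, hψ.symm, (c.map_aut α x').trans h₂⟩

/-- Arrows that agree at a point and become equal after composition with an arrow are equal. -/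
theorem eq_of_comp_eq {d a b : A} {h k : d ⟶ a} (f : a ⟶ b) {z : c.diagram.obj d}
    (hz : c.diagram.map h z = c.diagram.map k z) (e : h ≫ f = k ≫ f) : h = k := by
  -- The automorphism `φ` by which `h` and `k` differ is in the kernel of `H(a) → H(b)` and fixes a
  -- point, so it is trivial by freeness.
  obtain ⟨φ, rfl, -⟩ := c.isChartCategory.torsor d a h k
  rw [map_comp_apply, map_aut] at hz
  rw [Category.assoc] at e
  have h₁ := c.ι_nat a b f φ 1 ((c.arrow_cancel h e).symm.trans (Category.comp_id f).symm)
  rw [map_one] at h₁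
  have h₂ := (c.c.map f).free (c.ι a φ) (c.diagram.map h z) h₁ hz.symm
  rw [(c.ι a).map_eq_one_iff.1 h₂]
  exact (Category.comp_id h).symm

/-- Points of charts with the same image in `X` come from a point of a common chart. -/
theorem exists_span_of_proj_eq {a b : A} {x : c.diagram.obj a} {y : c.diagram.obj b}
    (h : c.proj a x = c.proj b y) : ∃ (d : A) (z : c.diagram.obj d) (f : d ⟶ a) (g : d ⟶ b),
      c.diagram.map f z = x ∧ c.diagram.map g z = y := by
  obtain ⟨d, ⟨f⟩, ⟨g⟩, z, hz⟩ := c.refines a b _ ⟨x, rfl⟩ ⟨y, h.symm⟩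
  -- The refinement meets the given points only after projection to `X`. An arrow to `b` is
  -- corrected by the automorphism of `b` that moves its value at `z` to the given point.
  have key : ∀ {b : A} (f : d ⟶ b) (w : c.diagram.obj b), c.proj b w = c.proj a x →
      ∃ f' : d ⟶ b, c.diagram.map f' z = w := by
    intro b f w hw
    have : (c.c.obj b).π (c.diagram.map f z) = (c.c.obj b).π w :=
      (c.proj_map f z).trans (hz.trans hw.symm)
    obtain ⟨k, hk⟩ := ((c.c.obj b).π_eq_iff _ _).1 this
    obtain ⟨φ, rfl⟩ := (c.ι b).surjective k
    exact ⟨f ≫ φ.hom, (c.map_comp_apply f φ.hom z).trans ((c.map_aut φ _).trans hk)⟩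
  obtain ⟨f', hf⟩ := key f x rfl
  obtain ⟨g', hg⟩ := key g y h.symm
  exact ⟨d, z, f', g', hf, hg⟩

/-! ### The category of elements and its calculus of fractions. -/

/-- The points of the charts, as objects of the category of elements. -/
def Elt : Type u := Σ a : A, c.diagram.obj a

instance : SmallCategory c.Elt where
  Hom p q := {f : p.1 ⟶ q.1 // c.diagram.map f p.2 = q.2}
  id p := ⟨𝟙 _, c.map_id_apply _ _⟩
  comp f g := ⟨f.1 ≫ g.1, by rw [map_comp_apply, f.2, g.2]⟩
  id_comp _ := Subtype.ext (Category.id_comp _)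
  comp_id _ := Subtype.ext (Category.comp_id _)
  assoc _ _ _ := Subtype.ext (Category.assoc _ _ _)

/-- Both sources have the same image in `X`, so a span joins them. Its two composites to `r` agree
at the point `z`, hence differ by an automorphism of the apex that fixes `z`, and this automorphism
is absorbed into one leg. -/
theorem elt_ore {p q r : c.Elt} (f : p ⟶ r) (g : q ⟶ r) :
    ∃ (e : c.Elt) (h : e ⟶ p) (k : e ⟶ q), h ≫ f = k ≫ g := by
  have hpq : c.proj p.1 p.2 = c.proj q.1 q.2 := by
    rw [← c.proj_map f.1, ← c.proj_map g.1, f.2, g.2]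
  obtain ⟨d, z, h, k, hz, kz⟩ := c.exists_span_of_proj_eq hpq
  obtain ⟨α, hα, hα'⟩ := c.exists_aut_comp (h ≫ f.1) (k ≫ g.1) (x := z) (x' := z) (by
    rw [map_comp_apply, map_comp_apply, hz, kz, f.2, g.2])
  refine ⟨⟨d, z⟩, ⟨α.hom ≫ h, ?_⟩, ⟨k, kz⟩, Subtype.ext ((Category.assoc _ _ _).trans hα)⟩
  rw [map_comp_apply, hα', hz]

/-- In the cancellation axiom no equalizing arrow is needed: parallel arrows of elements agree at a
point, so they are already equal by `eq_of_comp_eq`. -/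
instance : (⊤ : MorphismProperty c.Elt).HasRightCalculusOfFractions where
  exists_rightFraction X Y φ := by
    obtain ⟨e, h, k, w⟩ := c.elt_ore φ.f φ.s
    exact ⟨⟨h, trivial, k⟩, w⟩
  ext X Y Y' f₁ f₂ s _ h := ⟨X, 𝟙 X, trivial, by
    congr 1
    refine Subtype.ext (c.eq_of_comp_eq s.1 (f₁.2.trans f₂.2.symm) (congrArg Subtype.val h))⟩

/-- The category of elements with all arrows inverted. -/
abbrev Loc : Type u := (⊤ : MorphismProperty c.Elt).Localization

/-- The localization functor. -/
abbrev Q : c.Elt ⥤ c.Loc := (⊤ : MorphismProperty c.Elt).Q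

instance {p q : c.Elt} (f : p ⟶ q) : IsIso (c.Q.map f) :=
  Localization.inverts c.Q ⊤ f trivial

theorem exists_fraction {p q : c.Elt} (γ : c.Q.obj p ⟶ c.Q.obj q) :
    ∃ (e : c.Elt) (f : e ⟶ p) (g : e ⟶ q), γ = inv (c.Q.map f) ≫ c.Q.map g := by
  obtain ⟨φ, rfl⟩ := Localization.exists_rightFraction c.Q ⊤ γ
  exact ⟨_, φ.s, φ.f, rfl⟩

/-- Arrows identified by the localization agree after precomposition with some arrow, which can be
cancelled. -/
theorem Q_map_injective {p q : c.Elt} {f g : p ⟶ q} (h : c.Q.map f = c.Q.map g) : f = g := by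
  obtain ⟨e, s, -, hs⟩ := (MorphismProperty.map_eq_iff_precomp c.Q ⊤ f g).1 h
  exact Subtype.ext (c.arrow_cancel s.1 (congrArg Subtype.val hs))

instance {p q : c.Elt} (γ : c.Q.obj p ⟶ c.Q.obj q) : IsIso γ := by
  obtain ⟨e, f, g, rfl⟩ := c.exists_fraction γ
  infer_instance

/-- A point of a chart, as an object of the category of elements. -/
def elt (a : A) (x : c.diagram.obj a) : c.Elt := ⟨a, x⟩

theorem elt_inj {a : A} {x y : c.diagram.obj a} : c.elt a x = c.elt a y ↔ x = y :=
  ⟨fun h => eq_of_heq (Sigma.mk.inj h).2, fun h => h ▸ rfl⟩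

/-- The arrow of elements over an arrow of `A`. -/
def eltHom {a b : A} (f : a ⟶ b) (x : c.diagram.obj a) (y : c.diagram.obj b)
    (h : c.diagram.map f x = y) : c.elt a x ⟶ c.elt b y := ⟨f, h⟩

/-- The arrows of the groupoid of points of the orbifold. -/
structure Arrow : Type u where
  /-- the source of an arrow -/
  src : c.Elt
  /-- the target of an arrow -/
  tgt : c.Elt
  /-- the underlying arrow of the localization -/
  hom : c.Q.obj src ⟶ c.Q.obj tgt

/-- The arrow given by a span of arrows of `A` and a point of its source. -/
noncomputable def ofSpan {d a b : A} (f : d ⟶ a) (g : d ⟶ b) (z : c.diagram.obj d) : c.Arrow :=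
  ⟨c.elt a (c.diagram.map f z), c.elt b (c.diagram.map g z),
    inv (c.Q.map (c.eltHom f z _ rfl)) ≫ c.Q.map (c.eltHom g z _ rfl)⟩

theorem ofSpan_eq {d a b : A} (f : d ⟶ a) (g : d ⟶ b) (z : c.diagram.obj d)
    {x : c.diagram.obj a} {y : c.diagram.obj b} (hx : c.diagram.map f z = x)
    (hy : c.diagram.map g z = y) : c.ofSpan f g z = ⟨c.elt a x, c.elt b y,
      inv (c.Q.map (c.eltHom f z x hx)) ≫ c.Q.map (c.eltHom g z y hy)⟩ := by
  subst hx hy; rfl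

theorem ofSpan_elt {e p q : c.Elt} (f : e ⟶ p) (g : e ⟶ q) :
    c.ofSpan f.1 g.1 e.2 = ⟨p, q, inv (c.Q.map f) ≫ c.Q.map g⟩ := c.ofSpan_eq _ _ _ f.2 g.2

theorem exists_eq_ofSpan (γ : c.Arrow) : ∃ (d a b : A) (f : d ⟶ a) (g : d ⟶ b)
    (z : c.diagram.obj d), γ = c.ofSpan f g z := by
  obtain ⟨p, q, γ⟩ := γ
  obtain ⟨e, f, g, rfl⟩ := c.exists_fraction γ
  exact ⟨_, _, _, _, _, _, (c.ofSpan_elt f g).symm⟩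

theorem ofSpan_comp {e d a b : A} (h : e ⟶ d) (f : d ⟶ a) (g : d ⟶ b) (u : c.diagram.obj e) :
    c.ofSpan (h ≫ f) (h ≫ g) u = c.ofSpan f g (c.diagram.map h u) := by
  rw [c.ofSpan_eq (h ≫ f) (h ≫ g) u (c.map_comp_apply h f u) (c.map_comp_apply h g u)]
  have h₁ : ∀ {a : A} (f : d ⟶ a), c.eltHom (h ≫ f) u _ (c.map_comp_apply h f u) =
    c.eltHom h u _ rfl ≫ c.eltHom f _ _ rfl := fun f => rfl
  rw [h₁, h₁]
  simp [ofSpan]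

/-- Arrows with the same source are given by spans with a common left leg. -/
theorem exists_common_span {p q q' : c.Elt} (γ : c.Q.obj p ⟶ c.Q.obj q)
    (γ' : c.Q.obj p ⟶ c.Q.obj q') : ∃ (e : c.Elt) (f : e ⟶ p) (g : e ⟶ q) (g' : e ⟶ q'),
      γ = inv (c.Q.map f) ≫ c.Q.map g ∧ γ' = inv (c.Q.map f) ≫ c.Q.map g' := by
  obtain ⟨d, f, g, rfl⟩ := c.exists_fraction γ
  obtain ⟨d', f', g', rfl⟩ := c.exists_fraction γ'
  obtain ⟨e, h, k, w⟩ := c.elt_ore f f'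
  refine ⟨e, h ≫ f, h ≫ g, k ≫ g', by simp, ?_⟩
  rw [w]; simp

theorem inv_comp_eq_iff {e e' p q : c.Elt} {f : e ⟶ p} {g : e ⟶ q} {f' : e' ⟶ p} {g' : e' ⟶ q} :
    inv (c.Q.map f) ≫ c.Q.map g = inv (c.Q.map f') ≫ c.Q.map g' ↔
      ∃ (d : c.Elt) (k : d ⟶ e) (l : d ⟶ e'), k ≫ f = l ≫ f' ∧ k ≫ g = l ≫ g' := by
  constructor
  · intro h
    obtain ⟨d, k, l, w⟩ := c.elt_ore f f'
    refine ⟨d, k, l, w, c.Q_map_injective ?_⟩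
    rw [IsIso.inv_comp_eq] at h
    rw [Functor.map_comp, h, ← Category.assoc, ← Category.assoc, ← Functor.map_comp, w]
    simp
  · rintro ⟨d, k, l, w, w'⟩
    have : inv (c.Q.map f) ≫ c.Q.map g = inv (c.Q.map (k ≫ f)) ≫ c.Q.map (k ≫ g) := by simp
    rw [this, w, w']; simp

/-- Spans that define the same arrow at one point agree as arrows of `A` on a refinement, hence they
agree along a whole neighbourhood. The topology of the set of arrows rests on this. -/
theorem exists_refinement {d d' a b : A} {f : d ⟶ a} {g : d ⟶ b} {f' : d' ⟶ a} {g' : d' ⟶ b}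
    {z : c.diagram.obj d} {z' : c.diagram.obj d'} (h : c.ofSpan f g z = c.ofSpan f' g' z') :
    ∃ (e : A) (u : c.diagram.obj e) (k : e ⟶ d) (l : e ⟶ d'), c.diagram.map k u = z ∧
      c.diagram.map l u = z' ∧ k ≫ f = l ≫ f' ∧ k ≫ g = l ≫ g' := by
  have hx : c.diagram.map f' z' = c.diagram.map f z := c.elt_inj.1 (congrArg Arrow.src h.symm)
  have hy : c.diagram.map g' z' = c.diagram.map g z := c.elt_inj.1 (congrArg Arrow.tgt h.symm)
  rw [c.ofSpan_eq f' g' z' hx hy] at h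
  have h' := eq_of_heq (Arrow.mk.inj h).2.2
  obtain ⟨e, k, l, w, w'⟩ := c.inv_comp_eq_iff.1 h'
  exact ⟨e.1, e.2, k.1, l.1, k.2, l.2, congrArg Subtype.val w, congrArg Subtype.val w'⟩

/-- A single value determines the right leg. This gives both the separation of arrows and the
faithfulness of the functor to the groupoid. -/
theorem ofSpan_left_injective {d a b : A} {f : d ⟶ a} {g g' : d ⟶ b} {z : c.diagram.obj d}
    (h : c.ofSpan f g z = c.ofSpan f g' z) : g = g' := by
  obtain ⟨e, u, k, l, hk, hl, w, w'⟩ := c.exists_refinement h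
  obtain rfl := c.eq_of_comp_eq f (hk.trans hl.symm) w
  exact c.arrow_cancel k w'

/-- An arrow is given by any span over its source and target, up to an automorphism. -/
theorem exists_aut_of_span {d a b : A} (f : d ⟶ a) (g : d ⟶ b) (z : c.diagram.obj d) (γ : c.Arrow)
    (hs : γ.src = c.elt a (c.diagram.map f z)) (y : c.diagram.obj b) (ht : γ.tgt = c.elt b y) :
    ∃ ψ : Aut b, γ = c.ofSpan f (g ≫ ψ.hom) z := by
  obtain ⟨p, q, γ⟩ := γ
  obtain rfl : p = _ := hs
  obtain rfl : q = _ := ht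
  obtain ⟨e', f', h, rfl⟩ := c.exists_fraction γ
  obtain ⟨e, l, k, w⟩ := c.elt_ore f' (c.eltHom f z _ rfl)
  -- On a common refinement of the left legs, the two right legs are arrows from `e` to `b` and
  -- differ by an automorphism of `b`.
  obtain ⟨ψ, hψ, -⟩ := c.isChartCategory.torsor e.1 b (k.1 ≫ g) (l ≫ h).1
  refine ⟨ψ, ?_⟩
  have hk : c.diagram.map k.1 e.2 = z := k.2
  have hf' : k.1 ≫ f = (l ≫ f').1 := congrArg Subtype.val w.symm
  have h₁ : c.ofSpan f (g ≫ ψ.hom) z = c.ofSpan (l ≫ f').1 (l ≫ h).1 e.2 := by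
    refine (congrArg (c.ofSpan f (g ≫ ψ.hom)) hk.symm).trans ?_
    refine (c.ofSpan_comp k.1 f (g ≫ ψ.hom) e.2).symm.trans ?_
    rw [← hf', ← hψ]
    exact congrArg (c.ofSpan _ · e.2) (Category.assoc _ _ _).symm
  rw [h₁, c.ofSpan_elt (l ≫ f') (l ≫ h)]
  simp

variable {c} in
/-- The composition of arrows. -/
noncomputable def Arrow.comp (γ δ : c.Arrow) (h : γ.tgt = δ.src) : c.Arrow :=
  ⟨γ.src, δ.tgt, γ.hom ≫ eqToHom (congrArg c.Q.obj h) ≫ δ.hom⟩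

theorem ofSpan_comp_ofSpan {d a b e : A} (f : d ⟶ a) (g : d ⟶ b) (k : d ⟶ e)
    (z : c.diagram.obj d) :
    (c.ofSpan f g z).comp (c.ofSpan g k z) rfl = c.ofSpan f k z := by
  simp [Arrow.comp, ofSpan]

variable {c} in
/-- The inverse of an arrow. -/
noncomputable def Arrow.symm (γ : c.Arrow) : c.Arrow := ⟨γ.tgt, γ.src, inv γ.hom⟩

theorem ofSpan_symm {d a b : A} (f : d ⟶ a) (g : d ⟶ b) (z : c.diagram.obj d) :
    (c.ofSpan f g z).symm = c.ofSpan g f z := by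
  simp [Arrow.symm, ofSpan]

/-- The identity arrows. -/
noncomputable def idArrow (p : c.Elt) : c.Arrow := ⟨p, p, 𝟙 _⟩

theorem ofSpan_self {d a : A} (f : d ⟶ a) (z : c.diagram.obj d) :
    c.ofSpan f f z = c.idArrow (c.elt a (c.diagram.map f z)) := by
  simp [idArrow, ofSpan]

variable {c} in
-- Composable arrows are given by three legs with one apex, so that composing them means forgetting
-- the middle leg.
theorem Arrow.exists_span {γ δ : c.Arrow} (h : γ.tgt = δ.src) : ∃ (d a b e : A) (f : d ⟶ a)
    (g : d ⟶ b) (k : d ⟶ e) (z : c.diagram.obj d), γ = c.ofSpan f g z ∧ δ = c.ofSpan g k z := by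
  obtain ⟨p, q, γ⟩ := γ
  obtain ⟨q', r, δ⟩ := δ
  obtain rfl : q = q' := h
  obtain ⟨e, g, f, k, h₁, h₂⟩ := c.exists_common_span (inv γ) δ
  refine ⟨_, _, _, _, f.1, g.1, k.1, e.2, ?_, ?_⟩
  · have h₃ : γ = inv (inv (c.Q.map g) ≫ c.Q.map f) := by rw [← h₁, IsIso.inv_inv]
    rw [c.ofSpan_elt f g, h₃, IsIso.inv_comp, IsIso.inv_inv]
  · rw [c.ofSpan_elt g k, h₂]

variable {c}

theorem Arrow.id_comp (γ : c.Arrow) : (c.idArrow γ.src).comp γ rfl = γ := by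
  simp [Arrow.comp, idArrow]

theorem Arrow.comp_id (γ : c.Arrow) : γ.comp (c.idArrow γ.tgt) rfl = γ := by
  simp [Arrow.comp, idArrow]

theorem Arrow.assoc (γ δ ε : c.Arrow) (h : γ.tgt = δ.src) (h' : δ.tgt = ε.src) :
    (γ.comp δ h).comp ε h' = γ.comp (δ.comp ε h') h := by
  simp [Arrow.comp]

theorem Arrow.comp_symm (γ : c.Arrow) : γ.comp γ.symm rfl = c.idArrow γ.src := by
  simp [Arrow.comp, Arrow.symm, idArrow]

theorem Arrow.symm_comp (γ : c.Arrow) : γ.symm.comp γ rfl = c.idArrow γ.tgt := by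
  simp [Arrow.comp, Arrow.symm, idArrow]

end OrbifoldAtlas

end SatakeOrbifold

/-! ### The étale groupoid of an atlas -/

namespace SatakeOrbifold

open Mfd

variable {𝕜 : Type} [RCLike 𝕜]

namespace Mfd

/-- Morphisms lift locally along étale maps. -/
theorem Etale.exists_local_lift {W N M : Mfd.{u} 𝕜} {e : W ⟶ N} (he : Etale e) (f : M ⟶ N) {m : M}
    {w : W} (h : e w = f m) : ∃ (U : Mfd.{u} 𝕜) (k : U ⟶ M) (l : U ⟶ W) (n : U), OpenEmb k ∧
      k n = m ∧ l n = w ∧ k ≫ f = l ≫ e := by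
  obtain ⟨d, hw, hd, hds⟩ := he w
  have hs : IsOpen (f ⁻¹' d.target) := d.open_target.preimage (continuous f)
  let k := openSubι _ hs
  have hm : m ∈ f ⁻¹' d.target := by
    change f m ∈ d.target
    rw [← h, hd w hw]; exact d.map_source hw
  have hl : SmoothOn (fun u => d.symm (f (k u))) univ :=
    (hds.comp_on (k ≫ f).smooth isOpen_univ d.open_target).mono (fun u _ => ⟨trivial, u.2⟩)
  refine ⟨_, k, ⟨_, hl⟩, ⟨m, hm⟩, openEmb_openSubι _ hs, rfl, ?_, ?_⟩
  · change d.symm (f m) = w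
    rw [← h, hd w hw, d.left_inv hw]
  · refine Mfd.hom_ext fun u => ?_
    change f (k u) = e (d.symm (f (k u)))
    exact ((hd _ (d.map_target u.2)).trans (d.right_inv u.2)).symm

/-- Lifts along étale maps are locally unique. -/
theorem Etale.exists_nbhd_eq {U N M : Mfd.{u} 𝕜} {s : N ⟶ M} (hs : Etale s) {p q : U ⟶ N}
    (h : p ≫ s = q ≫ s) {n : U} (hn : p n = q n) :
    ∃ (W : Mfd.{u} 𝕜) (k : W ⟶ U), IsNbhd k n ∧ k ≫ p = k ≫ q := by
  obtain ⟨d, hd, hd', -⟩ := hs (p n)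
  have ho : IsOpen (p ⁻¹' d.source ∩ q ⁻¹' d.source) :=
    (d.open_source.preimage (continuous p)).inter (d.open_source.preimage (continuous q))
  refine ⟨_, openSubι _ ho, ⟨openEmb_openSubι _ ho, ?_⟩, Mfd.hom_ext fun w => ?_⟩
  · rw [range_openSubι]
    exact ⟨hd, by rw [mem_preimage, ← hn]; exact hd⟩
  · refine d.injOn w.2.1 w.2.2 ?_
    exact (hd' _ w.2.1).symm.trans ((hom_congr_apply h w.1).trans (hd' _ w.2.2))

/-- The inclusion of a member into a disjoint union. -/
def sigmaι {I : Type u} (V : I → Mfd.{u} 𝕜) (i : I) : V i ⟶ sigma V where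
  toFun v := ⟨i, v⟩
  smooth := by
    refine ⟨(continuous_sigmaMk (σ := fun i => (V i).carrier)).continuousOn, ?_⟩
    rintro m n e he E ⟨j, e', he', rfl⟩
    by_cases hij : i = j
    · subst hij
      refine ((V i).compat m n e he e' he').congr_mono ?_ ?_
      · intro z hz
        exact OpenPartialHomeomorph.lift_openEmbedding_apply _ _
      · rintro z ⟨hz, -, y, hy, hyz⟩
        refine ⟨hz, ?_⟩
        have : y = e.symm z := by simpa using hyz
        subst this
        exact hy
    · intro z hz
      obtain ⟨-, -, y, -, hyz⟩ := hz
      exact absurd (congrArg Sigma.fst hyz).symm hij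

open Classical in
theorem openEmb_sigmaι {I : Type u} (V : I → Mfd.{u} 𝕜) (i : I) : OpenEmb (sigmaι V i) := by
  refine ⟨fun v => ?_, fun v w h => eq_of_heq (Sigma.mk.inj h).2⟩
  -- A globally smooth retraction to `V i`. Its constant value on the other members is arbitrary,
  -- since only its restriction to the image of `V i` matters.
  let q : ∀ j, V j ⟶ V i := fun j =>
    if h : j = i then eqToHom (congrArg V h) else ⟨fun _ => v, isSmooth_const v⟩
  have hq : ∀ v, sigmaDesc q (sigmaι V i v) = v := fun v => by
    simp only [sigmaDesc, sigmaι, q, dif_pos]; rfl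
  let e : OpenPartialHomeomorph (V i) (sigma V) :=
    { toFun := sigmaι V i
      invFun := sigmaDesc q
      source := univ
      target := range (sigmaι V i)
      map_source' := fun v _ => ⟨v, rfl⟩
      map_target' := fun _ _ => trivial
      left_inv' := fun v _ => hq v
      right_inv' := by
        rintro _ ⟨v, rfl⟩
        rw [hq]
      open_source := isOpen_univ
      open_target := (isOpenMap_sigmaMk (σ := fun i => (V i).carrier)).isOpen_range
      continuousOn_toFun := (continuous _).continuousOn
      continuousOn_invFun := (continuous _).continuousOn }
  exact ⟨e, trivial, fun _ _ => rfl, (sigmaDesc q).smooth.mono (subset_univ _)⟩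

end Mfd

/-- Where `p ∘ q` is injective so is `q`, which is then an open embedding there; locally `p` is the
inverse of `q` followed by `p ∘ q`. -/
theorem isLocalHomeomorph_of_cover {Y M : Type*} [TopologicalSpace Y] [TopologicalSpace M]
    {p : Y → M} (h : ∀ y, ∃ (Z : Type u) (_ : TopologicalSpace Z) (q : Z → Y), Continuous q ∧
      IsOpenMap q ∧ y ∈ range q ∧ IsLocalHomeomorph (p ∘ q)) : IsLocalHomeomorph p := by
  refine IsLocalHomeomorph.mk _ (fun y => ?_)
  obtain ⟨Z, _, q, hq, hq', ⟨z, rfl⟩, hpq⟩ := h y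
  obtain ⟨e, hz, he⟩ := hpq z
  have : Nonempty Z := ⟨z⟩
  have hinj : InjOn q e.source := fun a ha b hb hab => e.injOn ha hb (by
    rw [← he]; exact congrArg p hab)
  let d := OpenPartialHomeomorph.ofContinuousOpen (hinj.toPartialEquiv q e.source)
    hq.continuousOn hq' e.open_source
  refine ⟨d.symm.trans e, ?_, ?_⟩
  · refine ⟨d.map_source hz, ?_⟩
    change d.symm (d z) ∈ e.source
    rwa [d.left_inv hz]
  · intro y hy
    change p y = e (d.symm y)
    rw [← he]
    change p y = p (d (d.symm y))
    rw [d.right_inv hy.1]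

namespace OrbifoldAtlas

variable {X : Type u} [TopologicalSpace X] {A : Type u} [SmallCategory A]
  (c : OrbifoldAtlas.{u} 𝕜 X A)

/-- The manifold of objects of the groupoid of an atlas. -/
noncomputable def objMfd : Mfd.{u} 𝕜 := sigma c.diagram.obj

/-- The inclusion of a chart into the manifold of objects. -/
noncomputable def incl (a : A) : c.diagram.obj a ⟶ c.objMfd := sigmaι c.diagram.obj a

theorem openEmb_incl (a : A) : OpenEmb (c.incl a) := openEmb_sigmaι _ a

/-- The finest topology for which all the span maps are continuous. -/
instance : TopologicalSpace c.Arrow where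
  IsOpen U := ∀ (d a b : A) (f : d ⟶ a) (g : d ⟶ b), IsOpen (c.ofSpan f g ⁻¹' U)
  isOpen_univ _ _ _ _ _ := isOpen_univ
  isOpen_inter _ _ hs ht d a b f g := (hs d a b f g).inter (ht d a b f g)
  isOpen_sUnion S hS d a b f g := by
    rw [preimage_sUnion]
    exact isOpen_biUnion fun t ht => hS t ht d a b f g

theorem continuous_ofSpan {d a b : A} (f : d ⟶ a) (g : d ⟶ b) : Continuous (c.ofSpan f g) :=
  ⟨fun _ hU => hU d a b f g⟩

theorem continuous_arrow_iff {Y : Type*} [TopologicalSpace Y] {F : c.Arrow → Y} :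
    Continuous F ↔ ∀ (d a b : A) (f : d ⟶ a) (g : d ⟶ b),
      Continuous (fun z => F (c.ofSpan f g z)) :=
  ⟨fun h _ _ _ f g => h.comp (c.continuous_ofSpan f g),
    fun h => ⟨fun _ hU d a b f g => hU.preimage (h d a b f g)⟩⟩

/-- If another span takes the same value at a point, then both agree along a common refinement,
whose image in the source of the other span is open because `V(l)` is étale. -/
theorem isOpenMap_ofSpan {d a b : A} (f : d ⟶ a) (g : d ⟶ b) : IsOpenMap (c.ofSpan f g) := by
  intro O hO d' a' b' f' g'
  rw [isOpen_iff_forall_mem_open]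
  rintro z' ⟨z, hz, h⟩
  obtain rfl : a = a' := congrArg (fun γ : c.Arrow => γ.src.1) h
  obtain rfl : b = b' := congrArg (fun γ : c.Arrow => γ.tgt.1) h
  obtain ⟨e, u, k, l, hk, hl, w, w'⟩ := c.exists_refinement h
  refine ⟨c.diagram.map l '' (c.diagram.map k ⁻¹' O), ?_,
    (c.etale_map l).isOpenMap _ (hO.preimage (continuous _)), u, ?_, hl⟩
  · rintro _ ⟨v, hv, rfl⟩
    refine ⟨c.diagram.map k v, hv, ?_⟩
    rw [← c.ofSpan_comp, w, w', c.ofSpan_comp]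
  · rw [mem_preimage, hk]; exact hz

/-- The source, as a map to the manifold of objects. -/
def srcPt (γ : c.Arrow) : c.objMfd := γ.src

/-- The target, as a map to the manifold of objects. -/
def tgtPt (γ : c.Arrow) : c.objMfd := γ.tgt

theorem continuous_srcPt : Continuous c.srcPt :=
  c.continuous_arrow_iff.2 fun _ _ _ f _ => continuous (c.diagram.map f ≫ c.incl _)

theorem continuous_tgtPt : Continuous c.tgtPt :=
  c.continuous_arrow_iff.2 fun _ _ _ _ g => continuous (c.diagram.map g ≫ c.incl _)

theorem etale_map_incl {a b : A} (f : a ⟶ b) : Etale (c.diagram.map f ≫ c.incl b) :=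
  (c.etale_map f).comp (c.openEmb_incl b).1

theorem isLocalHomeomorph_srcPt : IsLocalHomeomorph c.srcPt := by
  refine isLocalHomeomorph_of_cover (fun γ => ?_)
  obtain ⟨d, a, b, f, g, z, rfl⟩ := c.exists_eq_ofSpan γ
  exact ⟨_, inferInstance, c.ofSpan f g, c.continuous_ofSpan f g, c.isOpenMap_ofSpan f g, ⟨z, rfl⟩,
    (c.etale_map_incl f).isLocalHomeomorph⟩

/-- Arrows with different sources or targets are separated there. Otherwise they have spans with a
common left leg `f` and different right legs; on an open set where `V(f)` is injective, a
coincidence of the two span maps would occur at a single point and force the right legs to be equal.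
-/
instance : T2Space c.Arrow := by
  refine ⟨fun γ δ hne => ?_⟩
  by_cases hs : c.srcPt γ = c.srcPt δ
  · by_cases ht : c.tgtPt γ = c.tgtPt δ
    · obtain ⟨p, q, γ⟩ := γ
      obtain ⟨p', q', δ⟩ := δ
      obtain rfl : p = p' := hs
      obtain rfl : q = q' := ht
      obtain ⟨e, f, g, g', rfl, rfl⟩ := c.exists_common_span γ δ
      rw [← c.ofSpan_elt f g, ← c.ofSpan_elt f g'] at hne ⊢
      obtain ⟨E, hE, hE', -⟩ := c.etale_map f.1 e.2
      refine ⟨_, _, c.isOpenMap_ofSpan f.1 g.1 _ E.open_source,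
        c.isOpenMap_ofSpan f.1 g'.1 _ E.open_source, ⟨_, hE, rfl⟩, ⟨_, hE, rfl⟩, ?_⟩
      rw [Set.disjoint_left]
      rintro _ ⟨v, hv, rfl⟩ ⟨w, hw, h⟩
      have : c.diagram.map f.1 w = c.diagram.map f.1 v := c.elt_inj.1 (congrArg Arrow.src h)
      rw [hE' _ hw, hE' _ hv] at this
      obtain rfl := E.injOn hw hv this
      exact hne (by rw [c.ofSpan_left_injective h])
    · obtain ⟨U, V, hU, hV, h₁, h₂, h⟩ := t2_separation ht
      exact ⟨_, _, hU.preimage c.continuous_tgtPt, hV.preimage c.continuous_tgtPt, h₁, h₂,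
        h.preimage _⟩
  · obtain ⟨U, V, hU, hV, h₁, h₂, h⟩ := t2_separation hs
    exact ⟨_, _, hU.preimage c.continuous_srcPt, hV.preimage c.continuous_srcPt, h₁, h₂,
      h.preimage _⟩

/-- The manifold of arrows of the groupoid of an atlas. -/
noncomputable def arrMfd : Mfd.{u} 𝕜 := ofLocalHomeo c.Arrow c.srcPt c.isLocalHomeomorph_srcPt

/-- The source morphism. -/
noncomputable def srcHom : c.arrMfd ⟶ c.objMfd := ofLocalHomeoProj _ _ c.isLocalHomeomorph_srcPt

theorem etale_srcHom : Etale c.srcHom := etale_ofLocalHomeoProj _ _ _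

/-- The étale morphism to the manifold of arrows given by a span. -/
noncomputable def spanHom {d a b : A} (f : d ⟶ a) (g : d ⟶ b) : c.diagram.obj d ⟶ c.arrMfd where
  toFun := c.ofSpan f g
  smooth := c.etale_srcHom.smooth_of_comp (c.continuous_ofSpan f g)
    (c.diagram.map f ≫ c.incl a).smooth

theorem etale_spanHom {d a b : A} (f : d ⟶ a) (g : d ⟶ b) : Etale (c.spanHom f g) :=
  c.etale_srcHom.of_comp (c.etale_map_incl f)

/-- The span maps are étale and jointly surjective, so they serve as charts of the manifold of
arrows. -/
theorem smooth_of_spanHom {N : Mfd.{u} 𝕜} {F : c.arrMfd → N}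
    (h : ∀ (d a b : A) (f : d ⟶ a) (g : d ⟶ b),
      SmoothOn (fun z => F (c.spanHom f g z)) univ) : SmoothOn F univ := by
  refine smoothOn_univ_of_etale (fun γ => ?_)
  obtain ⟨d, a, b, f, g, z, rfl⟩ := c.exists_eq_ofSpan γ
  exact ⟨_, c.spanHom f g, c.etale_spanHom f g, ⟨z, rfl⟩, h d a b f g⟩

/-- The target morphism. -/
noncomputable def tgtHom : c.arrMfd ⟶ c.objMfd where
  toFun := c.tgtPt
  smooth := c.smooth_of_spanHom fun _ _ _ _ g => (c.diagram.map g ≫ c.incl _).smooth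

theorem etale_tgtHom : Etale c.tgtHom := etale_of_cover fun γ => by
  obtain ⟨d, a, b, f, g, z, rfl⟩ := c.exists_eq_ofSpan γ
  exact ⟨_, c.spanHom f g, c.etale_spanHom f g, ⟨z, rfl⟩, c.etale_map_incl g⟩

/-- The morphism of inverses. -/
noncomputable def invHom : c.arrMfd ⟶ c.arrMfd where
  toFun := Arrow.symm
  smooth := c.smooth_of_spanHom fun _ _ _ f g =>
    (c.spanHom g f).smooth.congr fun z _ => c.ofSpan_symm f g z

/-- The morphism of identity arrows. -/
noncomputable def oneHom : c.objMfd ⟶ c.arrMfd where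
  toFun := c.idArrow
  smooth := by
    refine smoothOn_univ_of_etale (fun x => ?_)
    obtain ⟨a, v⟩ := x
    refine ⟨_, c.incl a, (c.openEmb_incl a).1, ⟨v, rfl⟩, (c.spanHom (𝟙 a) (𝟙 a)).smooth.congr
      fun z _ => ?_⟩
    refine Eq.trans ?_ (c.ofSpan_self (𝟙 a) z).symm
    rw [c.map_id_apply]; rfl

/-- At one point the arrows are given by legs `F`, `Q`, `K`. The map `f` lifts locally through the
étale span map of `F` and `Q`. Along this lift, `g` and the span map of `Q` and `K` have the same
source and agree at a point, hence nearby, because the source map is étale. -/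
theorem isSmooth_arrow_comp {M : Mfd.{u} 𝕜} (f g : M ⟶ c.arrMfd)
    (h : ∀ m, Arrow.tgt (f m) = Arrow.src (g m)) :
    IsSmooth M c.arrMfd (fun m => Arrow.comp (f m) (g m) (h m)) := by
  refine isSmooth_of_locally (fun m => ?_)
  obtain ⟨d, a, b, e, F, Q, K, z, hf, hg⟩ := Arrow.exists_span (h m)
  obtain ⟨U, k, l, n, hk, rfl, rfl, w⟩ := (c.etale_spanHom F Q).exists_local_lift f hf.symm
  have hl : ∀ u, f (k u) = c.ofSpan F Q (l u) := fun u => hom_congr_apply w u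
  obtain ⟨W, k', hk', w'⟩ := c.etale_srcHom.exists_nbhd_eq (p := k ≫ g) (q := l ≫ c.spanHom Q K)
    (n := n) (Mfd.hom_ext fun u => by
      refine (h (k u)).symm.trans ?_
      rw [hl u]; rfl) hg
  have hl' : ∀ v, g (k (k' v)) = c.ofSpan Q K (l (k' v)) := fun v => hom_congr_apply w' v
  refine ⟨W, k' ≫ k, hk'.comp hk, (k' ≫ l ≫ c.spanHom F K).smooth.congr fun v _ => ?_⟩
  refine Eq.trans ?_ (c.ofSpan_comp_ofSpan F Q K (l (k' v)))
  change Arrow.comp (f (k (k' v))) (g (k (k' v))) _ = _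
  congr 1
  · exact hl _
  · exact hl' _

/-- The groupoid of an atlas. -/
noncomputable def groupoid : GroupoidIn.{u} 𝕜 where
  G₀ := c.objMfd
  G₁ := c.arrMfd
  s := c.srcHom
  t := c.tgtHom
  one := c.oneHom
  inv := c.invHom
  comp f g h := ⟨_, c.isSmooth_arrow_comp f g (fun m => hom_congr_apply h m)⟩
  comp_nat _ _ _ _ _ := rfl
  one_s := rfl
  one_t := rfl
  comp_s _ _ _ := rfl
  comp_t _ _ _ := rfl
  one_comp f _ := Mfd.hom_ext fun m => Arrow.id_comp (f m)
  comp_one f _ := Mfd.hom_ext fun m => Arrow.comp_id (f m)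
  assoc f g k h h' _ _ := Mfd.hom_ext fun m => Arrow.assoc (f m) (g m) (k m) (hom_congr_apply h m)
    (hom_congr_apply h' m)
  inv_s := rfl
  inv_t := rfl
  comp_inv f _ := Mfd.hom_ext fun m => Arrow.comp_symm (f m)
  inv_comp f _ := Mfd.hom_ext fun m => Arrow.symm_comp (f m)

theorem isEtale_groupoid : c.groupoid.IsEtale := ⟨c.etale_srcHom, c.etale_tgtHom⟩

/-- The projection from the manifold of objects to `X`. -/
def projPt (p : c.objMfd) : X := c.proj p.1 p.2

theorem continuous_projPt : Continuous c.projPt :=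
  continuous_sigma (σ := fun a => (c.diagram.obj a).carrier) fun a => (c.c.obj a).π_cont

theorem projPt_srcPt (γ : c.Arrow) : c.projPt (c.srcPt γ) = c.projPt (c.tgtPt γ) := by
  obtain ⟨d, a, b, f, g, z, rfl⟩ := c.exists_eq_ofSpan γ
  exact (c.proj_map f z).trans (c.proj_map g z).symm

/-- Let the endpoints converge to `(x, y)` along an ultrafilter of arrows. As `X` is Hausdorff, `x`
and `y` have the same image and are joined by a span. The possible limits are the arrows obtained
from this span by twisting with the finite group `Aut b`. -/
theorem isProperMap_srcPt_tgtPt [T2Space X] :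
    IsProperMap fun γ : c.Arrow => (c.srcPt γ, c.tgtPt γ) := by
  have hc : Continuous fun γ : c.Arrow => (c.srcPt γ, c.tgtPt γ) :=
    c.continuous_srcPt.prodMk c.continuous_tgtPt
  refine isProperMap_iff_ultrafilter.2 ⟨hc, ?_⟩
  rintro 𝒰 ⟨x, y⟩ h
  have h₁ : Filter.Tendsto c.srcPt 𝒰 (𝓝 x) := ((continuous_fst.tendsto _).comp h)
  have h₂ : Filter.Tendsto c.tgtPt 𝒰 (𝓝 y) := ((continuous_snd.tendsto _).comp h)
  have hxy : c.projPt x = c.projPt y := by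
    have h₃ := (c.continuous_projPt.tendsto x).comp h₁
    have h₄ := (c.continuous_projPt.tendsto y).comp h₂
    refine tendsto_nhds_unique h₃ (h₄.congr fun γ => (c.projPt_srcPt γ).symm)
  obtain ⟨a, x⟩ := x
  obtain ⟨b, y⟩ := y
  obtain ⟨d, z, f, g, rfl, rfl⟩ := c.exists_span_of_proj_eq (x := x) (y := y) hxy
  -- Otherwise each of the finitely many candidates has an open neighbourhood that is not in the
  -- ultrafilter. But an arrow with endpoints close to the given ones lies on a sheet through one of
  -- the candidates, at a point close to it, so the union of these neighbourhoods is in the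
  -- ultrafilter.
  have key : ∃ ψ : Aut b, (𝒰 : Filter c.Arrow) ≤ 𝓝 (c.ofSpan f (g ≫ ψ.hom) z) := by
    by_contra! hcon
    have hN : ∀ ψ : Aut b, ∃ N : Set c.Arrow, IsOpen N ∧ c.ofSpan f (g ≫ ψ.hom) z ∈ N ∧
        N ∉ (𝒰 : Filter c.Arrow) := by
      intro ψ
      by_contra! hN
      refine hcon ψ (fun S hS => ?_)
      obtain ⟨N, hN₁, hN₂, hN₃⟩ := mem_nhds_iff.1 hS
      exact Filter.mem_of_superset (hN N hN₂ hN₃) hN₁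
    choose N hN₁ hN₂ hN₃ using hN
    have : Finite (Aut b) := Finite.of_equiv _ (c.ι b).symm.toEquiv
    have hO : IsOpen (⋂ ψ : Aut b, c.ofSpan f (g ≫ ψ.hom) ⁻¹' N ψ) :=
      isOpen_iInter_of_finite fun ψ => (hN₁ ψ).preimage (c.continuous_ofSpan _ _)
    have hS : (c.diagram.map f ≫ c.incl a) '' (⋂ ψ : Aut b, c.ofSpan f (g ≫ ψ.hom) ⁻¹' N ψ) ∈
        𝓝 (c.incl a (c.diagram.map f z)) :=
      ((c.etale_map_incl f).isOpenMap _ hO).mem_nhds ⟨z, mem_iInter.2 hN₂, rfl⟩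
    have hT : range (c.incl b) ∈ 𝓝 (c.incl b (c.diagram.map g z)) :=
      (c.openEmb_incl b).1.isOpenMap.isOpen_range.mem_nhds ⟨_, rfl⟩
    have hU : ⋃ ψ : Aut b, N ψ ∈ (𝒰 : Filter c.Arrow) := by
      filter_upwards [h₁ hS, h₂ hT] with γ hγ hγ'
      obtain ⟨w, hw, hw'⟩ := hγ
      obtain ⟨v, hv⟩ := hγ'
      obtain ⟨ψ, rfl⟩ := c.exists_aut_of_span f g w γ hw'.symm v hv.symm
      exact mem_iUnion.2 ⟨ψ, mem_iInter.1 hw ψ⟩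
    obtain ⟨ψ, hψ⟩ := (Ultrafilter.eventually_exists_iff (f := 𝒰) (P := fun ψ γ => γ ∈ N ψ)).1
      (by filter_upwards [hU] with γ hγ using mem_iUnion.1 hγ)
    exact hN₃ ψ hψ
  obtain ⟨ψ, hψ⟩ := key
  exact ⟨_, tendsto_nhds_unique ((hc.tendsto _).mono_left hψ) h, hψ⟩

theorem isSeparated_groupoid [T2Space X] : c.groupoid.IsSeparated := c.isProperMap_srcPt_tgtPt

end OrbifoldAtlas

end SatakeOrbifold

/-! ### The realization of an atlas -/

namespace SatakeOrbifold

open Mfd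

variable {𝕜 : Type} [RCLike 𝕜]

section Transfer

variable {𝒜 𝒳 𝒴 𝒵 : BasedCategory.{u, u + 1} (Mfd.{u} 𝕜)}

/-- The isomorphism of underlying functors of an isomorphism of functors over manifolds. -/
def basedIsoToIso {F G : 𝒳 ⥤ᵇ 𝒴} (i : F ≅ G) : F.toFunctor ≅ G.toFunctor :=
  (BasedNatTrans.forgetful 𝒳 𝒴).mapIso i

/-- Composition of an isomorphism of functors over manifolds with a functor. -/
def basedIsoWhiskerRight {F G : 𝒜 ⥤ᵇ 𝒳} (i : F ≅ G) (K : 𝒳 ⥤ᵇ 𝒴) : F.comp K ≅ G.comp K where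
  hom := BasedCategory.whiskerRight i.hom K
  inv := BasedCategory.whiskerRight i.inv K
  hom_inv_id := BasedNatTrans.homCategory.ext _ _ (NatTrans.ext (funext fun a => by
    have h : i.hom.app a ≫ i.inv.app a = 𝟙 _ := congrArg (fun k : F ⟶ F => k.app a) i.hom_inv_id
    exact ((K.map_comp _ _).symm.trans (congrArg K.map h)).trans (K.map_id _)))
  inv_hom_id := BasedNatTrans.homCategory.ext _ _ (NatTrans.ext (funext fun a => by
    have h : i.inv.app a ≫ i.hom.app a = 𝟙 _ := congrArg (fun k : G ⟶ G => k.app a) i.inv_hom_id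
    exact ((K.map_comp _ _).symm.trans (congrArg K.map h)).trans (K.map_id _)))

/-- An equivalence of categories over manifolds, with an inverse over manifolds. -/
structure IsBasedEquiv (E : 𝒳 ⥤ᵇ 𝒴) : Prop where
  full : E.toFunctor.Full
  faithful : E.toFunctor.Faithful
  surj : ∀ y : 𝒴.obj, ∃ (x : 𝒳.obj) (φ : E.obj x ⟶ y), 𝒴.p.IsHomLift (𝟙 (𝒴.p.obj y)) φ

theorem isBasedEquiv_of_inverse {E : 𝒳 ⥤ᵇ 𝒴} {E' : 𝒴 ⥤ᵇ 𝒳} (η : E.comp E' ≅ BasedFunctor.id 𝒳)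
    (ε : E'.comp E ≅ BasedFunctor.id 𝒴) : IsBasedEquiv E := by
  let e : 𝒳.obj ≌ 𝒴.obj := CategoryTheory.Equivalence.mk E.toFunctor E'.toFunctor
    (basedIsoToIso η).symm (basedIsoToIso ε)
  exact ⟨(inferInstance : e.functor.Full), (inferInstance : e.functor.Faithful),
    fun y => ⟨E'.obj y, ε.hom.app y, BasedNatTrans.app_isHomLift ε.hom y⟩⟩

theorem IsBasedEquiv.isLocalEquiv {E : 𝒳 ⥤ᵇ 𝒴} (h : IsBasedEquiv E) : IsLocalEquiv E := by
  have := h.full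
  have := h.faithful
  refine ⟨fun y m => ?_, fun p q χ m => ?_, fun p q φ ψ h m => ?_⟩
  · obtain ⟨x, φ, hφ⟩ := h.surj y
    obtain ⟨f, hf, hf'⟩ := (isNbhd_id m).exists_of_eq
      ((E.w_obj x).symm.trans (IsHomLift.domain_eq 𝒴.p (𝟙 (𝒴.p.obj y)) φ)) hφ
    exact ⟨x, φ, f, hf, hf'⟩
  · obtain ⟨φ, rfl⟩ := E.toFunctor.map_surjective χ
    refine ⟨p, 𝟙 p, φ, ?_, ?_⟩
    · rw [𝒳.p.map_id]; exact isNbhd_id m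
    · rw [E.map_id, Category.id_comp]
  · refine ⟨p, 𝟙 p, ?_, ?_⟩
    · rw [𝒳.p.map_id]; exact isNbhd_id m
    · rw [E.toFunctor.map_injective h]

/-- A functor with the universal property of the associated stack is equivalent to the
associated stack. -/
theorem IsAssociatedStack.exists_comparison {ℓ₀ : 𝒜 ⥤ᵇ 𝒴} (h₀ : IsAssociatedStack ℓ₀)
    (hl : HasLifts 𝒜) {ℓ : 𝒜 ⥤ᵇ 𝒳} (h𝒳 : IsStack 𝒳)
    (h : ∀ 𝒵 : BasedCategory.{u, u + 1} (Mfd.{u} 𝕜), IsStack 𝒵 → (precomp ℓ 𝒵).IsEquivalence) :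
    ∃ E : 𝒴 ⥤ᵇ 𝒳, IsBasedEquiv E ∧ Nonempty (ℓ₀.comp E ≅ ℓ) := by
  have := h 𝒴 h₀.isStack
  have := h 𝒳 h𝒳
  have := h₀.precomp_isEquivalence hl h𝒳
  have := h₀.precomp_isEquivalence hl h₀.isStack
  let E := (precomp ℓ₀ 𝒳).objPreimage ℓ
  let i : ℓ₀.comp E ≅ ℓ := (precomp ℓ₀ 𝒳).objObjPreimageIso ℓ
  let E' := (precomp ℓ 𝒴).objPreimage ℓ₀
  let i' : ℓ.comp E' ≅ ℓ₀ := (precomp ℓ 𝒴).objObjPreimageIso ℓ₀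
  -- The composites of `E` and `E'` restrict along `ℓ₀` and `ℓ` to functors isomorphic to `ℓ₀` and
  -- `ℓ`. Precomposition is fully faithful, so the composites are isomorphic to identities.
  exact ⟨E, isBasedEquiv_of_inverse (E' := E')
    ((precomp ℓ₀ 𝒴).preimageIso (X := E.comp E') (Y := BasedFunctor.id 𝒴)
      ((basedIsoWhiskerRight i E').trans i'))
    ((precomp ℓ 𝒳).preimageIso (X := E'.comp E) (Y := BasedFunctor.id 𝒳)
      ((basedIsoWhiskerRight i' E).trans i)), ⟨i⟩⟩

end Transfer

namespace OrbifoldAtlas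

variable {X : Type u} [TopologicalSpace X] {A : Type u} [SmallCategory A]
  (c : OrbifoldAtlas.{u} 𝕜 X A)

theorem Arrow.comp_congr {c : OrbifoldAtlas.{u} 𝕜 X A} {γ γ' δ δ' : c.Arrow} (h : γ.tgt = δ.src)
    (hγ : γ = γ') (hδ : δ = δ') : γ.comp δ h = γ'.comp δ' (by rw [← hγ, ← hδ, h]) := by
  subst hγ hδ; rfl

theorem ofSpan_id_left {a b d : A} (f : a ⟶ b) (g : b ⟶ d) (z : c.diagram.obj a) :
    c.ofSpan (𝟙 b) g (c.diagram.map f z) = c.ofSpan f (f ≫ g) z := by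
  rw [← c.ofSpan_comp, Category.comp_id]

/-- The functor from the total category of the diagram of manifolds to the groupoid of an atlas. -/
noncomputable def toGroupoid : total c.diagram ⥤ᵇ c.groupoid.toBased where
  obj x := (⟨TotalObj.base x, TotalObj.map x ≫ c.incl (TotalObj.idx x)⟩ : c.groupoid.Pts)
  map {x y} f :=
    { base := TotalHom.base f
      arr := TotalObj.map x ≫ c.spanHom (𝟙 _) (TotalHom.idx f)
      src := Mfd.hom_ext fun m => congrArg (c.elt _) (c.map_id_apply _ (TotalObj.map x m))
      tgt := Mfd.hom_ext fun m => congrArg (c.elt _) (hom_congr_apply (TotalHom.w f) m) }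
  map_id x := GroupoidIn.PtsHom.ext rfl (Mfd.hom_ext fun m =>
    (c.ofSpan_self _ _).trans (congrArg (fun v => c.idArrow (c.elt _ v)) (c.map_id_apply _ _)))
  map_comp {x y z} f g := GroupoidIn.PtsHom.ext rfl (Mfd.hom_ext fun m => by
    have h₁ : c.ofSpan (𝟙 _) (TotalHom.idx g) (TotalObj.map y (TotalHom.base f m)) =
        c.ofSpan (TotalHom.idx f) (TotalHom.idx f ≫ TotalHom.idx g) (TotalObj.map x m) :=
      (congrArg (c.ofSpan (𝟙 _) (TotalHom.idx g)) (hom_congr_apply (TotalHom.w f) m).symm).trans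
        (c.ofSpan_id_left _ _ _)
    refine (c.ofSpan_comp_ofSpan (𝟙 _) (TotalHom.idx f) (TotalHom.idx f ≫ TotalHom.idx g)
      (TotalObj.map x m)).symm.trans ?_
    exact Arrow.comp_congr rfl rfl h₁.symm)
  w := rfl

/-- A map to the manifold of arrows lifts locally through an étale span map, and the two legs of the
span are then arrows of the total category that represent it as a fraction. Faithfulness is
`ofSpan_left_injective` at a point. -/
theorem isLocalEquiv_toGroupoid : IsLocalEquiv c.toGroupoid where
  surj (x : c.groupoid.Pts) m := by
    obtain ⟨a, v, hv⟩ : ∃ (a : A) (v : c.diagram.obj a), x.map m = c.incl a v :=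
      ⟨(x.map m).1, (x.map m).2, rfl⟩
    obtain ⟨W, k, l, hk, hw⟩ := exists_nbhd_lift (isSmooth_hom x.map) m (f := c.incl a)
      ⟨c.openEmb_incl a, v, hv.symm⟩
    let q : TotalObj c.diagram := ⟨a, W, l⟩
    let φ : c.toGroupoid.obj q ⟶ x :=
      show GroupoidIn.PtsHom (c.toGroupoid.obj q : c.groupoid.Pts) x from
      { base := k
        arr := (l ≫ c.incl a) ≫ c.groupoid.one
        src := rfl
        tgt := Mfd.hom_ext hw }
    exact ⟨q, φ, k, hk, IsHomLift.map c.groupoid.toBased.p φ⟩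
  full (p q : TotalObj c.diagram) χ m := by
    let χ' : GroupoidIn.PtsHom (c.toGroupoid.obj p : c.groupoid.Pts) (c.toGroupoid.obj q) := χ
    obtain ⟨d, a, b, f, g, z, h⟩ := c.exists_eq_ofSpan (χ'.arr m)
    obtain ⟨i, B, x⟩ := p
    obtain ⟨j, B', y⟩ := q
    obtain rfl : i = a := congrArg (fun γ : c.Elt => γ.1)
      ((hom_congr_apply χ'.src m).symm.trans (congrArg Arrow.src h))
    obtain rfl : j = b := congrArg (fun γ : c.Elt => γ.1)
      ((hom_congr_apply χ'.tgt m).symm.trans (congrArg Arrow.tgt h))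
    obtain ⟨U, k, l, n, hk, rfl, rfl, w⟩ := (c.etale_spanHom f g).exists_local_lift χ'.arr h.symm
    have hl : ∀ u, χ'.arr (k u) = c.ofSpan f g (l u) := fun u => hom_congr_apply w u
    have hs : l ≫ c.diagram.map f = k ≫ x := Mfd.hom_ext fun u => c.elt_inj.1
      ((congrArg Arrow.src (hl u)).symm.trans (hom_congr_apply χ'.src (k u)))
    have ht : l ≫ c.diagram.map g = (k ≫ χ'.base) ≫ y := Mfd.hom_ext fun u => c.elt_inj.1
      ((congrArg Arrow.tgt (hl u)).symm.trans (hom_congr_apply χ'.tgt (k u)))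
    let r : TotalObj c.diagram := ⟨d, U, l⟩
    let ρ : TotalHom r ⟨i, B, x⟩ := ⟨f, k, hs⟩
    let φ : TotalHom r ⟨j, B', y⟩ := ⟨g, k ≫ χ'.base, ht⟩
    refine ⟨r, ρ, φ, ⟨hk, n, rfl⟩, ?_⟩
    refine GroupoidIn.PtsHom.ext rfl (Mfd.hom_ext fun u => ?_)
    refine (c.ofSpan_comp_ofSpan (𝟙 _) f g (l u)).symm.trans ?_
    have h₁ : c.ofSpan f g (l u) = χ'.arr (k u) := (hl u).symm
    exact Arrow.comp_congr rfl rfl h₁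
  faithful (p q : TotalObj c.diagram) (φ : TotalHom p q) (ψ : TotalHom p q) h m := by
    refine ⟨p, 𝟙 p, isNbhd_id m, ?_⟩
    congr 1
    have hb : φ.base = ψ.base := congrArg GroupoidIn.PtsHom.base h
    have ha := hom_congr_apply (congrArg GroupoidIn.PtsHom.arr h) m
    exact TotalHom.ext (c.ofSpan_left_injective ha) hb

/-- A presentation of the realization of an atlas by its groupoid. -/
theorem exists_presentation : ∃ (𝒳 : BasedCategory.{u, u + 1} (Mfd.{u} 𝕜))
    (α : c.groupoid.toBased ⥤ᵇ 𝒳), IsAssociatedStack α ∧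
      IsAssociatedStack (c.toGroupoid.comp α) := by
  obtain ⟨𝒳, α, hα⟩ := c.groupoid.exists_isAssociatedStack
  exact ⟨𝒳, α, hα, isAssociatedStack_iff.2 ⟨hα.isStack,
    c.isLocalEquiv_toGroupoid.comp hα.isLocalEquiv⟩⟩

theorem exists_isRealization : ∃ (𝒳 : BasedCategory.{u, u + 1} (Mfd.{u} 𝕜))
    (ℓ : total c.diagram ⥤ᵇ 𝒳), c.IsRealization ℓ := by
  obtain ⟨𝒳, α, -, h⟩ := c.exists_presentation
  exact ⟨𝒳, _, h.isStack, fun 𝒵 h𝒵 => h.precomp_isEquivalence (hasLifts_total _) h𝒵⟩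

variable {c} {𝒳 : BasedCategory.{u, u + 1} (Mfd.{u} 𝕜)} {ℓ : total c.diagram ⥤ᵇ 𝒳}

/-- A universal property determines its solution up to equivalence, so the presentation found for
one 2-colimit is transported to any other. -/
theorem IsRealization.exists_isAssociatedStack (h : c.IsRealization ℓ) :
    IsAssociatedStack ℓ ∧ ∃ α : c.groupoid.toBased ⥤ᵇ 𝒳, IsAssociatedStack α := by
  obtain ⟨𝒴, α, hα, h₀⟩ := c.exists_presentation
  obtain ⟨E, hE, ⟨i⟩⟩ := h₀.exists_comparison (hasLifts_total _) h.1 h.2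
  exact ⟨isAssociatedStack_iff.2 ⟨h.1, (h₀.isLocalEquiv.comp hE.isLocalEquiv).congr i⟩,
    α.comp E, isAssociatedStack_iff.2 ⟨h.1, hα.isLocalEquiv.comp hE.isLocalEquiv⟩⟩

theorem IsRealization.isAssociatedStack (h : c.IsRealization ℓ) : IsAssociatedStack ℓ :=
  h.exists_isAssociatedStack.1

theorem IsRealization.isOrbifold [T2Space X] (h : c.IsRealization ℓ) : IsOrbifold 𝒳 :=
  ⟨h.1, c.groupoid, c.isEtale_groupoid, c.isSeparated_groupoid, h.exists_isAssociatedStack.2⟩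

end OrbifoldAtlas

end SatakeOrbifold

/-! ### Local images and open embeddings -/

namespace SatakeOrbifold

open Mfd

variable {𝕜 : Type} [RCLike 𝕜]

section LocalImage

variable {ℬ 𝒳 𝒴 𝒬 : BasedCategory.{u, u + 1} (Mfd.{u} 𝕜)}

/-- In a category fibred in groupoids, arrows to `y` and the morphisms between them are determined
by their projections to the base of `y`. For a fully faithful `P` the fibre product is thus fully
embedded in the manifolds over that base, and only its essential image remains to be identified. -/
theorem IsOpenEmb.of_full_faithful (P : 𝒬 ⥤ᵇ 𝒳) [P.toFunctor.Full] [P.toFunctor.Faithful]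
    (h𝒳 : IsGroupoidOver 𝒳) (W : ∀ y : 𝒳.obj, Set (𝒳.p.obj y)) (hW : ∀ y, IsOpen (W y))
    (h₁ : ∀ (x : 𝒬.obj) (y : 𝒳.obj) (χ : P.obj x ⟶ y), range (𝒳.p.map χ) ⊆ W y)
    (h₂ : ∀ (y : 𝒳.obj) (U : Mfd.{u} 𝕜) (v : U ⟶ 𝒳.p.obj y), range v ⊆ W y →
      ∃ (x : 𝒬.obj) (χ : P.obj x ⟶ y), 𝒳.p.IsHomLift v χ) : IsOpenEmb P := by
  intro y
  have h₃ : ∀ (U : Mfd.{u} 𝕜) (v : U ⟶ 𝒳.p.obj y), range v ⊆ W y →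
      (fibreProj P y).essImage (Over.mk v) := fun U v hv => by
    obtain ⟨x, χ, hχ⟩ := h₂ y U v hv
    obtain rfl := IsHomLift.domain_eq 𝒳.p v χ
    obtain rfl := IsHomLift.eq_of_isHomLift 𝒳.p v χ
    exact ⟨CostructuredArrow.mk (S := P.toFunctor) χ, ⟨Iso.refl _⟩⟩
  refine ⟨⟨fun {s t} γ => ?_⟩, ⟨fun {s t} a b hab => ?_⟩, W y, hW y, fun v => ⟨?_, fun hv => ?_⟩⟩
  · obtain ⟨c, ⟨hc, hc'⟩, -⟩ := h𝒳.factor y (P.obj s.left) (P.obj t.left) s.hom t.hom γ.left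
      (Over.w γ).symm
    obtain ⟨d, rfl⟩ := P.toFunctor.map_surjective c
    exact ⟨CostructuredArrow.homMk d hc, Over.OverMorphism.ext hc'⟩
  · refine CostructuredArrow.hom_ext _ _ (P.toFunctor.map_injective ?_)
    refine h𝒳.hom_unique' t.hom (congrArg CommaMorphism.left hab) ?_
    exact (CostructuredArrow.w a).trans (CostructuredArrow.w b).symm
  · rintro ⟨s, ⟨i⟩⟩
    have hw : i.inv.left ≫ 𝒳.p.map s.hom = v.hom := Over.w i.inv
    rw [← hw]
    rintro _ ⟨m, rfl⟩
    exact h₁ s.left y s.hom ⟨i.inv.left m, rfl⟩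
  · exact h₃ v.left v.hom hv

/-! ### The full substack of objects that are locally in the image of a functor. -/

/-- The points of the base of `y` near which `y` is in the image of `j`. -/
def hitSet (j : ℬ ⥤ᵇ 𝒳) (y : 𝒳.obj) : Set (𝒳.p.obj y) :=
  {m | ∃ (r : ℬ.obj) (σ : j.obj r ⟶ y) (f : ℬ.p.obj r ⟶ 𝒳.p.obj y),
    IsNbhd f m ∧ 𝒳.p.IsHomLift f σ}

theorem isOpen_hitSet (j : ℬ ⥤ᵇ 𝒳) (y : 𝒳.obj) : IsOpen (hitSet j y) := by
  rw [isOpen_iff_forall_mem_open]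
  rintro m ⟨r, σ, f, hf, hσ⟩
  refine ⟨range f, ?_, hf.1.1.isOpenMap.isOpen_range, hf.2⟩
  rintro _ ⟨n, rfl⟩
  exact ⟨r, σ, f, ⟨hf.1, n, rfl⟩, hσ⟩

theorem mem_hitSet_obj (j : ℬ ⥤ᵇ 𝒳) (r : ℬ.obj) (m : 𝒳.p.obj (j.obj r)) :
    m ∈ hitSet j (j.obj r) := by
  obtain ⟨f, hf, hf'⟩ := (isNbhd_id m).exists_of_eq (j.w_obj r).symm
    (IsHomLift.id (p := 𝒳.p) (a := j.obj r) rfl)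
  exact ⟨r, 𝟙 _, f, hf, hf'⟩

theorem mem_hitSet_of_map {j : ℬ ⥤ᵇ 𝒳} (h𝒳 : IsGroupoidOver 𝒳) (hl : HasLifts ℬ) {x y : 𝒳.obj}
    (χ : x ⟶ y) {m : 𝒳.p.obj x} (h : 𝒳.p.map χ m ∈ hitSet j y) : m ∈ hitSet j x := by
  obtain ⟨r, σ, f, hf, hσ⟩ := h
  obtain ⟨V, k, l, hk, hkl⟩ := exists_nbhd_lift (isSmooth_hom (𝒳.p.map χ)) m hf
  obtain ⟨s, ρ, hρ⟩ := hl r V l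
  have hw : k ≫ 𝒳.p.map χ = l ≫ f := Mfd.hom_ext fun v => (hkl v).symm
  obtain ⟨d, hd, -⟩ := h𝒳.exists_factor (f := l ≫ f) k hw (j.map ρ ≫ σ) χ inferInstance
    (IsHomLift.map 𝒳.p χ)
  obtain ⟨g, hg, hg'⟩ := hk.exists_of_eq (IsHomLift.domain_eq ℬ.p l ρ) hd
  exact ⟨s, d, g, hg, hg'⟩

theorem mem_hitSet_of_isNbhd {j : ℬ ⥤ᵇ 𝒳} {x y : 𝒳.obj} (hx : ∀ m, m ∈ hitSet j x) (ρ : x ⟶ y)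
    {V : Mfd.{u} 𝕜} {f : V ⟶ 𝒳.p.obj y} {m : 𝒳.p.obj y} (hf : IsNbhd f m) (h : 𝒳.p.IsHomLift f ρ) :
    m ∈ hitSet j y := by
  obtain rfl := IsHomLift.domain_eq 𝒳.p f ρ
  obtain ⟨hf, v, rfl⟩ := hf
  obtain ⟨r, σ, g, hg, hσ⟩ := hx v
  exact ⟨r, σ ≫ ρ, g ≫ f, hg.comp hf, inferInstance⟩

/-- The objects of `𝒳` that are locally in the image of `j`. -/
def LocalImage (j : ℬ ⥤ᵇ 𝒳) : Type (u + 1) := {y : 𝒳.obj // ∀ m, m ∈ hitSet j y}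

instance (j : ℬ ⥤ᵇ 𝒳) : Category.{u} (LocalImage j) where
  Hom x y := x.1 ⟶ y.1
  id x := 𝟙 x.1
  comp f g := f ≫ g
  id_comp f := Category.id_comp (obj := 𝒳.obj) f
  comp_id f := Category.comp_id (obj := 𝒳.obj) f
  assoc f g h := Category.assoc (obj := 𝒳.obj) f g h

/-- The full subcategory of objects that are locally in the image of `j`. -/
def localImage (j : ℬ ⥤ᵇ 𝒳) : BasedCategory.{u, u + 1} (Mfd.{u} 𝕜) where
  obj := LocalImage j
  p := { obj := fun x => 𝒳.p.obj x.1
         map := fun f => 𝒳.p.map f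
         map_id := fun x => 𝒳.p.map_id x.1
         map_comp := fun f g => 𝒳.p.map_comp f g }

/-- The inclusion of the objects that are locally in the image of `j`. -/
def localImageIncl (j : ℬ ⥤ᵇ 𝒳) : localImage j ⥤ᵇ 𝒳 where
  obj := Subtype.val
  map f := f
  map_id _ := rfl
  map_comp _ _ := rfl
  w := rfl

instance (j : ℬ ⥤ᵇ 𝒳) : (localImageIncl j).toFunctor.Full := ⟨fun f => ⟨f, rfl⟩⟩

instance (j : ℬ ⥤ᵇ 𝒳) : (localImageIncl j).toFunctor.Faithful := ⟨fun h => h⟩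

/-- The factorization of `j` over the objects that are locally in its image. -/
def toLocalImage (j : ℬ ⥤ᵇ 𝒳) : ℬ ⥤ᵇ localImage j where
  obj r := ⟨j.obj r, mem_hitSet_obj j r⟩
  map f := j.map f
  map_id r := j.map_id r
  map_comp f g := j.map_comp f g
  w := j.w

theorem isHomLift_localImage_iff (j : ℬ ⥤ᵇ 𝒳) {x y : LocalImage j} (φ : x ⟶ y) {R S : Mfd.{u} 𝕜}
    (f : R ⟶ S) : (localImage j).p.IsHomLift f φ ↔ 𝒳.p.IsHomLift (a := x.1) (b := y.1) f φ :=
  ((localImageIncl j).isHomLift_iff f φ).symm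

/-- Membership in the local image is stable under restriction and can be checked on a covering. -/
theorem isStack_localImage {j : ℬ ⥤ᵇ 𝒳} (h𝒳 : IsStack 𝒳) (hl : HasLifts ℬ) (r : ℬ.obj) :
    IsStack (localImage j) where
  groupoid :=
    { lift := fun (x : LocalImage j) U α => by
        obtain ⟨y, a, ha⟩ := h𝒳.groupoid.lift x.1 U α
        exact ⟨⟨y, fun m => mem_hitSet_of_map h𝒳.groupoid hl a (x.2 _)⟩, a,
          (isHomLift_localImage_iff j _ _).2 ha⟩
      factor := fun (x y z : LocalImage j) a b γ h => h𝒳.groupoid.factor x.1 y.1 z.1 a b γ h }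
  homs := fun (x y : LocalImage j) α I V f hf xs ρ φ hρ hφ compat =>
    h𝒳.homs x.1 y.1 α I V f hf (fun i => (xs i).1) ρ φ
      (fun i => (isHomLift_localImage_iff j _ _).1 (hρ i))
      (fun i => (isHomLift_localImage_iff j _ _).1 (hφ i))
      (fun i i' z a b e => compat i i' ⟨z, fun m => mem_hitSet_of_map h𝒳.groupoid hl a
        ((xs i).2 _)⟩ a b e)
  objects := fun U I V f hf W p₁ p₂ hW x w l r' hx hl' hr compat => by
    obtain ⟨y, ρ, hρ, e⟩ := h𝒳.objects U I V f hf W p₁ p₂ hW (fun i => (x i).1)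
      (fun i i' => (w i i').1) l r' hx (fun i i' => (isHomLift_localImage_iff j _ _).1 (hl' i i'))
      (fun i i' => (isHomLift_localImage_iff j _ _).1 (hr i i'))
      (fun i i' i'' z a b c => compat i i' i'' ⟨z, fun m => mem_hitSet_of_map h𝒳.groupoid hl a
        ((w i i').2 _)⟩ a b c)
    by_cases hI : Nonempty I
    -- A member of the covering is needed to identify the base of the glued object. For an empty
    -- covering any object of the substack is admissible, and `r` supplies one.
    · obtain ⟨i₀⟩ := hI
      have := hρ i₀
      obtain rfl := IsHomLift.codomain_eq 𝒳.p (f i₀) (ρ i₀)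
      have hy : ∀ m, m ∈ hitSet j y := fun m => by
        obtain ⟨i, hi⟩ := hf.exists_isNbhd m
        exact mem_hitSet_of_isNbhd (x i).2 (ρ i) hi (hρ i)
      exact ⟨⟨y, hy⟩, ρ, fun i => (isHomLift_localImage_iff j _ _).2 (hρ i), e⟩
    · have hI' : IsEmpty I := not_nonempty_iff.1 hI
      exact ⟨(toLocalImage j).obj r, fun i => hI'.elim i, fun i => hI'.elim i, fun i => hI'.elim i⟩

theorem isLocalEquiv_toLocalImage {j : ℬ ⥤ᵇ 𝒳}
    (full : ∀ (p q : ℬ.obj) (χ : j.obj p ⟶ j.obj q) (m : ℬ.p.obj p), ∃ (r : ℬ.obj) (ρ : r ⟶ p)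
      (φ : r ⟶ q), IsNbhd (ℬ.p.map ρ) m ∧ j.map φ = j.map ρ ≫ χ)
    (faithful : ∀ (p q : ℬ.obj) (φ ψ : p ⟶ q), j.map φ = j.map ψ → ∀ m : ℬ.p.obj p,
      ∃ (r : ℬ.obj) (ρ : r ⟶ p), IsNbhd (ℬ.p.map ρ) m ∧ ρ ≫ φ = ρ ≫ ψ) :
    IsLocalEquiv (toLocalImage j) where
  surj (x : LocalImage j) m := by
    obtain ⟨r, σ, f, hf, hσ⟩ := x.2 m
    exact ⟨r, σ, f, hf,
      (isHomLift_localImage_iff j (x := (toLocalImage j).obj r) (y := x) σ f).2 hσ⟩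
  full := full
  faithful := faithful

/-- A functor from the stack associated with `ℬ` to a stack `𝒳` is an open embedding if its
restriction `j` to `ℬ` is locally fully faithful and the set of points near which an object is in
the image of `j` is compatible with base change. -/
theorem IsAssociatedStack.exists_isOpenEmb {k : ℬ ⥤ᵇ 𝒬} (hk : IsAssociatedStack k)
    (hl : HasLifts ℬ) (r : ℬ.obj) {j : ℬ ⥤ᵇ 𝒳} (h𝒳 : IsStack 𝒳)
    (hj : IsLocalEquiv (toLocalImage j))
    (hmap : ∀ (x y : 𝒳.obj) (χ : x ⟶ y) (m : 𝒳.p.obj x), m ∈ hitSet j x →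
      𝒳.p.map χ m ∈ hitSet j y) :
    ∃ P : 𝒬 ⥤ᵇ 𝒳, Nonempty (k.comp P ≅ j) ∧ IsOpenEmb P := by
  have hj' : IsAssociatedStack (toLocalImage j) :=
    isAssociatedStack_iff.2 ⟨isStack_localImage h𝒳 hl r, hj⟩
  obtain ⟨E, hE, ⟨i⟩⟩ := hk.exists_comparison hl hj'.isStack
    (fun 𝒵 h𝒵 => hj'.precomp_isEquivalence hl h𝒵)
  have := hE.full
  have := hE.faithful
  refine ⟨E.comp (localImageIncl j), ⟨basedIsoWhiskerRight i (localImageIncl j)⟩, ?_⟩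
  have : (E.comp (localImageIncl j)).toFunctor.Full :=
    inferInstanceAs (E.toFunctor ⋙ (localImageIncl j).toFunctor).Full
  have : (E.comp (localImageIncl j)).toFunctor.Faithful :=
    inferInstanceAs (E.toFunctor ⋙ (localImageIncl j).toFunctor).Faithful
  refine IsOpenEmb.of_full_faithful _ h𝒳.groupoid (hitSet j) (isOpen_hitSet j) ?_ ?_
  · rintro x y χ _ ⟨m, rfl⟩
    exact hmap _ _ χ m ((E.obj x).2 m)
  · intro y U v hv
    obtain ⟨z, a, ha⟩ := h𝒳.groupoid.lift y U v
    have hz : ∀ m, m ∈ hitSet j z := fun m => mem_hitSet_of_map h𝒳.groupoid hl a (by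
      obtain rfl := IsHomLift.domain_eq 𝒳.p v a
      rw [← IsHomLift.eq_of_isHomLift 𝒳.p v a]
      exact hv ⟨m, rfl⟩)
    obtain ⟨x, φ, hφ⟩ := hE.surj ⟨z, hz⟩
    obtain ⟨φ', hφ'⟩ : ∃ φ' : (localImageIncl j).obj (E.obj x) ⟶ z,
        𝒳.p.IsHomLift (𝟙 (𝒳.p.obj z)) φ' := ⟨φ, (isHomLift_localImage_iff j _ _).1 hφ⟩
    refine ⟨x, φ' ≫ a, ?_⟩
    obtain rfl := IsHomLift.domain_eq 𝒳.p v a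
    have h := IsHomLift.comp 𝒳.p (𝟙 _) v φ' a
    rwa [Category.id_comp] at h

end LocalImage

end SatakeOrbifold

/-! ### Global quotients of charts -/

namespace SatakeOrbifold

open Mfd

variable {𝕜 : Type} [RCLike 𝕜]

namespace OrbifoldAtlas

variable {X : Type u} [TopologicalSpace X] {A : Type u} [SmallCategory A]
  (c : OrbifoldAtlas.{u} 𝕜 X A)

/-- The object of the total category given by a morphism to `V(a)`. -/
def totalMk {M : Mfd.{u} 𝕜} (a : A) (x : M ⟶ c.diagram.obj a) : (total c.diagram).obj :=
  (⟨a, M, x⟩ : TotalObj c.diagram)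

/-- The object of `cell a` given by a morphism to `V(a)`. -/
def cellMk {M : Mfd.{u} 𝕜} (a : A) (x : M ⟶ c.diagram.obj a) : (c.cell a).obj :=
  (⟨SingleObj.star _, M, x⟩ : TotalObj (autIncl a ⋙ c.diagram))

variable {c} in
/-- Morphisms of the total category. -/
def totalHom {M N : Mfd.{u} 𝕜} {a b : A} {x : M ⟶ c.diagram.obj a} {y : N ⟶ c.diagram.obj b}
    (f : a ⟶ b) (k : M ⟶ N) (h : x ≫ c.diagram.map f = k ≫ y) : c.totalMk a x ⟶ c.totalMk b y :=
  (⟨f, k, h⟩ : TotalHom (⟨a, M, x⟩ : TotalObj c.diagram) ⟨b, N, y⟩)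

variable {c} in
/-- Morphisms of `cell a`. -/
def cellHom {M N : Mfd.{u} 𝕜} {a : A} {x : M ⟶ c.diagram.obj a} {y : N ⟶ c.diagram.obj a}
    (f : Aut a) (k : M ⟶ N) (h : x ≫ c.diagram.map f.hom = k ≫ y) : c.cellMk a x ⟶ c.cellMk a y :=
  (⟨f, k, h⟩ : TotalHom (⟨SingleObj.star _, M, x⟩ : TotalObj (autIncl a ⋙ c.diagram))
    ⟨SingleObj.star _, N, y⟩)

theorem exists_eq_totalMk (p : (total c.diagram).obj) :
    ∃ (M : Mfd.{u} 𝕜) (a : A) (x : M ⟶ c.diagram.obj a), p = c.totalMk a x :=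
  ⟨TotalObj.base p, TotalObj.idx p, TotalObj.map p, rfl⟩

theorem exists_eq_cellMk {a : A} (p : (c.cell a).obj) :
    ∃ (M : Mfd.{u} 𝕜) (x : M ⟶ c.diagram.obj a), p = c.cellMk a x :=
  ⟨TotalObj.base p, TotalObj.map p, rfl⟩

theorem exists_eq_totalHom {M N : Mfd.{u} 𝕜} {a b : A} {x : M ⟶ c.diagram.obj a}
    {y : N ⟶ c.diagram.obj b} (φ : c.totalMk a x ⟶ c.totalMk b y) :
    ∃ (f : a ⟶ b) (k : M ⟶ N) (h : x ≫ c.diagram.map f = k ≫ y), φ = totalHom f k h :=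
  ⟨TotalHom.idx φ, TotalHom.base φ, TotalHom.w φ, rfl⟩

theorem exists_eq_cellHom {M N : Mfd.{u} 𝕜} {a : A} {x : M ⟶ c.diagram.obj a}
    {y : N ⟶ c.diagram.obj a} (φ : c.cellMk a x ⟶ c.cellMk a y) :
    ∃ (f : Aut a) (k : M ⟶ N) (h : x ≫ c.diagram.map f.hom = k ≫ y), φ = cellHom f k h :=
  ⟨TotalHom.idx φ, TotalHom.base φ, TotalHom.w φ, rfl⟩

theorem cellHom_one_w {M N : Mfd.{u} 𝕜} {a : A} (x : M ⟶ c.diagram.obj a) (k : N ⟶ M) :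
    (k ≫ x) ≫ c.diagram.map (Iso.hom (1 : Aut a)) = k ≫ x := by
  refine (congrArg ((k ≫ x) ≫ ·) (c.diagram.map_id a)).trans (Category.comp_id _)

theorem hasLifts_cell (a : A) : HasLifts (c.cell a) := by
  intro p U α
  obtain ⟨M, x, rfl⟩ := c.exists_eq_cellMk p
  exact ⟨_, cellHom 1 α (c.cellHom_one_w x α),
    IsHomLift.map (c.cell a).p (cellHom 1 α (c.cellHom_one_w x α))⟩

/-- The group component of an arrow of the transformation groupoid is locally constant, and the
constant ones come from `Aut(a)` through `ι`. -/
theorem isLocalEquiv_cellToChart (a : A) : IsLocalEquiv (c.cellToChart a) where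
  surj x m := by
    let y : (c.c.obj a).toAbstractChart.transGroupoid.Pts := x
    exact ⟨c.cellMk a y.map, 𝟙 _, 𝟙 y.base, isNbhd_id m, IsHomLift.id rfl⟩
  full p q χ m := by
    obtain ⟨M, x, rfl⟩ := c.exists_eq_cellMk p
    obtain ⟨N, y, rfl⟩ := c.exists_eq_cellMk q
    let χ' : GroupoidIn.PtsHom (⟨M, x⟩ : (c.c.obj a).toAbstractChart.transGroupoid.Pts) ⟨N, y⟩ := χ
    let h : M → (c.c.obj a).H := fun m => Sigma.fst (χ'.arr m)
    have hs : ∀ m, Sigma.snd (χ'.arr m) = x m := fun m => hom_congr_apply χ'.src m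
    have ht : ∀ m, (c.c.obj a).toAbstractChart.act (h m) (x m) = y (χ'.base m) := fun m => by
      rw [← hs]; exact hom_congr_apply χ'.tgt m
    obtain ⟨h₀, hh₀⟩ : ∃ h₀, h (show M from m) = h₀ := ⟨_, rfl⟩
    have ho : IsOpen {m' : M | h m' = h₀} :=
      ((isLocallyConstant_fst _).comp_continuous (continuous χ'.arr)).isOpen_fiber _
    let k := openSubι _ ho
    have hk : ∀ v, h (k v) = h₀ := fun v => v.2
    have hw : (k ≫ x) ≫ c.diagram.map (Iso.hom ((c.ι a).symm h₀)) = (k ≫ χ'.base) ≫ y :=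
      Mfd.hom_ext fun v => by
        refine (c.map_aut _ _).trans ?_
        rw [MulEquiv.apply_symm_apply]
        exact (congrArg (fun g => (c.c.obj a).act g (x (k v))) (hk v).symm).trans (ht _)
    refine ⟨_, cellHom 1 k (c.cellHom_one_w x k), cellHom ((c.ι a).symm h₀) (k ≫ χ'.base) hw,
      ⟨openEmb_openSubι _ ho, ?_⟩, ?_⟩
    · exact (range_openSubι _ ho).symm ▸ hh₀
    · refine GroupoidIn.PtsHom.ext rfl (Mfd.hom_ext fun v => ?_)
      refine congrArg (fun g => (⟨g, x (k v)⟩ : Σ _ : (c.c.obj a).H, (c.c.obj a).V)) ?_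
      change c.ι a ((c.ι a).symm h₀) = h (k v) * c.ι a 1
      rw [MulEquiv.apply_symm_apply, map_one, mul_one]
      exact (hk v).symm
  faithful p q φ ψ e m := by
    obtain ⟨M, x, rfl⟩ := c.exists_eq_cellMk p
    obtain ⟨N, y, rfl⟩ := c.exists_eq_cellMk q
    obtain ⟨f, k, h, rfl⟩ := c.exists_eq_cellHom φ
    obtain ⟨f', k', h', rfl⟩ := c.exists_eq_cellHom ψ
    obtain rfl : k = k' := congrArg GroupoidIn.PtsHom.base e
    have e' : c.ι a f = c.ι a f' := congrArg Sigma.fst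
      (hom_congr_apply (congrArg GroupoidIn.PtsHom.arr e) m)
    obtain rfl := (c.ι a).injective e'
    exact ⟨_, 𝟙 _, isNbhd_id m, rfl⟩

variable {c} {𝒳 : BasedCategory.{u, u + 1} (Mfd.{u} 𝕜)} {ℓ : total c.diagram ⥤ᵇ 𝒳}

/-- The arrow `(f, id)` of the total category lies over an identity, so `ℓ` inverts it. The section
carries the object given by `V(f) ∘ z` back to the one given by `z`. -/
theorem exists_section (h : IsGroupoidOver 𝒳) {d a : A} (f : d ⟶ a) {T : Mfd.{u} 𝕜}
    (z : T ⟶ c.diagram.obj d) : ∃ σ : ℓ.obj (c.totalMk a (z ≫ c.diagram.map f)) ⟶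
      ℓ.obj (c.totalMk d z), 𝒳.p.IsHomLift (𝟙 T) σ ∧
        σ ≫ ℓ.map (totalHom f (𝟙 T) (Category.id_comp _).symm) = 𝟙 _ := by
  have hκ : (total c.diagram).p.IsHomLift (𝟙 T)
      (totalHom (x := z) f (𝟙 T) (Category.id_comp _).symm) :=
    IsHomLift.map (total c.diagram).p (totalHom f (𝟙 T) (Category.id_comp _).symm)
  exact h.exists_factor (𝟙 T) (Category.comp_id _) (𝟙 _) _ (IsHomLift.id (ℓ.w_obj _))
    (ℓ.preserves_isHomLift _ _)

/-- Locally an arrow of `𝒳` between points of `V(a)` is a fraction with legs `f`, `g : d ⟶ a`. By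
the torsor property `g = f ≫ ψ`, so pushing the apex forward along `f` gives a fraction inside `cell
a`, with legs `1` and `ψ`. -/
theorem isLocalEquiv_toLocalImage_cell (hℓ : IsAssociatedStack ℓ) (a : A) :
    IsLocalEquiv (toLocalImage ((c.cellToTotal a).comp ℓ)) := by
  refine isLocalEquiv_toLocalImage (fun p q χ m => ?_) (fun p q φ ψ e m => ?_)
  · obtain ⟨M, x, rfl⟩ := c.exists_eq_cellMk p
    obtain ⟨N, y, rfl⟩ := c.exists_eq_cellMk q
    obtain ⟨r, ρ, φ, hρ, e⟩ := hℓ.isLocalEquiv.full (c.totalMk a x) (c.totalMk a y) χ m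
    obtain ⟨T, d, z, rfl⟩ := c.exists_eq_totalMk r
    obtain ⟨f, k, hf, rfl⟩ := c.exists_eq_totalHom ρ
    obtain ⟨g, l, hg, rfl⟩ := c.exists_eq_totalHom φ
    obtain ⟨ψ, rfl, -⟩ := c.isChartCategory.torsor d a f g
    have h₁ : (z ≫ c.diagram.map f) ≫ c.diagram.map (Iso.hom (1 : Aut a)) = k ≫ x :=
      (congrArg ((z ≫ c.diagram.map f) ≫ ·) (c.diagram.map_id a)).trans
        ((Category.comp_id _).trans hf)
    have h₂ : (z ≫ c.diagram.map f) ≫ c.diagram.map ψ.hom = l ≫ y := by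
      rw [← hg]
      exact (Category.assoc _ _ _).trans (congrArg (z ≫ ·) (c.diagram.map_comp _ _).symm)
    refine ⟨c.cellMk a (z ≫ c.diagram.map f), cellHom 1 k h₁, cellHom ψ l h₂, hρ, ?_⟩
    obtain ⟨σ, -, hσ⟩ := exists_section (ℓ := ℓ) hℓ.isStack.groupoid f z
    let κ : c.totalMk d z ⟶ c.totalMk a (z ≫ c.diagram.map f) :=
      totalHom f (𝟙 T) (Category.id_comp _).symm
    have e₁ : κ ≫ totalHom (𝟙 a) k h₁ = totalHom f k hf :=
      TotalHom.ext (Category.comp_id f) (Category.id_comp k)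
    have e₂ : κ ≫ totalHom ψ.hom l h₂ = totalHom (f ≫ ψ.hom) l hg :=
      TotalHom.ext rfl (Category.id_comp l)
    rw [← e₁, ← e₂, ℓ.map_comp, ℓ.map_comp] at e
    -- The arrow `κ` moves the apex from `V(d)` to `V(a)`; since `ℓ κ` is a split epimorphism it can
    -- be cancelled from the equation for the original span.
    have : Epi (ℓ.map κ) := (SplitEpi.mk σ hσ).epi
    exact (cancel_epi (ℓ.map κ)).1 (e.trans (Category.assoc _ _ _))
  · obtain ⟨M, x, rfl⟩ := c.exists_eq_cellMk p
    obtain ⟨N, y, rfl⟩ := c.exists_eq_cellMk q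
    obtain ⟨f, k, h, rfl⟩ := c.exists_eq_cellHom φ
    obtain ⟨f', k', h', rfl⟩ := c.exists_eq_cellHom ψ
    obtain ⟨r, ρ, hρ, e'⟩ := hℓ.isLocalEquiv.faithful (c.totalMk a x) (c.totalMk a y)
      (totalHom f.hom k h) (totalHom f'.hom k' h') e m
    have hk : k = k' := by
      have h₁ : (total c.diagram).p.IsHomLift k (totalHom f.hom k h) :=
        IsHomLift.map (total c.diagram).p (totalHom f.hom k h)
      have h₂ : (total c.diagram).p.IsHomLift k' (totalHom f'.hom k' h') :=
        IsHomLift.map (total c.diagram).p (totalHom f'.hom k' h')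
      have h₃ : 𝒳.p.IsHomLift k (ℓ.map (totalHom f.hom k h)) := ℓ.preserves_isHomLift _ _
      have h₄ : 𝒳.p.IsHomLift k' (ℓ.map (totalHom f.hom k h)) := by
        rw [show ℓ.map (totalHom f.hom k h) = ℓ.map (totalHom f'.hom k' h') from e]
        exact ℓ.preserves_isHomLift _ _
      exact isHomLift_unique _ h₃ h₄
    have hf : f = f' := Iso.ext (c.arrow_cancel (TotalHom.idx ρ) (congrArg TotalHom.idx e'))
    subst hk hf
    exact ⟨_, 𝟙 _, isNbhd_id m, rfl⟩

/-- Near the image point, `y` is given by a map `y₀` to some `V(b)`. The arrow from the chart `a` is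
locally a span with apex `d`. As `V(d) → V(b)` is étale, `y₀` lifts locally to `V(d)`, and the other
leg sends this lift to `V(a)`. The lift exists on a full neighbourhood in the base of `y`, even if
`χ` is not open. -/
theorem map_mem_hitSet (hℓ : IsAssociatedStack ℓ) (a : A) {x y : 𝒳.obj} (χ : x ⟶ y)
    {m : 𝒳.p.obj x} (hm : m ∈ hitSet ((c.cellToTotal a).comp ℓ) x) :
    𝒳.p.map χ m ∈ hitSet ((c.cellToTotal a).comp ℓ) y := by
  obtain ⟨r, σ, f, ⟨hf, n, rfl⟩, hσ⟩ := hm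
  obtain ⟨M, x₀, rfl⟩ := c.exists_eq_cellMk r
  obtain ⟨q, ψ, g, hg, hψ⟩ := hℓ.isLocalEquiv.surj y (𝒳.p.map χ (f n))
  obtain ⟨N, b, y₀, rfl⟩ := c.exists_eq_totalMk q
  obtain ⟨W, k, l, ⟨hk, w, rfl⟩, hkl⟩ := exists_nbhd_lift (isSmooth_hom (f ≫ 𝒳.p.map χ)) n hg
  have hw : l ≫ g = k ≫ f ≫ 𝒳.p.map χ := Mfd.hom_ext hkl
  let ρ : c.totalMk a (k ≫ x₀) ⟶ c.totalMk a x₀ := totalHom (𝟙 a) k (c.cellHom_one_w x₀ k)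
  have hρ : (total c.diagram).p.IsHomLift k ρ :=
        IsHomLift.map (total c.diagram).p ρ
  let σ' : ℓ.obj (c.totalMk a x₀) ⟶ x := σ
  have hσ' : 𝒳.p.IsHomLift f σ' := hσ
  obtain ⟨δ, hδ, -⟩ := hℓ.isStack.groupoid.exists_factor l hw (ℓ.map ρ ≫ σ' ≫ χ) ψ
    inferInstance hψ
  obtain ⟨t, θ, φ, hθ, e⟩ := hℓ.isLocalEquiv.full (c.totalMk a (k ≫ x₀)) (c.totalMk b y₀) δ w
  obtain ⟨T, d, z, rfl⟩ := c.exists_eq_totalMk t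
  obtain ⟨F, i, hF, rfl⟩ := c.exists_eq_totalHom θ
  obtain ⟨F', i', hF', rfl⟩ := c.exists_eq_totalHom φ
  obtain ⟨-, t, ht⟩ := hθ
  have ht : i t = w := ht
  have hi : i' = i ≫ l := by
    have h₁ : (total c.diagram).p.IsHomLift i' (totalHom F' i' hF') :=
        IsHomLift.map (total c.diagram).p (totalHom F' i' hF')
    have h₂ : (total c.diagram).p.IsHomLift i (totalHom F i hF) :=
        IsHomLift.map (total c.diagram).p (totalHom F i hF)
    have h₃ : 𝒳.p.IsHomLift i' (ℓ.map (totalHom F' i' hF')) := ℓ.preserves_isHomLift _ _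
    have h₄ : 𝒳.p.IsHomLift (i ≫ l) (ℓ.map (totalHom F' i' hF')) := by
      rw [e]; infer_instance
    exact isHomLift_unique _ h₃ h₄
  obtain ⟨U, k', l', u, hk', hu, hu', w'⟩ := (c.etale_map F').exists_local_lift y₀ (m := i' t)
    (w := z t) (hom_congr_apply hF' t)
  obtain ⟨τ, hτ, -⟩ := exists_section (ℓ := ℓ) hℓ.isStack.groupoid F l'
  have h₁ : (total c.diagram).p.IsHomLift k' (totalHom F' k' w'.symm) :=
        IsHomLift.map (total c.diagram).p (totalHom F' k' w'.symm)
  have h₂ : 𝒳.p.IsHomLift (𝟙 U ≫ k' ≫ g) (τ ≫ ℓ.map (totalHom F' k' w'.symm) ≫ ψ) := by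
    have h₃ := ℓ.preserves_isHomLift k' (totalHom F' k' w'.symm)
    have h₄ : 𝒳.p.IsHomLift (k' ≫ g) (ℓ.map (totalHom F' k' w'.symm) ≫ ψ) :=
      @IsHomLift.comp _ _ _ _ 𝒳.p _ _ _ _ _ _ k' g _ ψ h₃ hψ
    exact IsHomLift.comp (p := 𝒳.p) (𝟙 U) (k' ≫ g) τ _
  rw [Category.id_comp] at h₂
  refine ⟨c.cellMk a (l' ≫ c.diagram.map F), τ ≫ ℓ.map (totalHom F' k' w'.symm) ≫ ψ, k' ≫ g,
    ⟨hk'.comp hg.1, u, ?_⟩, h₂⟩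
  change g (k' u) = _
  rw [hu, hi]
  change g (l (i t)) = _
  rw [ht, hkl]; rfl

/-- The open embedding of the global quotient of a chart. -/
theorem exists_isOpenEmb (hℓ : IsAssociatedStack ℓ) (a : A)
    {𝒬 : BasedCategory.{u, u + 1} (Mfd.{u} 𝕜)} {q : c.chartGroupoid a ⥤ᵇ 𝒬}
    (hq : IsAssociatedStack q) : ∃ πhat : 𝒬 ⥤ᵇ 𝒳,
      Nonempty ((c.cellToChart a).comp (q.comp πhat) ≅ (c.cellToTotal a).comp ℓ) ∧
      IsOpenEmb πhat := by
  have hk : IsAssociatedStack ((c.cellToChart a).comp q) := isAssociatedStack_iff.2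
    ⟨hq.isStack, (c.isLocalEquiv_cellToChart a).comp hq.isLocalEquiv⟩
  exact hk.exists_isOpenEmb (c.hasLifts_cell a) (c.cellMk a (𝟙 _)) hℓ.isStack
    (isLocalEquiv_toLocalImage_cell hℓ a) (fun x y χ m hm => map_mem_hitSet hℓ a χ hm)

end OrbifoldAtlas

end SatakeOrbifold

/-! ### The coarse space -/

namespace SatakeOrbifold

open Mfd

variable {𝕜 : Type} [RCLike 𝕜]

section Coarse

variable {𝒳 : BasedCategory.{u, u + 1} (Mfd.{u} 𝕜)}

/-- The restriction of `x` to the point `m` of its base has the class `κ`. -/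
def ClassAt {U : Mfd.{u} 𝕜} (x : 𝒳.obj) (m : U) (κ : Coarse 𝒳) : Prop :=
  ∃ (w : 𝒳.obj) (hw : 𝒳.p.obj w = pt.{u} 𝕜) (φ : w ⟶ x),
    𝒳.p.IsHomLift (point m) φ ∧ coarseMk w hw = κ

theorem coarseMk_eq_of_hom {x y : 𝒳.obj} (hx : 𝒳.p.obj x = pt.{u} 𝕜) (hy : 𝒳.p.obj y = pt.{u} 𝕜)
    (φ : x ⟶ y) (hφ : 𝒳.p.IsHomLift (𝟙 (pt.{u} 𝕜)) φ) : coarseMk x hx = coarseMk y hy :=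
  Quotient.sound (Relation.ReflTransGen.single (Or.inl
    ⟨Functor.Fiber.homMk 𝒳.p (pt.{u} 𝕜) φ⟩))

/-- In a fibre every arrow is invertible, so a zigzag collapses to a single arrow. -/
theorem IsGroupoidOver.exists_hom_of_coarseMk_eq (h : IsGroupoidOver 𝒳) {x y : 𝒳.obj}
    {hx : 𝒳.p.obj x = pt.{u} 𝕜} {hy : 𝒳.p.obj y = pt.{u} 𝕜} (e : coarseMk x hx = coarseMk y hy) :
    ∃ φ : x ⟶ y, 𝒳.p.IsHomLift (𝟙 (pt.{u} 𝕜)) φ := by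
  have e' : Zigzag (Functor.Fiber.mk hx : 𝒳.p.Fiber (pt.{u} 𝕜)) (Functor.Fiber.mk hy) :=
    Quotient.exact e
  suffices H : ∀ b : 𝒳.p.Fiber (pt.{u} 𝕜), Zigzag (Functor.Fiber.mk hx) b →
      ∃ φ : x ⟶ Functor.Fiber.fiberInclusion.obj b, 𝒳.p.IsHomLift (𝟙 (pt.{u} 𝕜)) φ from H _ e'
  intro b hb
  induction hb with
  | refl => exact ⟨𝟙 x, IsHomLift.id hx⟩
  | tail _ hz ih =>
    obtain ⟨φ, hφ⟩ := ih
    rcases hz with ⟨⟨f⟩⟩ | ⟨⟨f⟩⟩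
    · exact ⟨φ ≫ Functor.Fiber.fiberInclusion.map f, inferInstance⟩
    · obtain ⟨c, hc, -⟩ := h.exists_factor (𝟙 _) (Category.comp_id _) φ
        (Functor.Fiber.fiberInclusion.map f) hφ inferInstance
      exact ⟨c, hc⟩

theorem ClassAt.unique (h : IsGroupoidOver 𝒳) {U : Mfd.{u} 𝕜} {x : 𝒳.obj} {m : U} {κ κ' : Coarse 𝒳}
    (h₁ : ClassAt x m κ) (h₂ : ClassAt x m κ') : κ = κ' := by
  obtain ⟨w, hw, φ, hφ, rfl⟩ := h₁
  obtain ⟨w', hw', φ', hφ', rfl⟩ := h₂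
  obtain ⟨c, hc, -⟩ := h.exists_factor (𝟙 _) (Category.id_comp _) φ φ' hφ hφ'
  exact coarseMk_eq_of_hom hw hw' c hc

theorem ClassAt.map {U V : Mfd.{u} 𝕜} {x y : 𝒳.obj} {m : U} {κ : Coarse 𝒳} (h : ClassAt x m κ)
    {f : U ⟶ V} {χ : x ⟶ y} (hχ : 𝒳.p.IsHomLift f χ) : ClassAt y (f m) κ := by
  obtain ⟨w, hw, φ, hφ, rfl⟩ := h
  exact ⟨w, hw, φ ≫ χ, IsHomLift.comp (p := 𝒳.p) (point m) f φ χ, rfl⟩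

theorem classAt_coarseMk {x : 𝒳.obj} (hx : 𝒳.p.obj x = pt.{u} 𝕜) (m : pt.{u} 𝕜) :
    ClassAt x m (coarseMk x hx) :=
  ⟨x, hx, 𝟙 x, IsHomLift.id hx, rfl⟩

/-- Relates the class at a point of an arbitrary object `α y` to the quotient map from `G₀`, which
is defined by objects over the one-point manifold only. -/
theorem classAt_coarseMap {G : GroupoidIn.{u} 𝕜} (α : G.toBased ⥤ᵇ 𝒳) (y : G.Pts) (m : y.base) :
    ClassAt (α.obj y) m (coarseMap α (y.map m)) := by
  let z : G.Pts := ⟨pt.{u} 𝕜, point (y.map m)⟩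
  let φ : z ⟶ y := ⟨point m, point (y.map m) ≫ G.one,
    by rw [Category.assoc, G.one_s, Category.comp_id],
    by rw [Category.assoc, G.one_t, Category.comp_id]; rfl⟩
  have h : G.toBased.p.IsHomLift (point m) φ := IsHomLift.map G.toBased.p φ
  exact ⟨_, _, α.map φ, α.preserves_isHomLift (point m) φ, rfl⟩

end Coarse

namespace OrbifoldAtlas

variable {X : Type u} [TopologicalSpace X] {A : Type u} [SmallCategory A]
  {c : OrbifoldAtlas.{u} 𝕜 X A} {𝒳 : BasedCategory.{u, u + 1} (Mfd.{u} 𝕜)}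
  {ℓ : total c.diagram ⥤ᵇ 𝒳}

variable (ℓ) in
theorem classAt_coarsePoint {M : Mfd.{u} 𝕜} (a : A) (x : M ⟶ c.diagram.obj a) (m : M) :
    ClassAt (ℓ.obj (c.totalMk a x)) m (c.coarsePoint ℓ a (x m)) := by
  have e : point (x m) ≫ c.diagram.map (𝟙 a) = point m ≫ x :=
    (congrArg (point (x m) ≫ ·) (c.diagram.map_id a)).trans (Category.comp_id _)
  refine ⟨_, _, ℓ.map (totalHom (𝟙 a) (point m) e), ?_, rfl⟩
  have h : (total c.diagram).p.IsHomLift (point m) (totalHom (𝟙 a) (point m) e) :=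
    IsHomLift.map (total c.diagram).p (totalHom (𝟙 a) (point m) e)
  exact ℓ.preserves_isHomLift (point m) _

theorem exists_coarsePoint_eq (hℓ : IsAssociatedStack ℓ) (κ : Coarse 𝒳) :
    ∃ (a : A) (v : c.diagram.obj a), c.coarsePoint ℓ a v = κ := by
  obtain ⟨⟨x, hx⟩, rfl⟩ := Quotient.exists_rep κ
  obtain ⟨q, φ, f, ⟨-, n, -⟩, hφ⟩ := hℓ.isLocalEquiv.surj_at hx PUnit.unit
  obtain ⟨N, a, y, rfl⟩ := c.exists_eq_totalMk q
  exact ⟨a, y n, ((classAt_coarsePoint ℓ a y n).map hφ).unique hℓ.isStack.groupoid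
    (classAt_coarseMk hx _)⟩

/-- An arrow between two points of the stack is locally a span of charts, and arrows of charts
commute with the projections to `X`. Conversely, points with the same image in `X` are joined by a
span, whose legs become isomorphisms in the stack. -/
theorem coarsePoint_eq_iff (hℓ : IsAssociatedStack ℓ) {a b : A} {v : c.diagram.obj a}
    {w : c.diagram.obj b} :
    c.coarsePoint ℓ a v = c.coarsePoint ℓ b w ↔ c.proj a v = c.proj b w := by
  constructor
  · intro e
    obtain ⟨χ, -⟩ := hℓ.isStack.groupoid.exists_hom_of_coarseMk_eq e
    obtain ⟨r, ρ, φ, ⟨-, t, -⟩, -⟩ := hℓ.isLocalEquiv.full (c.totalMk a (point v))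
      (c.totalMk b (point w)) χ PUnit.unit
    obtain ⟨T, d, z, rfl⟩ := c.exists_eq_totalMk r
    obtain ⟨f, k, hf, rfl⟩ := c.exists_eq_totalHom ρ
    obtain ⟨g, l, hg, rfl⟩ := c.exists_eq_totalHom φ
    have h₁ : c.diagram.map f (z t) = v := hom_congr_apply hf t
    have h₂ : c.diagram.map g (z t) = w := hom_congr_apply hg t
    rw [← h₁, ← h₂, proj_map, proj_map]
  · intro e
    obtain ⟨d, z, f, g, rfl, rfl⟩ := c.exists_span_of_proj_eq e
    have key : ∀ {b : A} (f : d ⟶ b),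
        c.coarsePoint ℓ d z = c.coarsePoint ℓ b (c.diagram.map f z) := fun {b} f => by
      have e : point z ≫ c.diagram.map f = 𝟙 _ ≫ point (c.diagram.map f z) := rfl
      have h : (total c.diagram).p.IsHomLift (𝟙 (pt.{u} 𝕜)) (totalHom f (𝟙 _) e) :=
        IsHomLift.map (total c.diagram).p (totalHom f (𝟙 _) e)
      exact coarseMk_eq_of_hom _ _ (ℓ.map (totalHom f (𝟙 _) e))
        (@BasedFunctor.preserves_isHomLift _ _ _ _ ℓ _ _ _ _ _ _ h)
    exact (key f).symm.trans (key g)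

/-- The bijection from the coarse space of the realization onto the space of the atlas. -/
theorem exists_coarse_equiv (hℓ : IsAssociatedStack ℓ) :
    ∃ e : Coarse 𝒳 ≃ X, ∀ (a : A) (v : (c.c.obj a).V),
      e (c.coarsePoint ℓ a v) = (c.c.obj a).π v := by
  choose a v h using exists_coarsePoint_eq hℓ
  have key : ∀ (b : A) (w : c.diagram.obj b),
      c.proj (a (c.coarsePoint ℓ b w)) (v (c.coarsePoint ℓ b w)) = c.proj b w :=
    fun b w => (coarsePoint_eq_iff hℓ).1 (h _)
  refine ⟨Equiv.ofBijective (fun κ => c.proj (a κ) (v κ)) ⟨fun κ κ' e => ?_, fun x => ?_⟩, key⟩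
  · rw [← h κ, ← h κ']
    exact (coarsePoint_eq_iff hℓ).2 e
  · obtain ⟨b, w, rfl⟩ := c.cover x
    exact ⟨_, key b w⟩

/-- The presentation `α` and the charts are compared locally, in both directions. Continuity then
follows from that of the projections `π(a)`, openness from their openness. -/
theorem isHomeomorph_coarse (hℓ : IsAssociatedStack ℓ) {e : Coarse 𝒳 ≃ X}
    (he : ∀ (a : A) (v : (c.c.obj a).V), e (c.coarsePoint ℓ a v) = (c.c.obj a).π v)
    {G : GroupoidIn.{u} 𝕜} {α : G.toBased ⥤ᵇ 𝒳} (hα : IsAssociatedStack α) :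
    @IsHomeomorph _ _ (coarseTopology α) _ e := by
  let := coarseTopology α
  refine ⟨continuous_coinduced_dom.2 (continuous_iff_continuousAt.2 fun g => ?_),
    fun U hU => isOpen_iff_forall_mem_open.2 ?_, e.bijective⟩
  -- The universal object over `G₀` is near `g` given by a map `x` to some `V(a)`; in these terms
  -- the map from `G₀` to `X` is `π(a) ∘ x`.
  · let y : G.Pts := ⟨G.G₀, 𝟙 _⟩
    obtain ⟨q, φ, f, ⟨hf, n, rfl⟩, hφ⟩ := hℓ.isLocalEquiv.surj_at (α.w_obj y) g
    obtain ⟨N, a, x, rfl⟩ := c.exists_eq_totalMk q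
    have key : ∀ n : N, e (coarseMap α (f n)) = (c.c.obj a).π (x n) := fun n =>
      (congrArg e ((classAt_coarseMap α y (f n)).unique hℓ.isStack.groupoid
        ((classAt_coarsePoint ℓ a x n).map hφ))).trans (he a _)
    refine hf.isOpenEmbedding.continuousAt_iff.1 (Continuous.continuousAt ?_)
    exact ((c.c.obj a).π_cont.comp (continuous x)).congr fun n => (key n).symm
  · rintro _ ⟨κ, hκ, rfl⟩
    obtain ⟨a, v, rfl⟩ := exists_coarsePoint_eq hℓ κ
    -- In the other direction, the universal object over `V(a)` is near `v` given by a map `y.map`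
    -- to `G₀`. Points of `V(a)` near `v` with class in `U` thus form an open set, and `π(a)` maps
    -- it to an open subset of the image of `U`.
    obtain ⟨y, φ, f, ⟨hf, w, rfl⟩, hφ⟩ := hα.isLocalEquiv.surj_at
      (ℓ.w_obj (c.totalMk a (𝟙 (c.diagram.obj a)))) v
    let y : G.Pts := y
    have key : ∀ w : y.base, c.coarsePoint ℓ a (f w) = coarseMap α (y.map w) := fun w =>
      (classAt_coarsePoint ℓ a (𝟙 _) (f w)).unique hℓ.isStack.groupoid
        ((classAt_coarseMap α y w).map hφ)
    have hU' : IsOpen (coarseMap α ⁻¹' U) := isOpen_coinduced.1 hU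
    refine ⟨(c.c.obj a).π '' (f '' (y.map ⁻¹' (coarseMap α ⁻¹' U))), ?_, ?_, ?_⟩
    · rintro _ ⟨_, ⟨w, hw, rfl⟩, rfl⟩
      exact ⟨_, hw, (congrArg e (key w).symm).trans (he a _)⟩
    · exact (c.c.obj a).π_open _ (hf.isOpenEmbedding.isOpenMap _ (hU'.preimage (continuous y.map)))
    · exact ⟨_, ⟨w, show coarseMap α (y.map w) ∈ U from key w ▸ hκ, rfl⟩, (he a _).symm⟩

end OrbifoldAtlas

end SatakeOrbifold

open SatakeOrbifold in
theorem theorem3 (𝕜 : Type) [RCLike 𝕜] (X : Type u) [TopologicalSpace X] [T2Space X]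
    (A : Type u) [SmallCategory A] (c : OrbifoldAtlas.{u} 𝕜 X A) :
    (∃ (𝒳 : BasedCategory.{u, u + 1} (Mfd.{u} 𝕜)) (ℓ : total c.diagram ⥤ᵇ 𝒳),
      c.IsRealization ℓ) ∧
    ∀ (𝒳 : BasedCategory.{u, u + 1} (Mfd.{u} 𝕜)) (ℓ : total c.diagram ⥤ᵇ 𝒳),
      c.IsRealization ℓ →
      IsOrbifold 𝒳 ∧
      (∀ a : A,
        (∃ (𝒬 : BasedCategory.{u, u + 1} (Mfd.{u} 𝕜)) (q : c.chartGroupoid a ⥤ᵇ 𝒬),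
          IsAssociatedStack q) ∧
        ∀ (𝒬 : BasedCategory.{u, u + 1} (Mfd.{u} 𝕜)) (q : c.chartGroupoid a ⥤ᵇ 𝒬),
          IsAssociatedStack q →
          ∃ πhat : 𝒬 ⥤ᵇ 𝒳,
            Nonempty ((c.cellToChart a).comp (q.comp πhat) ≅ (c.cellToTotal a).comp ℓ) ∧
            IsOpenEmb πhat) ∧
      ∃ e : Coarse 𝒳 ≃ X,
        (∀ (a : A) (v : (c.c.obj a).V), e (c.coarsePoint ℓ a v) = (c.c.obj a).π v) ∧
        ∀ (G : GroupoidIn.{u} 𝕜) (α : G.toBased ⥤ᵇ 𝒳), G.IsEtale → G.IsSeparated →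
          IsAssociatedStack α → @IsHomeomorph _ _ (coarseTopology α) _ e := by
  refine ⟨c.exists_isRealization, fun 𝒳 ℓ h => ?_⟩
  have hℓ := h.isAssociatedStack
  obtain ⟨e, he⟩ := OrbifoldAtlas.exists_coarse_equiv hℓ
  exact ⟨h.isOrbifold, fun a => ⟨GroupoidIn.exists_isAssociatedStack _,
    fun 𝒬 q hq => OrbifoldAtlas.exists_isOpenEmb hℓ a hq⟩, e, he,
    fun G α _ _ hα => OrbifoldAtlas.isHomeomorph_coarse hℓ he hα⟩
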